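/- **Notation.** Write $e(x)=e^{2\pi i x}$ and $\widehat f(\xi)=\int_{\mathbb R} f(x)e(-\xi x)\,dx$; $\varphi$ is Euler's function. For real $\Delta,N>10$ put $Q=\Delta\sqrt N$ and let $\mathcal Q_{\Delta,N}$ be the family of products $q=bc$ of positive integers $b,c$ with $bc\in[Q,2Q]$, $Q^{1/1000}\le b\le 2Q^{1/1000}$, $bc$ squarefree, and all prime factors of $bc$ larger than $\Delta^{2001}$. Sums over $q\in\mathcal Q_{\Delta,N}$ run over the pairs $(b,c)$ (so $q$ is counted once for each admissible factorization), and $\sum_{(a,q)=1}$ runs over $1\le a\le q$ coprime to $q$. For real functions $\Phi,V$ set $$F_{\Phi,V,\theta}(\xi,\eta)=\int_0^\infty \widehat\Phi(2\xi x)\,e(2\xi\theta x)\,x\,V(x^2)\,e\Big(-\frac{\eta x}{2}\Big)dx,$$ $$\mathcal B_{a,\Delta,q}=\{(u,v)\in\mathbb Z^2:\ 1\le|u|\le\Delta^4,\ u\equiv 2va \bmod q\},$$ $$\widetilde R_{\Phi,V}\Big(\frac aq-\theta;N\Big)=\sum_{(u,v)\in\mathcal B_{a,\Delta,q}} e\Big(-\frac{\overline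 q^{\,2}u^2}{4v}+\frac{u^2}{4vq^2}\Big)F_{\Phi,V,N\theta}\Big(\frac v{\sqrt N},\frac{u}{q/\sqrt N}\Big),$$ where $\overline q$ is the inverse of $q$ modulo $4v$. For a function $w$ and $\boldsymbol t,\boldsymbol u\in\mathbb R^k$ set $$H_{\Phi,V,k,\theta,\Delta}(\boldsymbol t,\boldsymbol u)=\int_{\mathbb R^k}\prod_{i=1}^kF_{\Phi,V,\theta}(\xi_i,u_i)\;e(-\langle\boldsymbol t,\boldsymbol\xi\rangle)\;w(\Delta^3(\xi_1+\dots+\xi_k))\,d\boldsymbol\xi .$$ **Proposition 1.7.** Let $0\le\Phi,V\le1$ be non-zero, smooth, compactly supported functions on $\mathbb R$, with $V$ supported in $(1/2,3)$. For every fixed $k\in\mathbb N$ and every $\varepsilon>0$ there is a constant $C=C(\Phi,V,k,\varepsilon)$ such that the following holds. Let $w$ be a smooth real function compactly supported in $(-1/2,1/2)$ with $w(0)=1$; let $\phi\ge0$ be smooth, supported in $[-1/100,1/100]$, with $\int_{\mathbb R}\phi=1$; and let $\Delta,N>10$ be real numbers with $\Delta^{2001}<\log N$. Then all sums and integrals below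 converge absolutely, and $$\Bigg|\frac{N}{\sum_{q\in\mathcal Q_{\Delta,N}}\varphi(q)}\sum_{\substack{(a,q)=1\\ q\in\mathcal Q_{\Delta,N}}}\int_{\mathbb R}\widetilde R_{\Phi,V}\Big(\frac aq-\theta;N\Big)^k\phi(N\theta)\,d\theta-\frac{2}{3\Delta^2}\int_{\mathbb R}\int_\Delta^{2\Delta}\sum_{\substack{\boldsymbol u,\boldsymbol t\in\mathbb Z^k\\ \langle\boldsymbol 1,\boldsymbol u\rangle=0=\langle\boldsymbol u,\boldsymbol t\rangle\\ \forall i:\ 1\le|u_i|\le\Delta^4}}H_{\Phi,V,k,\theta,\Delta}\Big(\frac{\boldsymbol t}{v},\frac{\boldsymbol u}{v}\Big)\frac{dv}{v^{k-1}}\,\phi(\theta)\,d\theta\Bigg|\le C\,N^{-1/8000+\varepsilon}.$$ -/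

import Mathlib

open scoped FourierTransform ContDiff

noncomputable section

namespace MinorArcMoments

/-- The additive character `e(x) = exp(2πix)`. -/
def e (x : ℝ) : ℂ := Complex.exp (2 * Real.pi * Complex.I * x)

/-- The Fourier transform `∫ Φ(x) e(-ξx) dx` of a real-valued function. -/
def hat (Φ : ℝ → ℝ) (ξ : ℝ) : ℂ := 𝓕 (fun x : ℝ => (Φ x : ℂ)) ξ

/-- `F_{Φ,V,θ}(ξ,η) = ∫_0^∞ Φ^(2ξx) e(2ξθx) x V(x²) e(-ηx/2) dx`. -/
def F (Φ V : ℝ → ℝ) (θ ξ η : ℝ) : ℂ :=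
  ∫ x in Set.Ioi (0 : ℝ),
    hat Φ (2 * ξ * x) * e (2 * ξ * θ * x) * ((x * V (x ^ 2) : ℝ) : ℂ) * e (-(η * x / 2))

/-- The set `B_{a,Δ,q}` of pairs `(u,v)` of integers with `1 ≤ |u| ≤ Δ⁴` and
`u ≡ 2va mod q`. -/
def B (Δ : ℝ) (a q : ℕ) : Set (ℤ × ℤ) :=
  {p | 1 ≤ |p.1| ∧ ((|p.1| : ℤ) : ℝ) ≤ Δ ^ 4 ∧ p.1 ≡ 2 * p.2 * (a : ℤ) [ZMOD (q : ℤ)]}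

/-- The least non-negative representative of the inverse of `q` modulo `4|v|`
(for `v ≠ 0` and `q` coprime to `4v`). -/
def qbar (q : ℕ) (v : ℤ) : ℕ := ((q : ZMod (4 * v.natAbs))⁻¹).val

theorem qbar_spec (q : ℕ) (v : ℤ) (h : Nat.Coprime q (4 * v.natAbs)) :
    q * qbar q v ≡ 1 [MOD 4 * v.natAbs] := by
  rw [← ZMod.natCast_eq_natCast_iff]
  rcases Nat.eq_zero_or_pos (4 * v.natAbs) with h0 | h0
  · rw [h0, Nat.coprime_zero_right] at h
    subst h
    have hv : v = 0 := by omega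
    subst hv
    simp only [qbar]
    change ((1 * ((1 : ℕ) : ZMod 0)⁻¹.val : ℕ) : ZMod 0) = ((1 : ℕ) : ZMod 0)
    decide
  · have : NeZero (4 * v.natAbs) := ⟨h0.ne'⟩
    simp only [qbar, Nat.cast_mul, ZMod.natCast_val, ZMod.cast_id', id_eq, Nat.cast_one]
    exact ZMod.coe_mul_inv_eq_one q h

/-- The summand of `R~` belonging to the pair `p = (u,v)`. -/
def Rterm (Φ V : ℝ → ℝ) (N : ℝ) (q : ℕ) (θ : ℝ) (p : ℤ × ℤ) : ℂ :=
  e (-((qbar q p.2 : ℝ) ^ 2 * (p.1 : ℝ) ^ 2 / (4 * (p.2 : ℝ)))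
      + (p.1 : ℝ) ^ 2 / (4 * (p.2 : ℝ) * (q : ℝ) ^ 2))
    * F Φ V (N * θ) ((p.2 : ℝ) / Real.sqrt N) ((p.1 : ℝ) / ((q : ℝ) / Real.sqrt N))

/-- `R~_{Φ,V}(a/q - θ; N)`, the sum being over `(u,v) ∈ B_{a,Δ,q}`. -/
def Rtilde (Φ V : ℝ → ℝ) (Δ N : ℝ) (a q : ℕ) (θ : ℝ) : ℂ :=
  ∑' p : B Δ a q, Rterm Φ V N q θ p

open Classical in
/-- The moduli `q = ab` of the minor arcs, with `Q = Δ√N`. They are recorded by their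
factorizations: the elements are the pairs `(a,b)` of positive integers such that
`Q ≤ ab ≤ 2Q`, `Q^(1/1000) ≤ a ≤ 2 Q^(1/1000)`, every prime dividing `ab` exceeds `Δ^2001`,
and `ab` is squarefree. -/
def moduli (Δ N : ℝ) : Finset (ℕ × ℕ) :=
  (Finset.Icc 1 ⌊2 * (Δ * Real.sqrt N)⌋₊ ×ˢ Finset.Icc 1 ⌊2 * (Δ * Real.sqrt N)⌋₊).filter
    fun m =>
      Δ * Real.sqrt N ≤ ((m.1 * m.2 : ℕ) : ℝ) ∧
      ((m.1 * m.2 : ℕ) : ℝ) ≤ 2 * (Δ * Real.sqrt N) ∧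
      (Δ * Real.sqrt N) ^ (1 / 1000 : ℝ) ≤ (m.1 : ℝ) ∧
      (m.1 : ℝ) ≤ 2 * (Δ * Real.sqrt N) ^ (1 / 1000 : ℝ) ∧
      (∀ p : ℕ, p.Prime → p ∣ m.1 * m.2 → Δ ^ 2001 < (p : ℝ)) ∧
      Squarefree (m.1 * m.2)

/-- The bounds on `a` and `b` built into `moduli` are no restriction. -/
theorem mem_moduli (Δ N : ℝ) (a b : ℕ) :
    (a, b) ∈ moduli Δ N ↔ 0 < a ∧ 0 < b ∧
      Δ * Real.sqrt N ≤ ((a * b : ℕ) : ℝ) ∧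
      ((a * b : ℕ) : ℝ) ≤ 2 * (Δ * Real.sqrt N) ∧
      (Δ * Real.sqrt N) ^ (1 / 1000 : ℝ) ≤ (a : ℝ) ∧
      (a : ℝ) ≤ 2 * (Δ * Real.sqrt N) ^ (1 / 1000 : ℝ) ∧
      (∀ p : ℕ, p.Prime → p ∣ a * b → Δ ^ 2001 < (p : ℝ)) ∧
      Squarefree (a * b) := by
  simp only [moduli, Finset.mem_filter, Finset.mem_product, Finset.mem_Icc]
  constructor
  · rintro ⟨⟨⟨h1, -⟩, ⟨h2, -⟩⟩, h⟩
    exact ⟨h1, h2, h⟩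
  · rintro ⟨h1, h2, h⟩
    have hab : a * b ≤ ⌊2 * (Δ * Real.sqrt N)⌋₊ := Nat.le_floor h.2.1
    refine ⟨⟨⟨h1, le_trans (Nat.le_mul_of_pos_right a h2) hab⟩,
      ⟨h2, le_trans (Nat.le_mul_of_pos_left b h1) hab⟩⟩, h⟩

/-- The normalization `L = ∑ φ(q)`. -/
def totientSum (Δ N : ℝ) : ℝ :=
  ∑ m ∈ moduli Δ N, (Nat.totient (m.1 * m.2) : ℝ)

/-- The `k`-th moment of `R~` against the minor arc measure,
`(N / L) ∑_q ∑_{1 ≤ c ≤ q, (c,q) = 1} ∫ R~(c/q - θ; N)^k φ(Nθ) dθ`. -/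
def moment (Φ V φ : ℝ → ℝ) (k : ℕ) (Δ N : ℝ) : ℂ :=
  ((N / totientSum Δ N : ℝ) : ℂ) *
    ∑ m ∈ moduli Δ N,
      ∑ c ∈ (Finset.Icc 1 (m.1 * m.2)).filter (fun c => Nat.Coprime c (m.1 * m.2)),
        ∫ θ : ℝ, Rtilde Φ V Δ N c (m.1 * m.2) θ ^ k * (φ (N * θ) : ℂ)

/-- The integrand of `H`. -/
def Hintegrand (Φ V w : ℝ → ℝ) {k : ℕ} (θ Δ : ℝ) (t u ξ : Fin k → ℝ) : ℂ :=
  (∏ i, F Φ V θ (ξ i) (u i)) * e (-(∑ i, t i * ξ i)) * (w (∑ i, Δ ^ 3 * ξ i) : ℂ)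

/-- `H_{Φ,V,k,θ,Δ}(t,u) = ∫ ∏ᵢ F_{Φ,V,θ}(ξᵢ,uᵢ) e(-⟨t,ξ⟩) w(Δ³ξ₁ + ... + Δ³ξₖ) dξ` over `ℝᵏ`. -/
def H (Φ V w : ℝ → ℝ) {k : ℕ} (θ Δ : ℝ) (t u : Fin k → ℝ) : ℂ :=
  ∫ ξ : Fin k → ℝ, Hintegrand Φ V w θ Δ t u ξ

/-- The pairs `(u,t)` of integer vectors with `⟨1,u⟩ = 0 = ⟨u,t⟩` and `1 ≤ |uᵢ| ≤ Δ⁴`. -/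
def lattice (k : ℕ) (Δ : ℝ) : Set ((Fin k → ℤ) × (Fin k → ℤ)) :=
  {p | ∑ i, p.1 i = 0 ∧ ∑ i, p.1 i * p.2 i = 0 ∧
    ∀ i, 1 ≤ |p.1 i| ∧ ((|p.1 i| : ℤ) : ℝ) ≤ Δ ^ 4}

/-- The summand `H(t/v, u/v)` belonging to the pair `p = (u,t)`. -/
def Hterm (Φ V w : ℝ → ℝ) {k : ℕ} (θ Δ v : ℝ) (p : (Fin k → ℤ) × (Fin k → ℤ)) : ℂ :=
  H Φ V w θ Δ (fun i => (p.2 i : ℝ) / v) (fun i => (p.1 i : ℝ) / v)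

/-- The integrand `∑_{u,t} H(t/v, u/v) v^{-(k-1)} φ(θ)` of the main term. -/
def mainIntegrand (Φ V w φ : ℝ → ℝ) (k : ℕ) (Δ θ v : ℝ) : ℂ :=
  (∑' p : lattice k Δ, Hterm Φ V w θ Δ v (p : (Fin k → ℤ) × (Fin k → ℤ)))
    / ((v ^ ((k : ℤ) - 1) : ℝ) : ℂ) * (φ θ : ℂ)

/-- The main term `(2 / 3Δ²) ∫_ℝ ∫_Δ^{2Δ} ∑_{u,t} H(t/v, u/v) v^{-(k-1)} dv φ(θ) dθ`. -/
def mainTerm (Φ V w φ : ℝ → ℝ) (k : ℕ) (Δ : ℝ) : ℂ :=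
  ((2 / (3 * Δ ^ 2) : ℝ) : ℂ) *
    ∫ θ : ℝ, ∫ v in Set.Icc Δ (2 * Δ), mainIntegrand Φ V w φ k Δ θ v

end MinorArcMoments

end

open MinorArcMoments

/-!
# Moments of the minor arc function `R~`

Both sides of the asymptotic formula are averages over `q` (respectively `v`) and `θ` of one and
the same quantity (`density`). For `v` of size `Δ` it is
`∑_u ∑_m ∫_0^1 ∏ᵢ F_θ(v (mᵢ + uᵢ β), uᵢ / v) dβ`, where `u`, `m ∈ ℤᵏ` have coordinate sums
`U = M = 0` and `1 ≤ |uᵢ| ≤ Δ⁴`.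

* On the side of the main term, `ξ ↦ F_θ(ξ, η)` is the Fourier transform of a continuous kernel of
  compact support. Writing the condition `⟨u, t⟩ = 0` as an integral over `β` and `w` as an
  inverse Fourier transform, Poisson summation in every coordinate of `t` turns the lattice sum
  over `H` into the density (`Cutoffs.tsum_Hterm`). The values of `w` at the points `Δ³ v M` are
  all that remains of `w`, and they vanish unless `M = 0`.

* On the side of the moment, let `h` be the inverse of `2a` modulo `q`. Then `B_{a,Δ,q}` consists
  of the pairs `(u, uh + qm)`, and reciprocity turns the phase of such a pair into an additive
  character modulo `q²` (`e_reciprocity`). Hence `R~ᵏ` is the sum over `u` and `m` of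
  `e(4⁻¹ (U h⁻¹ - q M h⁻²) / q²) ∏ᵢ F_θ(v (mᵢ + uᵢ h/q), uᵢ/v)` with `v = q/√N`
  (`Cutoffs.Rtilde_pow`). In the sum over `h` the terms with `U = M = 0` have no oscillating phase
  and give `φ(q)` times the density, because the fractions `h/q` are equidistributed.

* The terms with `(U, M) ≠ (0, 0)` are negligible by partial summation and bounds for the
  incomplete exponential sums over `h` (`norm_sum_phase_le`). For `U = 0` the phase has period
  `q`, and completion and Kloosterman's fourth moment argument apply
  (`norm_invSqSum_pow_four_le`). For `U ≠ 0` the modulus is `q²` while the sum has length at most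
  `q`, so completion gains nothing; the small factor `b` of `q = bc` is used instead. Van der
  Corput's inequality with shifts by multiples of `b²` removes the component of the phase modulo
  `b²`, and along progressions modulo `c` the component modulo `c²` is linear, so that the
  correlations are geometric sums (`norm_sum_phase_ne_zero_le`). The saving is
  `b^(1/4) ≥ N^(1/8000)`, which is where the exponent in the theorem comes from.

* Finally `q/√N` is distributed on `[Δ, 2Δ]` with density proportional to `v dv` when `q` is
  weighted by `φ(q)`, with a power saving in `N`. For a fixed `b` this follows by opening the
  conditions on `c` with Möbius functions; the sieve costs little, as the product of the excluded
  primes has few divisors because of `Δ^2001 < log N` (`Scale.norm_average_moduli_sub_le`). The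
  constant of proportionality need not be known: the constant function `1` determines it.

All powers of `Δ` are at most powers of `log N` and disappear in `N^ε`.
-/

namespace MinorArcMoments
open MeasureTheory Filter Topology

/-- The standing assumptions on the two cutoff functions. -/
structure Cutoffs (Φ V : ℝ → ℝ) : Prop where
  smoothΦ : ContDiff ℝ ∞ Φ
  suppΦ : HasCompactSupport Φ
  boundΦ : ∀ x, 0 ≤ Φ x ∧ Φ x ≤ 1
  contV : Continuous V
  suppV : tsupport V ⊆ Set.Ioo (1 / 2) 3
  boundV : ∀ x, 0 ≤ V x ∧ V x ≤ 1

/-! ### The additive character -/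

lemma norm_e (x : ℝ) : ‖e x‖ = 1 := by
  rw [e, show (2 * Real.pi * Complex.I * x : ℂ) = ((2 * Real.pi * x : ℝ) : ℂ) * Complex.I by
    push_cast; ring]
  exact Complex.norm_exp_ofReal_mul_I _

lemma e_add (x y : ℝ) : e (x + y) = e x * e y := by
  simp only [e, ← Complex.exp_add]; congr 1; push_cast; ring

@[simp] lemma e_zero : e 0 = 1 := by simp [e]

lemma e_int (n : ℤ) : e n = 1 := by
  rw [e]; convert Complex.exp_int_mul_two_pi_mul_I n using 2; push_cast; ring

lemma e_sum {ι : Type*} (s : Finset ι) (f : ι → ℝ) : e (∑ i ∈ s, f i) = ∏ i ∈ s, e (f i) := by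
  classical
  induction s using Finset.induction_on with
  | empty => simp
  | insert a s ha ih => rw [Finset.sum_insert ha, Finset.prod_insert ha, e_add, ih]

@[fun_prop] lemma continuous_e : Continuous e := by
  unfold e; fun_prop

lemma norm_e_sub_le (x y : ℝ) : ‖e x - e y‖ ≤ 2 * Real.pi * |x - y| := by
  have h : e x - e y = e y * (Complex.exp (Complex.I * ((2 * Real.pi * (x - y) : ℝ) : ℂ)) - 1) := by
    have : Complex.exp (Complex.I * ((2 * Real.pi * (x - y) : ℝ) : ℂ)) = e (x - y) := by
      rw [e]; congr 1; push_cast; ring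
    rw [this, mul_sub, ← e_add, mul_one]; congr 2; ring
  rw [h, norm_mul, norm_e, one_mul]
  refine (Real.norm_exp_I_mul_ofReal_sub_one_le).trans ?_
  rw [Real.norm_eq_abs, abs_mul, abs_of_pos Real.two_pi_pos]

lemma fourier_eq_integral_e (f : ℝ → ℂ) (ξ : ℝ) : 𝓕 f ξ = ∫ x, f x * e (-(ξ * x)) := by
  rw [Real.fourier_eq']
  congr 1; ext x
  rw [smul_eq_mul, mul_comm, e]
  congr 2
  simp only [RCLike.inner_apply, conj_trivial]
  push_cast; ring

lemma fourierInv_eq_integral_e (f : ℝ → ℂ) (ξ : ℝ) : 𝓕⁻ f ξ = ∫ x, f x * e (ξ * x) := by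
  rw [Real.fourierInv_eq']
  congr 1; ext x
  rw [smul_eq_mul, mul_comm, e]
  congr 2
  simp only [RCLike.inner_apply, conj_trivial]
  push_cast; ring

/-! ### Decay and regularity of `F` -/

lemma schwartz_bound (f : SchwartzMap ℝ ℂ) (n : ℕ) :
    ∃ C, 0 ≤ C ∧ ∀ s, ‖f s‖ ≤ C / (1 + |s|) ^ n ∧ ‖deriv f s‖ ≤ C / (1 + |s|) ^ n := by
  refine ⟨2 ^ n * ((Finset.Iic (n, 1)).sup fun m => SchwartzMap.seminorm ℝ m.1 m.2) f,
    by positivity, fun s => ?_⟩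
  have hpos : (0 : ℝ) < (1 + |s|) ^ n := by positivity
  constructor
  · rw [le_div_iff₀ hpos, mul_comm]
    simpa using SchwartzMap.one_add_le_sup_seminorm_apply (𝕜 := ℝ) (m := (n, 1)) (k := n) (n := 0)
      le_rfl (by norm_num) f s
  · rw [le_div_iff₀ hpos, mul_comm]
    have := SchwartzMap.one_add_le_sup_seminorm_apply (𝕜 := ℝ) (m := (n, 1)) (k := n) (n := 1)
      le_rfl le_rfl f s
    rwa [norm_iteratedFDeriv_eq_norm_iteratedDeriv, iteratedDeriv_one] at this

/-- A smooth compactly supported real function, as a complex-valued Schwartz function. -/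
noncomputable def toSchwartz {g : ℝ → ℝ} (h₁ : HasCompactSupport g) (h₂ : ContDiff ℝ ∞ g) :
    SchwartzMap ℝ ℂ :=
  HasCompactSupport.toSchwartzMap (f := fun x => (g x : ℂ))
    (h₁.comp_left (g := fun x : ℝ => (x : ℂ)) (by simp)) (Complex.ofRealCLM.contDiff.comp h₂)

lemma toSchwartz_apply {g : ℝ → ℝ} (h₁ : HasCompactSupport g) (h₂ : ContDiff ℝ ∞ g) (x : ℝ) :
    toSchwartz h₁ h₂ x = (g x : ℂ) := rfl

lemma hat_eq {g : ℝ → ℝ} (h₁ : HasCompactSupport g) (h₂ : ContDiff ℝ ∞ g) :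
    hat g = 𝓕 (toSchwartz h₁ h₂) := by
  ext ξ
  rw [hat]
  exact congrFun (SchwartzMap.fourier_coe (toSchwartz h₁ h₂)).symm ξ

variable {Φ V : ℝ → ℝ}

lemma Cutoffs.hat_bound (hc : Cutoffs Φ V) : Differentiable ℝ (hat Φ) ∧ ∃ C, 0 ≤ C ∧
    ∀ s, ‖hat Φ s‖ ≤ C / (1 + |s|) ^ 3 ∧ ‖deriv (hat Φ) s‖ ≤ C / (1 + |s|) ^ 3 := by
  rw [hat_eq hc.suppΦ hc.smoothΦ]
  exact ⟨SchwartzMap.differentiable _, schwartz_bound _ 3⟩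

lemma Cutoffs.continuous_hat (hc : Cutoffs Φ V) : Continuous (hat Φ) :=
  hc.hat_bound.1.continuous

lemma Cutoffs.V_sq_eq_zero (hc : Cutoffs Φ V) {x : ℝ} (hx : 0 < x)
    (h : x ≤ 1 / 2 ∨ 2 < x) : V (x ^ 2) = 0 := by
  by_contra hne
  have := hc.suppV (subset_tsupport _ hne)
  rcases h with h | h <;> nlinarith [this.1, this.2]

/-- The integrand of `F`. -/
noncomputable def Fintegrand (Φ V : ℝ → ℝ) (θ ξ η x : ℝ) : ℂ :=
  hat Φ (2 * ξ * x) * e (2 * ξ * θ * x) * ((x * V (x ^ 2) : ℝ) : ℂ) * e (-(η * x / 2))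

lemma Cutoffs.F_eq (hc : Cutoffs Φ V) (θ ξ η : ℝ) :
    F Φ V θ ξ η = ∫ x in (1 / 2 : ℝ)..2, Fintegrand Φ V θ ξ η x := by
  rw [intervalIntegral.integral_of_le (by norm_num), F]
  refine (setIntegral_eq_of_subset_of_forall_sdiff_eq_zero measurableSet_Ioi
    (fun x hx => lt_trans (by norm_num) hx.1) ?_)
  rintro x ⟨hx, hx'⟩
  have : V (x ^ 2) = 0 := by
    apply hc.V_sq_eq_zero hx
    by_contra hcon
    push Not at hcon
    exact hx' ⟨hcon.1, hcon.2⟩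
  simp [this]

lemma Cutoffs.continuous_Fintegrand (hc : Cutoffs Φ V) :
    Continuous fun p : (ℝ × ℝ × ℝ) × ℝ => Fintegrand Φ V p.1.1 p.1.2.1 p.1.2.2 p.2 := by
  have h1 := hc.continuous_hat
  have h2 := hc.contV
  unfold Fintegrand
  fun_prop

lemma Cutoffs.continuous_F (hc : Cutoffs Φ V) :
    Continuous fun p : ℝ × ℝ × ℝ => F Φ V p.1 p.2.1 p.2.2 := by
  simp_rw [hc.F_eq]
  exact intervalIntegral.continuous_parametric_intervalIntegral_of_continuous'
    (f := fun p : ℝ × ℝ × ℝ => Fintegrand Φ V p.1 p.2.1 p.2.2) hc.continuous_Fintegrand _ _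

lemma norm_mul_V_sq_le (hc : Cutoffs Φ V) {x : ℝ} (hx : x ∈ Set.uIoc (1 / 2 : ℝ) 2) :
    ‖((x * V (x ^ 2) : ℝ) : ℂ)‖ ≤ 2 := by
  rw [Set.uIoc_of_le (by norm_num)] at hx
  have := hc.boundV (x ^ 2)
  rw [Complex.norm_real, Real.norm_of_nonneg (mul_nonneg (by linarith [hx.1]) this.1)]
  nlinarith [hx.1, hx.2]

/-- The decay of `F` in `ξ`, uniform in the other two variables, and the corresponding Lipschitz
bound. The hypothesis on `T` bounds the distance to the origin from below along the segment. -/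
lemma Cutoffs.F_bound (hc : Cutoffs Φ V) : ∃ C, 0 ≤ C ∧
    (∀ θ ξ η, ‖F Φ V θ ξ η‖ ≤ C / (1 + |ξ|) ^ 3) ∧
    ∀ θ ξ ξ' η η' T : ℝ, 0 < T → (∀ σ ∈ Set.uIcc ξ ξ', T ≤ 1 + |σ|) →
      ‖F Φ V θ ξ η - F Φ V θ ξ' η'‖ ≤ C * (1 + |θ|) * (|ξ - ξ'| + |η - η'|) / T ^ 3 := by
  obtain ⟨hd, C, hC, hb⟩ := hc.hat_bound
  have hat_le : ∀ s T : ℝ, 0 < T → T ≤ 1 + |s| → ‖hat Φ s‖ ≤ C / T ^ 3 := fun s T hT h =>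
    (hb s).1.trans (by gcongr)
  have scale : ∀ x ∈ Set.uIoc (1 / 2 : ℝ) 2, ∀ σ : ℝ, |σ| ≤ |2 * σ * x| ∧ 0 ≤ x ∧ x ≤ 2 := by
    intro x hx σ
    rw [Set.uIoc_of_le (by norm_num)] at hx
    have hx0 : 0 ≤ x := by linarith [hx.1]
    rw [abs_mul, abs_mul, abs_two, abs_of_nonneg hx0]
    exact ⟨by nlinarith [abs_nonneg σ, hx.1], hx0, hx.2⟩
  refine ⟨100 * C, by positivity, fun θ ξ η => ?_, fun θ ξ ξ' η η' T hT hseg => ?_⟩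
  · rw [hc.F_eq]
    have : ∀ x ∈ Set.uIoc (1 / 2 : ℝ) 2,
        ‖Fintegrand Φ V θ ξ η x‖ ≤ C / (1 + |ξ|) ^ 3 * 2 := by
      intro x hx
      rw [Fintegrand, norm_mul, norm_mul, norm_mul, norm_e, norm_e, mul_one, mul_one]
      gcongr
      · exact hat_le _ _ (by positivity) (by linarith [(scale x hx ξ).1])
      · exact norm_mul_V_sq_le hc hx
    refine (intervalIntegral.norm_integral_le_of_norm_le_const this).trans ?_
    have : 0 ≤ C / (1 + |ξ|) ^ 3 := by positivity
    rw [mul_div_assoc]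
    norm_num
    linarith
  · rw [hc.F_eq, hc.F_eq, ← intervalIntegral.integral_sub]
    rotate_left
    · exact (hc.continuous_Fintegrand.comp (f := fun x : ℝ => ((θ, ξ, η), x))
        (by fun_prop)).intervalIntegrable _ _
    · exact (hc.continuous_Fintegrand.comp (f := fun x : ℝ => ((θ, ξ', η'), x))
        (by fun_prop)).intervalIntegrable _ _
    have key : ∀ x ∈ Set.uIoc (1 / 2 : ℝ) 2,
        ‖Fintegrand Φ V θ ξ η x - Fintegrand Φ V θ ξ' η' x‖ ≤
          C / T ^ 3 * (8 * Real.pi * (1 + |θ|) * (|ξ - ξ'| + |η - η'|)) * 2 := by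
      intro x hx
      obtain ⟨-, hx0, hx2⟩ := scale x hx 0
      have e1 : Fintegrand Φ V θ ξ η x - Fintegrand Φ V θ ξ' η' x =
          ((hat Φ (2 * ξ * x) - hat Φ (2 * ξ' * x)) * e (2 * ξ * θ * x) * e (-(η * x / 2)) +
          hat Φ (2 * ξ' * x) * ((e (2 * ξ * θ * x) - e (2 * ξ' * θ * x)) * e (-(η * x / 2))
            + e (2 * ξ' * θ * x) * (e (-(η * x / 2)) - e (-(η' * x / 2)))))
          * ((x * V (x ^ 2) : ℝ) : ℂ) := by
        simp only [Fintegrand]; ring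
      rw [e1, norm_mul]
      refine mul_le_mul ?_ (norm_mul_V_sq_le hc hx) (norm_nonneg _) (by positivity)
      have h1 : ‖hat Φ (2 * ξ * x) - hat Φ (2 * ξ' * x)‖ ≤ C / T ^ 3 * (4 * |ξ - ξ'|) := by
        have := Convex.norm_image_sub_le_of_norm_deriv_le (𝕜 := ℝ) (f := hat Φ)
          (s := Set.uIcc (2 * ξ' * x) (2 * ξ * x)) (C := C / T ^ 3) (x := 2 * ξ' * x)
          (y := 2 * ξ * x) (fun s _ => hd s) ?_ (convex_uIcc _ _) Set.left_mem_uIcc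
          Set.right_mem_uIcc
        · refine this.trans ?_
          gcongr
          rw [Real.norm_eq_abs, show 2 * ξ * x - 2 * ξ' * x = (2 * x) * (ξ - ξ') by ring, abs_mul,
            abs_of_nonneg (by positivity : 0 ≤ 2 * x)]
          gcongr; linarith
        · intro s hs
          refine (hb s).2.trans ?_
          gcongr
          have : s ∈ (fun σ => 2 * σ * x) '' Set.uIcc ξ ξ' := by
            have hfun : (fun σ => 2 * σ * x) = fun σ => (2 * x) * σ := by ext; ring
            rw [hfun, Set.image_const_mul_uIcc, Set.uIcc_comm]
            rw [show 2 * x * ξ' = 2 * ξ' * x by ring, show 2 * x * ξ = 2 * ξ * x by ring]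
            exact hs
          obtain ⟨σ, hσ, rfl⟩ := this
          linarith [hseg σ hσ, (scale x hx σ).1]
      have h2 : ‖hat Φ (2 * ξ' * x)‖ ≤ C / T ^ 3 :=
        hat_le _ _ hT (by linarith [hseg ξ' Set.right_mem_uIcc, (scale x hx ξ').1])
      have h3 : ‖e (2 * ξ * θ * x) - e (2 * ξ' * θ * x)‖ ≤ 2 * Real.pi * (4 * |θ| * |ξ - ξ'|) := by
        refine (norm_e_sub_le _ _).trans (mul_le_mul_of_nonneg_left ?_ Real.two_pi_pos.le)
        rw [show 2 * ξ * θ * x - 2 * ξ' * θ * x = (2 * x) * (θ * (ξ - ξ')) by ring, abs_mul,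
          abs_of_nonneg (by positivity : 0 ≤ 2 * x), abs_mul θ, mul_assoc 4]
        gcongr; linarith
      have h4 : ‖e (-(η * x / 2)) - e (-(η' * x / 2))‖ ≤ 2 * Real.pi * |η - η'| := by
        refine (norm_e_sub_le _ _).trans (mul_le_mul_of_nonneg_left ?_ Real.two_pi_pos.le)
        rw [show -(η * x / 2) - -(η' * x / 2) = (x / 2) * (η' - η) by ring, abs_mul,
          abs_of_nonneg (by positivity : 0 ≤ x / 2), abs_sub_comm η']
        nlinarith [abs_nonneg (η - η')]
      refine (norm_add_le _ _).trans ?_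
      rw [norm_mul, norm_mul, norm_mul, norm_e, norm_e, mul_one, mul_one]
      have h5 : ‖(e (2 * ξ * θ * x) - e (2 * ξ' * θ * x)) * e (-(η * x / 2))
            + e (2 * ξ' * θ * x) * (e (-(η * x / 2)) - e (-(η' * x / 2)))‖ ≤
          2 * Real.pi * (4 * |θ| * |ξ - ξ'|) + 2 * Real.pi * |η - η'| := by
        refine (norm_add_le _ _).trans ?_
        rw [norm_mul, norm_mul, norm_e, norm_e, mul_one, one_mul]
        gcongr
      calc _ ≤ C / T ^ 3 * (4 * |ξ - ξ'|) + C / T ^ 3 *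
            (2 * Real.pi * (4 * |θ| * |ξ - ξ'|) + 2 * Real.pi * |η - η'|) := by gcongr
        _ = C / T ^ 3 * (4 * |ξ - ξ'| +
            (2 * Real.pi * (4 * |θ| * |ξ - ξ'|) + 2 * Real.pi * |η - η'|)) := by ring
        _ ≤ _ := by
          gcongr
          have := Real.pi_gt_three
          have a1 : 0 ≤ Real.pi * |θ| * |η - η'| := by positivity
          have a2 : 0 ≤ (Real.pi - 3) * |ξ - ξ'| := mul_nonneg (by linarith) (abs_nonneg _)
          have a3 : 0 ≤ Real.pi * |η - η'| := by positivity
          have a4 := abs_nonneg (ξ - ξ')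
          nlinarith
    refine (intervalIntegral.norm_integral_le_of_norm_le_const key).trans ?_
    have h0 : 0 ≤ C / T ^ 3 * ((1 + |θ|) * (|ξ - ξ'| + |η - η'|)) := by positivity
    have h1 : 100 * C * (1 + |θ|) * (|ξ - ξ'| + |η - η'|) / T ^ 3 =
      100 * (C / T ^ 3 * ((1 + |θ|) * (|ξ - ξ'| + |η - η'|))) := by ring
    have h2 : C / T ^ 3 * (8 * Real.pi * (1 + |θ|) * (|ξ - ξ'| + |η - η'|)) * 2 * |2 - 1 / 2| =
      24 * Real.pi * (C / T ^ 3 * ((1 + |θ|) * (|ξ - ξ'| + |η - η'|))) := by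
      rw [show |(2 : ℝ) - 1 / 2| = 3 / 2 by norm_num]; ring
    rw [h1, h2]
    gcongr
    linarith [Real.pi_lt_d2]

/-! ### `F` as a Fourier transform, and one-dimensional Poisson summation -/

lemma summable_inv_one_add_abs_pow {n : ℕ} (hn : 2 ≤ n) :
    Summable fun m : ℤ => 1 / (1 + |(m : ℝ)|) ^ n := by
  have h0 : Summable fun m : ℤ => 1 / (m : ℝ) ^ 2 + if m = 0 then (1 : ℝ) else 0 :=
    (Real.summable_one_div_int_pow.2 one_lt_two).add
      (summable_of_hasFiniteSupport ((Set.finite_singleton (0 : ℤ)).subset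
        (by intro m hm; by_contra h; simp_all)))
  refine h0.of_nonneg_of_le (fun m => by positivity) fun m => ?_
  rcases eq_or_ne m 0 with rfl | hm
  · simp
  · have h1 : 1 ≤ 1 + |(m : ℝ)| := by linarith [abs_nonneg (m : ℝ)]
    have h2 : (0 : ℝ) < |(m : ℝ)| := by positivity
    simp only [hm, if_false, add_zero]
    rw [← sq_abs (m : ℝ)]
    gcongr
    calc |(m : ℝ)| ^ 2 ≤ (1 + |(m : ℝ)|) ^ 2 := by gcongr; linarith
      _ ≤ _ := pow_le_pow_right₀ h1 hn

lemma one_add_abs_le_mul {v : ℝ} (hv : 1 ≤ v) (m α : ℝ) :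
    (1 + |m|) / (1 + |α|) ≤ 1 + |v * (m + α)| := by
  rw [div_le_iff₀ (by positivity), abs_mul, abs_of_nonneg (by linarith : 0 ≤ v)]
  have h1 : |m| ≤ |m + α| + |α| := by simpa using abs_sub (m + α) α
  have h2 : |m + α| ≤ v * |m + α| := le_mul_of_one_le_left (abs_nonneg _) hv
  nlinarith [abs_nonneg α, abs_nonneg (m + α), mul_nonneg (abs_nonneg α) (abs_nonneg (m + α))]

lemma Cutoffs.F_lattice_bound (hc : Cutoffs Φ V) : ∃ C, 0 ≤ C ∧
    ∀ θ η α v m : ℝ, 1 ≤ v →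
      ‖F Φ V θ (v * (m + α)) η‖ ≤ C * (1 + |α|) ^ 3 * (1 / (1 + |m|) ^ 3) := by
  obtain ⟨C, hC, hF, -⟩ := hc.F_bound
  refine ⟨C, hC, fun θ η α v m hv => (hF _ _ _).trans ?_⟩
  have h := one_add_abs_le_mul hv m α
  calc C / (1 + |v * (m + α)|) ^ 3 ≤ C / ((1 + |m|) / (1 + |α|)) ^ 3 := by gcongr
    _ = _ := by field_simp

lemma Cutoffs.summable_F (hc : Cutoffs Φ V) (θ η α : ℝ) {v : ℝ} (hv : 1 ≤ v) :
    Summable fun n : ℤ => ‖F Φ V θ (v * (n + α)) η‖ := by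
  obtain ⟨C, hC, h⟩ := hc.F_lattice_bound
  exact Summable.of_nonneg_of_le (fun _ => norm_nonneg _) (fun n => h θ η α v n hv)
    ((summable_inv_one_add_abs_pow (by norm_num)).mul_left _)

lemma Cutoffs.integrable_F (hc : Cutoffs Φ V) (θ η : ℝ) :
    Integrable fun ξ => F Φ V θ ξ η := by
  obtain ⟨C, hC, hF, -⟩ := hc.F_bound
  refine Integrable.mono' (g := fun ξ => C * (1 + ξ ^ 2)⁻¹)
    (integrable_inv_one_add_sq.const_mul C)
    (hc.continuous_F.comp (f := fun ξ : ℝ => (θ, ξ, η)) (by fun_prop)).aestronglyMeasurable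
    (Eventually.of_forall fun ξ => (hF θ ξ η).trans ?_)
  rw [div_eq_mul_inv]
  gcongr
  have h := abs_nonneg ξ
  rw [← sq_abs ξ]
  nlinarith [mul_nonneg h h, mul_nonneg h (mul_nonneg h h)]

/-- The integrand of `Fkernel`; the truncation of `x` from below only serves to make it continuous
everywhere. -/
noncomputable def kernelIntegrand (Φ V : ℝ → ℝ) (θ η z x : ℝ) : ℂ :=
  ((Φ (θ + z / (2 * max x (1 / 2))) * (V (x ^ 2) / 2) : ℝ) : ℂ) * e (-(η * x / 2))

/-- The compactly supported function of `z` whose Fourier transform is `ξ ↦ F_{Φ,V,θ}(ξ,η)`; it is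
obtained by inserting the definition of `Φ^` into that of `F`. -/
noncomputable def Fkernel (Φ V : ℝ → ℝ) (θ η z : ℝ) : ℂ :=
  ∫ x in (1 / 2 : ℝ)..2, kernelIntegrand Φ V θ η z x

lemma Cutoffs.continuous_kernelIntegrand (hc : Cutoffs Φ V) :
    Continuous fun p : (ℝ × ℝ × ℝ) × ℝ => kernelIntegrand Φ V p.1.1 p.1.2.1 p.1.2.2 p.2 := by
  have h1 := hc.smoothΦ.continuous
  have h2 := hc.contV
  have h3 : Continuous fun p : (ℝ × ℝ × ℝ) × ℝ => p.1.2.2 / (2 * max p.2 (1 / 2)) := by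
    refine Continuous.div (by fun_prop) (by fun_prop) fun p => ?_
    have : (1 / 2 : ℝ) ≤ max p.2 (1 / 2) := le_max_right _ _
    positivity
  unfold kernelIntegrand
  fun_prop

lemma Cutoffs.continuous_Fkernel (hc : Cutoffs Φ V) (θ η : ℝ) : Continuous (Fkernel Φ V θ η) :=
  intervalIntegral.continuous_parametric_intervalIntegral_of_continuous'
    (f := fun z : ℝ => kernelIntegrand Φ V θ η z)
    (hc.continuous_kernelIntegrand.comp (f := fun p : ℝ × ℝ => ((θ, η, p.1), p.2)) (by fun_prop))
    _ _

lemma Cutoffs.exists_radius (hc : Cutoffs Φ V) : ∃ R, 0 ≤ R ∧ ∀ y, R < |y| → Φ y = 0 := by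
  obtain ⟨R, hR⟩ := hc.suppΦ.isCompact.isBounded.exists_norm_le
  refine ⟨max R 0, le_max_right _ _, fun y hy => ?_⟩
  by_contra h
  have := hR y (subset_tsupport _ h)
  rw [Real.norm_eq_abs] at this
  linarith [le_max_left R 0]

/-- Outside a rectangle the integrand of the kernel vanishes. -/
lemma Cutoffs.kernelIntegrand_eq_zero (hc : Cutoffs Φ V) (θ : ℝ) : ∃ Z, 0 ≤ Z ∧
    ∀ η z x, Z < |z| ∨ 2 < |x| → kernelIntegrand Φ V θ η z x = 0 := by
  obtain ⟨R, hR, hΦ⟩ := hc.exists_radius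
  refine ⟨4 * (R + |θ|), by positivity, fun η z x h => ?_⟩
  have h0 : Φ (θ + z / (2 * max x (1 / 2))) * V (x ^ 2) = 0 := by
    rcases le_or_gt |x| 2 with hx | hx
    · have hz := h.resolve_right (by linarith)
      rw [hΦ, zero_mul]
      set d := 2 * max x (1 / 2)
      have hd0 : 0 < d := by
        have : (1 / 2 : ℝ) ≤ max x (1 / 2) := le_max_right _ _
        simp only [d]; linarith
      have hd4 : d ≤ 4 := by
        have : max x (1 / 2) ≤ 2 := max_le ((le_abs_self x).trans hx) (by norm_num)
        simp only [d]; linarith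
      have h1 : |z / d| ≤ |θ + z / d| + |θ| := by
        simpa using abs_sub (θ + z / d) θ
      have h2 : |z| / 4 ≤ |z / d| := by
        rw [abs_div, abs_of_pos hd0]; gcongr
      linarith
    · rw [← sq_abs, hc.V_sq_eq_zero (by linarith) (Or.inr hx), mul_zero]
  rw [kernelIntegrand, show Φ (θ + z / (2 * max x (1 / 2))) * (V (x ^ 2) / 2) =
    Φ (θ + z / (2 * max x (1 / 2))) * V (x ^ 2) / 2 by ring, h0]
  simp

lemma Cutoffs.Fkernel_eq_zero (hc : Cutoffs Φ V) (θ : ℝ) : ∃ Z, 0 ≤ Z ∧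
    ∀ η z, Z < |z| → Fkernel Φ V θ η z = 0 := by
  obtain ⟨Z, hZ, h⟩ := hc.kernelIntegrand_eq_zero θ
  refine ⟨Z, hZ, fun η z hz => ?_⟩
  rw [Fkernel]
  simp [h η z _ (Or.inl hz)]

lemma Cutoffs.hasCompactSupport_Fkernel (hc : Cutoffs Φ V) (θ η : ℝ) :
    HasCompactSupport (Fkernel Φ V θ η) := by
  obtain ⟨Z, -, h⟩ := hc.Fkernel_eq_zero θ
  refine HasCompactSupport.intro (isCompact_Icc (a := -Z) (b := Z)) fun z hz => h η z ?_
  by_contra hcon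
  exact hz (abs_le.1 (not_lt.1 hcon))

lemma Cutoffs.fourier_Fkernel (hc : Cutoffs Φ V) (θ η ξ : ℝ) :
    𝓕 (Fkernel Φ V θ η) ξ = F Φ V θ ξ η := by
  rw [fourier_eq_integral_e, hc.F_eq, intervalIntegral.integral_of_le (by norm_num)]
  obtain ⟨Z, -, hZ⟩ := hc.kernelIntegrand_eq_zero θ
  have hswap := integral_integral_swap_of_hasCompactSupport (μ := volume)
    (ν := volume.restrict (Set.Ioc (1 / 2 : ℝ) 2))
    (f := fun z x => kernelIntegrand Φ V θ η z x * e (-(ξ * z))) ?_ ?_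
  rotate_left
  · have := (hc.continuous_kernelIntegrand.comp (f := fun p : ℝ × ℝ => ((θ, η, p.1), p.2))
      (by fun_prop))
    exact this.mul (by fun_prop)
  · refine HasCompactSupport.intro
      ((isCompact_Icc (a := -Z) (b := Z)).prod (isCompact_Icc (a := (-2 : ℝ)) (b := 2))) ?_
    rintro ⟨z, x⟩ hzx
    simp only [Function.uncurry]
    rw [hZ, zero_mul]
    by_contra hcon
    push Not at hcon
    exact hzx ⟨abs_le.1 hcon.1, abs_le.1 hcon.2⟩
  calc ∫ z, Fkernel Φ V θ η z * e (-(ξ * z))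
      = ∫ z, ∫ x in Set.Ioc (1 / 2 : ℝ) 2, kernelIntegrand Φ V θ η z x * e (-(ξ * z)) := by
        congr 1; ext z
        rw [Fkernel, intervalIntegral.integral_of_le (by norm_num), integral_mul_const]
    _ = ∫ x in Set.Ioc (1 / 2 : ℝ) 2, ∫ z, kernelIntegrand Φ V θ η z x * e (-(ξ * z)) := hswap
    _ = _ := by
      refine setIntegral_congr_fun measurableSet_Ioc fun x hx => ?_
      have hx0 : 0 < x := lt_trans (by norm_num) hx.1
      have h1 : ∀ z, kernelIntegrand Φ V θ η z x * e (-(ξ * z)) =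
          (fun y : ℝ => ((Φ y : ℂ) * e (-(2 * ξ * x * y))) *
            (e (2 * ξ * θ * x) * ((V (x ^ 2) / 2 : ℝ) : ℂ) * e (-(η * x / 2))))
              (z / (2 * x) + θ) := by
        intro z
        have : e (-(ξ * z)) = e (-(2 * ξ * x * (z / (2 * x) + θ))) * e (2 * ξ * θ * x) := by
          rw [← e_add]; congr 1; field_simp; ring
        simp only [kernelIntegrand, max_eq_left hx.1.le, this]
        rw [add_comm θ]; push_cast; ring
      simp_rw [h1]
      rw [MeasureTheory.Measure.integral_comp_div (fun y : ℝ =>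
        (fun y : ℝ => ((Φ y : ℂ) * e (-(2 * ξ * x * y))) *
            (e (2 * ξ * θ * x) * ((V (x ^ 2) / 2 : ℝ) : ℂ) * e (-(η * x / 2)))) (y + θ)),
        integral_add_right_eq_self (fun y : ℝ => ((Φ y : ℂ) * e (-(2 * ξ * x * y))) *
            (e (2 * ξ * θ * x) * ((V (x ^ 2) / 2 : ℝ) : ℂ) * e (-(η * x / 2)))),
        integral_mul_const, ← fourier_eq_integral_e, Fintegrand, hat, abs_of_pos (by positivity),
        Complex.real_smul]
      push_cast; ring

lemma Cutoffs.integral_F_mul_e (hc : Cutoffs Φ V) (θ η y : ℝ) :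
    ∫ ξ, F Φ V θ ξ η * e (ξ * y) = Fkernel Φ V θ η y := by
  have hK := (hc.continuous_Fkernel θ η)
  have hF : 𝓕 (Fkernel Φ V θ η) = fun ξ => F Φ V θ ξ η := by
    ext ξ; exact hc.fourier_Fkernel θ η ξ
  have := congrFun (hK.fourierInv_fourier_eq
    (hK.integrable_of_hasCompactSupport (hc.hasCompactSupport_Fkernel θ η))
    (by rw [hF]; exact hc.integrable_F θ η)) y
  rw [fourierInv_eq_integral_e, hF] at this
  simpa [mul_comm y] using this

/-- Poisson summation for a dilated and modulated kernel. -/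
lemma Cutoffs.poisson (hc : Cutoffs Φ V) (θ η y α : ℝ) {v : ℝ} (hv : 1 ≤ v) :
    ∑' t : ℤ, Fkernel Φ V θ η (y - t / v) * e (α * t) =
      ∑' n : ℤ, (v : ℂ) * (F Φ V θ (v * (n + α)) η * e (v * (n + α) * y)) := by
  have hv0 : 0 < v := by linarith
  set f : ℝ → ℂ := fun s => Fkernel Φ V θ η (y - s / v) * e (α * s) with hf
  have hcont : Continuous f :=
    ((hc.continuous_Fkernel θ η).comp (f := fun s : ℝ => y - s / v) (by fun_prop)).mul
      (by fun_prop)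
  have hF : ∀ ξ, 𝓕 f ξ = v * (F Φ V θ (v * (-ξ + α)) η * e (v * (-ξ + α) * y)) := by
    intro ξ
    have h1 : ∀ s, f s * e (-(ξ * s)) =
        (fun z => Fkernel Φ V θ η z * e (-(v * (-ξ + α) * z)) * e (v * (-ξ + α) * y))
          (y - s / v) := by
      intro s
      simp only [hf]
      rw [mul_assoc, mul_assoc, ← e_add, ← e_add]
      congr 2
      field_simp; ring
    rw [fourier_eq_integral_e]
    simp_rw [h1]
    rw [MeasureTheory.Measure.integral_comp_div (fun s =>
      (fun z => Fkernel Φ V θ η z * e (-(v * (-ξ + α) * z)) * e (v * (-ξ + α) * y)) (y - s)),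
      integral_sub_left_eq_self
      (fun z => Fkernel Φ V θ η z * e (-(v * (-ξ + α) * z)) * e (v * (-ξ + α) * y)),
      integral_mul_const, ← fourier_eq_integral_e, hc.fourier_Fkernel, abs_of_pos hv0,
      Complex.real_smul]
  have hO : f =O[cocompact ℝ] fun x : ℝ => |x| ^ (-(2 : ℝ)) := by
    obtain ⟨Z, hZ, hK⟩ := hc.Fkernel_eq_zero θ
    refine Asymptotics.IsBigO.of_bound 0 ?_
    have : (Set.Icc (-(v * (Z + |y|))) (v * (Z + |y|)))ᶜ ∈ cocompact ℝ :=
      isCompact_Icc.compl_mem_cocompact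
    filter_upwards [this] with s hs
    rw [hf]
    simp only
    rw [hK, zero_mul, norm_zero, zero_mul]
    have hs' : v * (Z + |y|) < |s| := by
      by_contra hcon; exact hs (abs_le.1 (not_lt.1 hcon))
    have h2 : |s / v| ≤ |y - s / v| + |y| := by
      have := abs_sub (y - s / v) y
      rwa [show y - s / v - y = -(s / v) by ring, abs_neg] at this
    rw [abs_div, abs_of_pos hv0] at h2
    rw [mul_comm, ← lt_div_iff₀ hv0] at hs'
    linarith
  have hsum : Summable fun n : ℤ => 𝓕 f n := by
    have := (hc.summable_F θ η α hv).comp_injective neg_injective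
    refine Summable.of_norm (Summable.of_nonneg_of_le (fun _ => norm_nonneg _) (fun n => ?_)
      (this.mul_left v))
    rw [hF, norm_mul, norm_mul, norm_e, mul_one, Complex.norm_real, Real.norm_of_nonneg hv0.le]
    simp
  have h := Real.tsum_eq_tsum_fourier_of_rpow_decay_of_summable hcont one_lt_two hO hsum 0
  simp only [zero_add, QuotientAddGroup.mk_zero, fourier_eval_zero, mul_one] at h
  rw [← (Equiv.neg ℤ).tsum_eq fun n : ℤ =>
    (v : ℂ) * (F Φ V θ (v * (n + α)) η * e (v * (n + α) * y))]
  rw [show (∑' t : ℤ, Fkernel Φ V θ η (y - t / v) * e (α * t)) = ∑' n : ℤ, f n from rfl, h]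
  congr 1; ext n
  rw [hF]; simp

/-! ### Products of absolutely convergent series -/

lemma summable_norm_prod_and_prod_tsum {𝕜 ι : Type*} [RCLike 𝕜] {k : ℕ} {f : Fin k → ι → 𝕜}
    (hf : ∀ i, Summable fun n => ‖f i n‖) :
    (Summable fun m : Fin k → ι => ‖∏ i, f i (m i)‖) ∧
      ∏ i, ∑' n, f i n = ∑' m : Fin k → ι, ∏ i, f i (m i) := by
  induction k with
  | zero =>
    refine ⟨(hasSum_fintype _).summable, ?_⟩
    simp
  | succ k ih =>
    obtain ⟨h1, h2⟩ := ih (f := fun i => f i.succ) fun i => hf i.succ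
    have h3 := (hf 0).mul_norm h1
    have hcons : ∀ x : ι × (Fin k → ι), ∏ i, f i ((Fin.consEquiv fun _ => ι) x i) =
        f 0 x.1 * ∏ i : Fin k, f i.succ (x.2 i) := by
      intro x
      rw [Fin.prod_univ_succ]; simp [Fin.consEquiv]
    constructor
    · rw [← (Fin.consEquiv fun _ => ι).summable_iff]
      refine h3.congr fun x => ?_
      rw [Function.comp, hcons]
    · rw [Fin.prod_univ_succ, h2, tsum_mul_tsum_of_summable_norm (hf 0) h1,
        ← (Fin.consEquiv fun _ => ι).tsum_eq]
      congr 1; ext x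
      rw [hcons]

/-- The summable weights on `ℤᵏ` against which everything is estimated. -/
noncomputable def weight (n : ℕ) {k : ℕ} (m : Fin k → ℤ) : ℝ := ∏ i, 1 / (1 + |(m i : ℝ)|) ^ n

lemma weight_nonneg (n : ℕ) {k : ℕ} (m : Fin k → ℤ) : 0 ≤ weight n m :=
  Finset.prod_nonneg fun i _ => by positivity

lemma summable_weight {n : ℕ} (hn : 2 ≤ n) (k : ℕ) :
    Summable fun m : Fin k → ℤ => weight n m := by
  have := (summable_norm_prod_and_prod_tsum (𝕜 := ℝ) (k := k)
    (f := fun _ (m : ℤ) => 1 / (1 + |(m : ℝ)|) ^ n)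
    fun _ => (summable_inv_one_add_abs_pow hn).norm).1
  exact this.of_norm

/-! ### The main term as a lattice sum over `v` -/

/-- The nonzero integers of absolute value at most `Δ⁴`. -/
noncomputable def shifts (Δ : ℝ) : Finset ℤ := (Finset.Icc (-⌊Δ ^ 4⌋) ⌊Δ ^ 4⌋).erase 0

lemma mem_shifts {Δ : ℝ} {u : ℤ} : u ∈ shifts Δ ↔ 1 ≤ |u| ∧ ((|u| : ℤ) : ℝ) ≤ Δ ^ 4 := by
  rw [shifts, Finset.mem_erase, Finset.mem_Icc, ← abs_le, Int.le_floor, ← abs_pos]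
  exact Iff.rfl

/-- The vectors all of whose entries are nonzero and at most `Δ⁴` in absolute value. -/
noncomputable def shiftVecs (k : ℕ) (Δ : ℝ) : Finset (Fin k → ℤ) :=
  Fintype.piFinset fun _ => shifts Δ

lemma mem_shiftVecs {k : ℕ} {Δ : ℝ} {u : Fin k → ℤ} :
    u ∈ shiftVecs k Δ ↔ ∀ i, 1 ≤ |u i| ∧ ((|u i| : ℤ) : ℝ) ≤ Δ ^ 4 := by
  simp [shiftVecs, Fintype.mem_piFinset, mem_shifts]

/-- The product `∏ᵢ F(v(mᵢ + uᵢβ), uᵢ/v)`. -/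
noncomputable def Fprod (Φ V : ℝ → ℝ) {k : ℕ} (θ v : ℝ) (u m : Fin k → ℤ) (β : ℝ) : ℂ :=
  ∏ i, F Φ V θ (v * (m i + u i * β)) (u i / v)

/-- The density `∑_{u,m} ∫_0^1 ∏ᵢ F(v(mᵢ + uᵢβ), uᵢ/v) dβ`, the sum being over vectors `u`, `m`
with coordinate sums `0`. -/
noncomputable def density (Φ V : ℝ → ℝ) (k : ℕ) (Δ θ v : ℝ) : ℂ :=
  ∑ u ∈ (shiftVecs k Δ).filter (fun u => ∑ i, u i = 0),
    ∑' m : Fin k → ℤ, if ∑ i, m i = 0 then ∫ β in (0 : ℝ)..1, Fprod Φ V θ v u m β else 0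

lemma hat_inversion {w : ℝ → ℝ} (h₁ : HasCompactSupport w) (h₂ : ContDiff ℝ ∞ w) (s : ℝ) :
    ∫ τ, hat w τ * e (τ * s) = (w s : ℂ) := by
  have h := congrArg (fun f : SchwartzMap ℝ ℂ => f s)
    (FourierTransform.fourierInv_fourier_eq (F := SchwartzMap ℝ ℂ) (toSchwartz h₁ h₂))
  rw [SchwartzMap.fourierInv_coe, fourierInv_eq_integral_e, toSchwartz_apply] at h
  rw [← h, hat_eq h₁ h₂]
  simp_rw [mul_comm s]

lemma integrable_hat {w : ℝ → ℝ} (h₁ : HasCompactSupport w) (h₂ : ContDiff ℝ ∞ w) :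
    Integrable (hat w) := by
  rw [hat_eq h₁ h₂]; exact SchwartzMap.integrable _

lemma continuous_hat' {w : ℝ → ℝ} (h₁ : HasCompactSupport w) (h₂ : ContDiff ℝ ∞ w) :
    Continuous (hat w) := by
  rw [hat_eq h₁ h₂]; exact SchwartzMap.continuous _

lemma Cutoffs.integrable_prod_F (hc : Cutoffs Φ V) {k : ℕ} (θ : ℝ) (u : Fin k → ℝ) :
    Integrable fun ξ : Fin k → ℝ => ∏ i, F Φ V θ (ξ i) (u i) :=
  Integrable.fintype_prod_dep (f := fun i ξ => F Φ V θ ξ (u i)) fun i => hc.integrable_F θ (u i)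

lemma Cutoffs.integrable_Hintegrand (hc : Cutoffs Φ V) {w : ℝ → ℝ} (h₁ : HasCompactSupport w)
    (h₂ : ContDiff ℝ ∞ w) {k : ℕ} (θ Δ : ℝ) (t u : Fin k → ℝ) :
    Integrable (Hintegrand Φ V w θ Δ t u) := by
  obtain ⟨C, hC⟩ := h₁.exists_bound_of_continuous h₂.continuous
  have hw := h₂.continuous
  refine Integrable.mul_bdd (c := C) ?_
    (by fun_prop : Continuous fun ξ : Fin k → ℝ => (w (∑ i, Δ ^ 3 * ξ i) : ℂ)).aestronglyMeasurable
    (Eventually.of_forall fun ξ => ?_)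
  · refine Integrable.mul_bdd (c := 1) (hc.integrable_prod_F θ u)
      (by fun_prop : Continuous fun ξ : Fin k → ℝ => e (-(∑ i, t i * ξ i))).aestronglyMeasurable
      (Eventually.of_forall fun ξ => (norm_e _).le)
  · rw [Complex.norm_real]; exact hC _

/-- Writing `w` as an inverse Fourier transform turns `H` into a one-dimensional integral of a
product of kernels. -/
lemma Cutoffs.H_eq (hc : Cutoffs Φ V) {w : ℝ → ℝ} (h₁ : HasCompactSupport w)
    (h₂ : ContDiff ℝ ∞ w) {k : ℕ} (θ Δ : ℝ) (t u : Fin k → ℝ) :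
    H Φ V w θ Δ t u = ∫ τ, hat w τ * ∏ i, Fkernel Φ V θ (u i) (Δ ^ 3 * τ - t i) := by
  set G : (Fin k → ℝ) → ℝ → ℂ := fun ξ τ =>
    (∏ i, F Φ V θ (ξ i) (u i)) * hat w τ * e (∑ i, ξ i * (Δ ^ 3 * τ - t i)) with hG
  have hint : Integrable (Function.uncurry G) (volume.prod volume) :=
    Integrable.mul_bdd (c := 1) ((hc.integrable_prod_F θ u).mul_prod (integrable_hat h₁ h₂))
      (by fun_prop : Continuous fun p : (Fin k → ℝ) × ℝ =>
        e (∑ i, p.1 i * (Δ ^ 3 * p.2 - t i))).aestronglyMeasurable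
      (Eventually.of_forall fun ξ => (norm_e _).le)
  calc H Φ V w θ Δ t u = ∫ ξ, ∫ τ, G ξ τ := by
        rw [H]; congr 1; ext ξ
        rw [Hintegrand, ← hat_inversion h₁ h₂, ← integral_const_mul]
        congr 1; ext τ
        have : e (∑ i, ξ i * (Δ ^ 3 * τ - t i)) =
            e (-∑ i, t i * ξ i) * e (τ * ∑ i, Δ ^ 3 * ξ i) := by
          rw [← e_add, Finset.mul_sum, ← Finset.sum_neg_distrib, ← Finset.sum_add_distrib]
          congr 1
          exact Finset.sum_congr rfl fun i _ => by ring
        rw [hG]; simp only [this]; ring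
    _ = ∫ τ, ∫ ξ, G ξ τ := integral_integral_swap hint
    _ = _ := by
        congr 1; ext τ
        rw [← integral_congr_ae (μ := volume) (f := fun ξ : Fin k → ℝ =>
          hat w τ * ∏ i, (F Φ V θ (ξ i) (u i) * e (ξ i * (Δ ^ 3 * τ - t i))))]
        · rw [integral_const_mul, integral_fintype_prod_volume_eq_prod
            (fun i x => F Φ V θ x (u i) * e (x * (Δ ^ 3 * τ - t i)))]
          simp_rw [hc.integral_F_mul_e]
        · refine Eventually.of_forall fun ξ => ?_
          simp only [hG]
          rw [Finset.prod_mul_distrib, e_sum]; ring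

/-- The kernels decay, uniformly in `η`. -/
lemma Cutoffs.Fkernel_bound (hc : Cutoffs Φ V) (θ : ℝ) : ∃ C, 0 ≤ C ∧
    ∀ η y, ‖Fkernel Φ V θ η y‖ ≤ C * (1 / (1 + |y|) ^ 2) := by
  obtain ⟨Z, hZ, h⟩ := hc.Fkernel_eq_zero θ
  refine ⟨(1 + Z) ^ 2, by positivity, fun η y => ?_⟩
  rcases lt_or_ge Z |y| with hy | hy
  · rw [h η y hy, norm_zero]; positivity
  · have h1 : ‖Fkernel Φ V θ η y‖ ≤ 1 / 2 * |2 - 1 / 2| := by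
      refine intervalIntegral.norm_integral_le_of_norm_le_const fun x _ => ?_
      rw [kernelIntegrand, norm_mul, norm_e, mul_one, Complex.norm_real, Real.norm_eq_abs]
      have a := hc.boundΦ (θ + y / (2 * max x (1 / 2)))
      have b := hc.boundV (x ^ 2)
      rw [abs_of_nonneg (mul_nonneg a.1 (by linarith [b.1]))]
      nlinarith [a.1, a.2, b.1, b.2]
    refine h1.trans ?_
    rw [mul_one_div, le_div_iff₀ (by positivity)]
    have : (1 + |y|) ^ 2 ≤ (1 + Z) ^ 2 := by gcongr
    norm_num
    nlinarith [sq_nonneg (1 + |y|)]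

/-- Pointwise majorant, summable in `t` and integrable in `τ`, for the integrand of `H_eq`. -/
lemma Cutoffs.norm_hat_mul_prod_le (hc : Cutoffs Φ V) {w : ℝ → ℝ} (h₁ : HasCompactSupport w)
    (h₂ : ContDiff ℝ ∞ w) (k : ℕ) (θ Δ : ℝ) (hΔ : 0 ≤ Δ) {v : ℝ} (hv : 1 ≤ v) :
    ∃ C, 0 ≤ C ∧ ∀ (t u : Fin k → ℤ) (τ : ℝ),
      ‖hat w τ * ∏ i, Fkernel Φ V θ ((u i : ℝ) / v) (Δ ^ 3 * τ - (t i : ℝ) / v)‖ ≤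
        C * weight 2 t * (1 + τ ^ 2)⁻¹ := by
  obtain ⟨A, hA, hK⟩ := hc.Fkernel_bound θ
  obtain ⟨D, hD, hw⟩ := schwartz_bound (𝓕 (toSchwartz h₁ h₂)) (2 * k + 2)
  rw [← hat_eq h₁ h₂] at hw
  set B := v * (1 + v * Δ ^ 3)
  have hB : 0 ≤ B := by positivity
  refine ⟨D * (A * B ^ 2) ^ k, by positivity, fun t u τ => ?_⟩
  have h3 : ∀ i, ‖Fkernel Φ V θ ((u i : ℝ) / v) (Δ ^ 3 * τ - (t i : ℝ) / v)‖ ≤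
      A * B ^ 2 * (1 + |τ|) ^ 2 * (1 / (1 + |(t i : ℝ)|) ^ 2) := by
    intro i
    refine (hK _ _).trans ?_
    have h4 : 1 + |(t i : ℝ)| ≤ B * (1 + |τ|) * (1 + |Δ ^ 3 * τ - (t i : ℝ) / v|) := by
      set y := Δ ^ 3 * τ - (t i : ℝ) / v with hy
      have hv0 : v ≠ 0 := by positivity
      have h5 : |(t i : ℝ)| ≤ v * Δ ^ 3 * |τ| + v * |y| := by
        have : (t i : ℝ) = v * Δ ^ 3 * τ - v * y := by rw [hy]; field_simp; ring
        rw [this]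
        refine (abs_sub _ _).trans ?_
        rw [abs_mul, abs_mul v y, abs_of_nonneg (by positivity : 0 ≤ v * Δ ^ 3),
          abs_of_nonneg (by positivity : 0 ≤ v)]
      have hE : 0 ≤ v * Δ ^ 3 := by positivity
      have hτ := abs_nonneg τ
      have hyy := abs_nonneg y
      have h6 : B * (1 + |τ|) * (1 + |y|) - (1 + v * Δ ^ 3 * |τ| + v * |y|) =
          (v - 1) * (1 + v * Δ ^ 3 * |τ|) + (v * (v * Δ ^ 3) + v * |τ|)
          + v * (v * Δ ^ 3 + |τ| + v * Δ ^ 3 * |τ|) * |y| := by simp only [B]; ring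
      have h7 : 0 ≤ (v - 1) * (1 + v * Δ ^ 3 * |τ|) :=
        mul_nonneg (by linarith) (by positivity)
      have h8 : 0 ≤ (v * (v * Δ ^ 3) + v * |τ|)
          + v * (v * Δ ^ 3 + |τ| + v * Δ ^ 3 * |τ|) * |y| := by positivity
      linarith
    have h5 : 1 / (1 + |Δ ^ 3 * τ - (t i : ℝ) / v|) ^ 2 ≤
        (B * (1 + |τ|)) ^ 2 * (1 / (1 + |(t i : ℝ)|) ^ 2) := by
      rw [mul_one_div, div_le_div_iff₀ (by positivity) (by positivity), one_mul, ← mul_pow]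
      gcongr
    calc _ ≤ A * ((B * (1 + |τ|)) ^ 2 * (1 / (1 + |(t i : ℝ)|) ^ 2)) := by gcongr
      _ = _ := by ring
  have h6 : ‖∏ i, Fkernel Φ V θ ((u i : ℝ) / v) (Δ ^ 3 * τ - (t i : ℝ) / v)‖ ≤
      (A * B ^ 2) ^ k * (1 + |τ|) ^ (2 * k) * weight 2 t := by
    rw [norm_prod]
    refine (Finset.prod_le_prod (fun _ _ => norm_nonneg _) fun i _ => h3 i).trans_eq ?_
    rw [Finset.prod_mul_distrib, Finset.prod_const, Finset.card_univ, Fintype.card_fin, mul_pow,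
      ← pow_mul, weight]
  rw [norm_mul]
  calc _ ≤ D / (1 + |τ|) ^ (2 * k + 2) *
        ((A * B ^ 2) ^ k * (1 + |τ|) ^ (2 * k) * weight 2 t) := by
        gcongr; exact (hw τ).1
    _ = D * (A * B ^ 2) ^ k * weight 2 t * ((1 + |τ|) ^ 2)⁻¹ := by
        rw [pow_add]; field_simp
    _ ≤ _ := by
        have := weight_nonneg 2 t
        gcongr
        rw [← sq_abs τ]
        nlinarith [abs_nonneg τ]

lemma integral_e_mul_int (n : ℤ) :
    ∫ β in Set.Ioc (0 : ℝ) 1, e (n * β) = if n = 0 then 1 else 0 := by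
  rw [← intervalIntegral.integral_of_le zero_le_one]
  split_ifs with h
  · simp [h]
  · have hn : (2 * Real.pi * Complex.I * n : ℂ) ≠ 0 := by
      simp [Real.pi_ne_zero, Complex.I_ne_zero, h]
    have : ∀ β : ℝ, e (n * β) = Complex.exp ((2 * Real.pi * Complex.I * n) * β) := by
      intro β; rw [e]; congr 1; push_cast; ring
    simp_rw [this]
    rw [integral_exp_mul_complex hn]
    have h1 : Complex.exp (2 * Real.pi * Complex.I * n * (1 : ℝ)) = 1 := by
      rw [← e_int n, e]; congr 1; push_cast; ring
    rw [h1]; simp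

/-- The bound for `Fprod` that is summable over `m`. -/
lemma Cutoffs.Fprod_bound (hc : Cutoffs Φ V) : ∃ C, 1 ≤ C ∧
    ∀ (k : ℕ) (θ v β D : ℝ) (u m : Fin k → ℤ), 1 ≤ v → β ∈ Set.Icc (0 : ℝ) 1 →
      (∀ i, |(u i : ℝ)| ≤ D) → ‖Fprod Φ V θ v u m β‖ ≤ (C * (1 + D) ^ 3) ^ k * weight 3 m := by
  obtain ⟨C, hC, h⟩ := hc.F_lattice_bound
  refine ⟨C + 1, by linarith, fun k θ v β D u m hv hβ hu => ?_⟩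
  rw [Fprod, norm_prod, weight]
  have : ∀ i, ‖F Φ V θ (v * (m i + u i * β)) (u i / v)‖ ≤
      (C + 1) * (1 + D) ^ 3 * (1 / (1 + |(m i : ℝ)|) ^ 3) := by
    intro i
    refine (h _ _ _ _ _ hv).trans ?_
    have : |(u i : ℝ) * β| ≤ D := by
      rw [abs_mul, abs_of_nonneg hβ.1]
      exact (mul_le_of_le_one_right (abs_nonneg _) hβ.2).trans (hu i)
    have h0 : 0 ≤ |(u i : ℝ) * β| := abs_nonneg _
    gcongr
    linarith
  refine (Finset.prod_le_prod (fun _ _ => norm_nonneg _) fun i _ => this i).trans_eq ?_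
  rw [Finset.prod_mul_distrib, Finset.prod_const, Finset.card_univ, Fintype.card_fin]

lemma Cutoffs.continuous_Fprod (hc : Cutoffs Φ V) {k : ℕ} (θ v : ℝ) (u m : Fin k → ℤ) :
    Continuous (Fprod Φ V θ v u m) :=
  continuous_finsetProd _ fun i _ => hc.continuous_F.comp
    (f := fun β : ℝ => (θ, v * (m i + u i * β), (u i : ℝ) / v)) (by fun_prop)

/-! ### Poisson summation for the main term -/

section Poisson
variable {w : ℝ → ℝ} {k : ℕ}

lemma norm_Hterm_le (hc : Cutoffs Φ V) (h₁ : HasCompactSupport w) (h₂ : ContDiff ℝ ∞ w)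
    (k : ℕ) (θ Δ : ℝ) (hΔ : 0 ≤ Δ) {v : ℝ} (hv : 1 ≤ v) :
    ∃ C, 0 ≤ C ∧ ∀ u t : Fin k → ℤ, ‖Hterm Φ V w θ Δ v (u, t)‖ ≤ C * weight 2 t := by
  obtain ⟨C, hC, hb⟩ := hc.norm_hat_mul_prod_le h₁ h₂ k θ Δ hΔ hv
  refine ⟨C * Real.pi, by positivity, fun u t => ?_⟩
  rw [Hterm, hc.H_eq h₁ h₂]
  refine (norm_integral_le_of_norm_le (g := fun τ => C * weight 2 t * (1 + τ ^ 2)⁻¹)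
    (integrable_inv_one_add_sq.const_mul _)
    (Eventually.of_forall fun τ => hb t u τ)).trans_eq ?_
  rw [integral_const_mul, integral_univ_inv_one_add_sq]
  ring

/-- Poisson summation over `ℤᵏ`. The condition `⟨u,t⟩ = 0` is detected by an integral over `β`; on
the dual side the factor `w` singles out the vectors with coordinate sum `0`, because that sum
gets multiplied by `vΔ³ ≥ 1/2`. -/
lemma Cutoffs.tsum_Hterm (hc : Cutoffs Φ V) (h₁ : HasCompactSupport w) (h₂ : ContDiff ℝ ∞ w)
    (h₃ : tsupport w ⊆ Set.Ioo (-1 / 2) (1 / 2)) (h₄ : w 0 = 1) (θ : ℝ) {Δ v : ℝ} (hΔ : 1 ≤ Δ)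
    (hv : 1 ≤ v) (u : Fin k → ℤ) (hu : ∑ i, u i = 0) :
    ∑' t : Fin k → ℤ, (if ∑ i, u i * t i = 0 then Hterm Φ V w θ Δ v (u, t) else 0) =
      (v : ℂ) ^ k * ∑' m : Fin k → ℤ,
        if ∑ i, m i = 0 then ∫ β in (0 : ℝ)..1, Fprod Φ V θ v u m β else 0 := by
  have hv0 : 0 < v := by linarith
  set μ : Measure (ℝ × ℝ) := (volume.restrict (Set.Ioc (0 : ℝ) 1)).prod volume with hμ
  set I : (Fin k → ℤ) → ℝ → ℂ := fun t τ =>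
    hat w τ * ∏ i, Fkernel Φ V θ ((u i : ℝ) / v) (Δ ^ 3 * τ - (t i : ℝ) / v) with hI
  set A : (Fin k → ℤ) → ℝ × ℝ → ℂ := fun t p =>
    e ((∑ i, u i * t i : ℤ) * p.1) * I t p.2 with hA
  set B : (Fin k → ℤ) → ℝ × ℝ → ℂ := fun m p =>
    Fprod Φ V θ v u m p.1 * (hat w p.2 * e (p.2 * (Δ ^ 3 * v * (∑ i, m i : ℤ)))) with hB
  have hhat := continuous_hat' h₁ h₂
  -- the two series agree pointwise, by Poisson summation in each coordinate
  have hAB : ∀ p, ∑' t, A t p = (v : ℂ) ^ k * ∑' m, B m p := by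
    rintro ⟨β, τ⟩
    have e1 : ∀ t, A t (β, τ) = hat w τ *
        ∏ i, (Fkernel Φ V θ ((u i : ℝ) / v) (Δ ^ 3 * τ - (t i : ℝ) / v)
          * e (β * u i * (t i : ℤ))) := by
      intro t
      simp only [hA, hI]
      rw [Finset.prod_mul_distrib, ← e_sum]
      have : ((∑ i, u i * t i : ℤ) : ℝ) * β = ∑ i, β * u i * (t i : ℤ) := by
        push_cast; rw [Finset.sum_mul]; exact Finset.sum_congr rfl fun i _ => by ring
      rw [this]; ring
    obtain ⟨K, hK, hKb⟩ := hc.Fkernel_bound θ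
    have hs1 : ∀ i, Summable fun t : ℤ =>
        ‖Fkernel Φ V θ ((u i : ℝ) / v) (Δ ^ 3 * τ - (t : ℝ) / v) * e (β * u i * t)‖ := by
      intro i
      obtain ⟨Z, hZ, hzero⟩ := hc.Fkernel_eq_zero θ
      refine summable_of_hasFiniteSupport ?_
      refine (Set.finite_Icc (-⌈v * (Z + |Δ ^ 3 * τ|)⌉) ⌈v * (Z + |Δ ^ 3 * τ|)⌉).subset
        fun t ht => ?_
      have hne : Fkernel Φ V θ ((u i : ℝ) / v) (Δ ^ 3 * τ - (t : ℝ) / v) ≠ 0 := by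
        intro h0; apply ht; simp [h0]
      have h5 : |Δ ^ 3 * τ - (t : ℝ) / v| ≤ Z := by
        by_contra hcon; exact hne (hzero _ _ (not_le.1 hcon))
      have h6 : |(t : ℝ) / v| ≤ Z + |Δ ^ 3 * τ| := by
        have := abs_sub (Δ ^ 3 * τ - (t : ℝ) / v) (Δ ^ 3 * τ)
        rw [show Δ ^ 3 * τ - (t : ℝ) / v - Δ ^ 3 * τ = -((t : ℝ) / v) by ring, abs_neg] at this
        linarith
      rw [abs_div, abs_of_pos hv0, div_le_iff₀ hv0, mul_comm] at h6
      have h7 : ((|t| : ℤ) : ℝ) ≤ (⌈v * (Z + |Δ ^ 3 * τ|)⌉ : ℤ) := by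
        push_cast; exact h6.trans (Int.le_ceil _)
      exact abs_le.1 (by exact_mod_cast h7)
    have hs2 : ∀ i, Summable fun n : ℤ => ‖(v : ℂ) * (F Φ V θ (v * (n + β * u i)) ((u i : ℝ) / v)
        * e (v * (n + β * u i) * (Δ ^ 3 * τ)))‖ := by
      intro i
      refine ((hc.summable_F θ ((u i : ℝ) / v) (β * u i) hv).mul_left ‖(v : ℂ)‖).congr fun n => ?_
      rw [norm_mul, norm_mul, norm_e, mul_one]
    calc ∑' t, A t (β, τ) = hat w τ * ∏ i, ∑' t : ℤ,
          Fkernel Φ V θ ((u i : ℝ) / v) (Δ ^ 3 * τ - (t : ℝ) / v) * e (β * u i * t) := by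
          rw [(summable_norm_prod_and_prod_tsum hs1).2, ← tsum_mul_left]
          exact tsum_congr e1
      _ = hat w τ * ∏ i, ∑' n : ℤ, (v : ℂ) * (F Φ V θ (v * (n + β * u i)) ((u i : ℝ) / v)
            * e (v * (n + β * u i) * (Δ ^ 3 * τ))) := by
          congr 1
          exact Finset.prod_congr rfl fun i _ => hc.poisson _ _ _ _ hv
      _ = (v : ℂ) ^ k * ∑' m, B m (β, τ) := by
          rw [(summable_norm_prod_and_prod_tsum hs2).2, ← tsum_mul_left, ← tsum_mul_left]
          refine tsum_congr fun m => ?_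
          rw [Finset.prod_mul_distrib, Finset.prod_const, Finset.card_univ, Fintype.card_fin,
            Finset.prod_mul_distrib, ← e_sum]
          have h8 : ∑ i, v * ((m i : ℝ) + β * u i) * (Δ ^ 3 * τ) =
              τ * (Δ ^ 3 * v * (∑ i, m i : ℤ)) := by
            have : ∑ i, v * ((m i : ℝ) + β * u i) * (Δ ^ 3 * τ) =
                Δ ^ 3 * τ * v * ((∑ i, m i : ℤ) + β * (∑ i, u i : ℤ)) := by
              push_cast
              rw [Finset.mul_sum, ← Finset.sum_add_distrib, Finset.mul_sum]
              exact Finset.sum_congr rfl fun i _ => by ring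
            rw [this, hu]; push_cast; ring
          rw [h8]
          simp only [hB, Fprod, mul_comm β]
          ring
  -- termwise integrals
  have hIint : ∀ t, Integrable (I t) := fun t => by
    obtain ⟨C, hC, hb⟩ := hc.norm_hat_mul_prod_le h₁ h₂ k θ Δ (by linarith) hv
    refine Integrable.mono' (g := fun τ => C * weight 2 t * (1 + τ ^ 2)⁻¹)
      (integrable_inv_one_add_sq.const_mul _) ?_ (Eventually.of_forall fun τ => hb t u τ)
    refine (hhat.mul (continuous_finsetProd _ fun i _ => ?_)).aestronglyMeasurable
    exact (hc.continuous_Fkernel θ _).comp (by fun_prop)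
  have hAint : ∀ t, Integrable (A t) μ := fun t => by
    refine Integrable.mul_prod (f := fun β : ℝ => e ((∑ i, u i * t i : ℤ) * β)) (g := I t) ?_
      (hIint t)
    exact (by fun_prop : Continuous fun β : ℝ => e ((∑ i, u i * t i : ℤ) * β)).integrableOn_Ioc
  have hAnorm : Summable fun t => ∫ p, ‖A t p‖ ∂μ := by
    obtain ⟨C, hC, hb⟩ := hc.norm_hat_mul_prod_le h₁ h₂ k θ Δ (by linarith) hv
    refine Summable.of_nonneg_of_le (fun _ => integral_nonneg fun _ => norm_nonneg _)
      (fun t => ?_) ((summable_weight le_rfl k).mul_left (C * Real.pi))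
    have : ∀ p, ‖A t p‖ = (1 : ℝ) * ‖I t p.2‖ := fun p => by
      simp only [hA]; rw [norm_mul, norm_e]
    simp_rw [this]
    rw [hμ, integral_prod_mul (fun _ : ℝ => (1 : ℝ)) (fun τ => ‖I t τ‖)]
    simp only [integral_const, MeasurableSet.univ, measureReal_restrict_apply, Set.univ_inter,
      Real.volume_real_Ioc, sub_zero, smul_eq_mul, mul_one]
    have := integral_mono (hIint t).norm
      (integrable_inv_one_add_sq.const_mul (C * weight 2 t)) fun τ => hb t u τ
    rw [integral_const_mul, integral_univ_inv_one_add_sq] at this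
    simp only [zero_le_one, sup_of_le_left, one_mul]
    linarith
  have hBint : ∀ m, Integrable (B m) μ := fun m => by
    refine Integrable.mul_prod (f := Fprod Φ V θ v u m)
      (g := fun τ => hat w τ * e (τ * (Δ ^ 3 * v * (∑ i, m i : ℤ))))
      (hc.continuous_Fprod θ v u m).integrableOn_Ioc ?_
    exact (integrable_hat h₁ h₂).mul_bdd (c := 1)
      (by fun_prop : Continuous fun τ : ℝ =>
        e (τ * (Δ ^ 3 * v * (∑ i, m i : ℤ)))).aestronglyMeasurable
      (Eventually.of_forall fun ξ => (norm_e _).le)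
  have hBnorm : Summable fun m => ∫ p, ‖B m p‖ ∂μ := by
    obtain ⟨C, hC, hb⟩ := hc.Fprod_bound
    set D := ∑ i, |(u i : ℝ)|
    have hD : ∀ i, |(u i : ℝ)| ≤ D := fun i =>
      Finset.single_le_sum (f := fun i => |(u i : ℝ)|) (fun _ _ => abs_nonneg _)
        (Finset.mem_univ i)
    refine Summable.of_nonneg_of_le (fun _ => integral_nonneg fun _ => norm_nonneg _)
      (fun m => ?_) ((summable_weight (n := 3) (by norm_num) k).mul_left
        ((C * (1 + D) ^ 3) ^ k * ∫ τ, ‖hat w τ‖))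
    have : ∀ p, ‖B m p‖ = ‖Fprod Φ V θ v u m p.1‖ * ‖hat w p.2‖ := fun p => by
      simp only [hB]; rw [norm_mul, norm_mul, norm_e, mul_one]
    simp_rw [this]
    rw [hμ, integral_prod_mul (fun β : ℝ => ‖Fprod Φ V θ v u m β‖) (fun τ => ‖hat w τ‖)]
    rw [mul_right_comm]
    refine mul_le_mul_of_nonneg_right ?_ (integral_nonneg fun _ => norm_nonneg _)
    have h9 := setIntegral_mono_on (μ := volume) (s := Set.Ioc (0 : ℝ) 1)
      (f := fun β => ‖Fprod Φ V θ v u m β‖)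
      (g := fun _ => (C * (1 + D) ^ 3) ^ k * weight 3 m)
      (hc.continuous_Fprod θ v u m).norm.integrableOn_Ioc
      continuous_const.integrableOn_Ioc measurableSet_Ioc
      fun β hβ => hb k θ v β D u m hv ⟨hβ.1.le, hβ.2⟩ hD
    simpa using h9
  -- the integral over `β` detects `⟨u, t⟩ = 0`
  have hA1 : ∀ t, ∫ p, A t p ∂μ =
      if ∑ i, u i * t i = 0 then Hterm Φ V w θ Δ v (u, t) else 0 := fun t => by
    rw [hμ, integral_prod_mul (fun β : ℝ => e ((∑ i, u i * t i : ℤ) * β)) (I t),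
      integral_e_mul_int, Hterm, hc.H_eq h₁ h₂]
    split_ifs <;> simp [hI]
  -- the integral over `τ` is the value of `w` at `Δ³ v M`
  have hB1 : ∀ m, ∫ p, B m p ∂μ =
      if ∑ i, m i = 0 then ∫ β in (0 : ℝ)..1, Fprod Φ V θ v u m β else 0 := fun m => by
    rw [hμ, integral_prod_mul (Fprod Φ V θ v u m)
      (fun τ => hat w τ * e (τ * (Δ ^ 3 * v * (∑ i, m i : ℤ)))), hat_inversion h₁ h₂,
      ← intervalIntegral.integral_of_le zero_le_one]
    split_ifs with hm
    · simp [hm, h₄]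
    · have : w (Δ ^ 3 * v * (∑ i, m i : ℤ)) = 0 := by
        by_contra hne
        have hmem := h₃ (subset_tsupport _ hne)
        have h10 : (1 : ℝ) ≤ |((∑ i, m i : ℤ) : ℝ)| := by exact_mod_cast Int.one_le_abs hm
        have h11 : |Δ ^ 3 * v * (∑ i, m i : ℤ)| < 1 / 2 := by
          rw [abs_lt]; constructor <;> linarith [hmem.1, hmem.2]
        rw [abs_mul, abs_of_nonneg (by positivity)] at h11
        have h12 : 1 ≤ Δ ^ 3 := one_le_pow₀ hΔ
        nlinarith [mul_le_mul h12 hv (by norm_num) (by linarith)]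
      rw [this]; simp
  simp_rw [← hA1, ← hB1]
  rw [integral_tsum_of_summable_integral_norm hAint hAnorm,
    integral_tsum_of_summable_integral_norm hBint hBnorm, ← integral_const_mul]
  simp_rw [hAB]

lemma mem_lattice_iff {Δ : ℝ} (u t : Fin k → ℤ) : (u, t) ∈ lattice k Δ ↔
    u ∈ (shiftVecs k Δ).filter (fun u => ∑ i, u i = 0) ∧ ∑ i, u i * t i = 0 := by
  rw [Finset.mem_filter, mem_shiftVecs, lattice]
  simp only [Set.mem_ofPred_eq]
  tauto

open Classical in
lemma summable_indicator_Hterm (hc : Cutoffs Φ V) (h₁ : HasCompactSupport w) (h₂ : ContDiff ℝ ∞ w)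
    (θ : ℝ) {Δ v : ℝ} (hΔ : 0 ≤ Δ) (hv : 1 ≤ v) :
    Summable ((lattice k Δ).indicator (Hterm Φ V w θ Δ v)) := by
  obtain ⟨C, hC, hb⟩ := norm_Hterm_le hc h₁ h₂ k θ Δ hΔ hv
  have h1 : Summable fun u : Fin k → ℤ => if u ∈ shiftVecs k Δ then C else 0 :=
    summable_of_hasFiniteSupport ((shiftVecs k Δ).finite_toSet.subset fun u hu => by
      by_contra h; apply hu; exact if_neg h)
  have h2 := h1.mul_of_nonneg (summable_weight (n := 2) le_rfl k)
    (fun u => by positivity) (fun m => weight_nonneg _ _)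
  refine Summable.of_norm (Summable.of_nonneg_of_le (fun _ => norm_nonneg _) ?_ h2)
  rintro ⟨u, t⟩
  by_cases h : (u, t) ∈ lattice k Δ
  · rw [Set.indicator_of_mem h]
    rw [mem_lattice_iff, Finset.mem_filter] at h
    simp only [h.1.1, if_true]
    exact hb u t
  · rw [Set.indicator_of_notMem h, norm_zero]
    have := weight_nonneg 2 t
    positivity

lemma Cutoffs.mainIntegrand_eq (hc : Cutoffs Φ V) (h₁ : HasCompactSupport w)
    (h₂ : ContDiff ℝ ∞ w) (h₃ : tsupport w ⊆ Set.Ioo (-1 / 2) (1 / 2)) (h₄ : w 0 = 1)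
    (φ : ℝ → ℝ) (k : ℕ) (θ : ℝ) {Δ v : ℝ} (hΔ : 1 ≤ Δ) (hv : 1 ≤ v) :
    mainIntegrand Φ V w φ k Δ θ v = v * density Φ V k Δ θ v * φ θ := by
  classical
  rw [mainIntegrand, tsum_subtype (lattice k Δ) (Hterm Φ V w θ Δ v)]
  have hs := summable_indicator_Hterm (k := k) hc h₁ h₂ θ (by linarith : 0 ≤ Δ) hv
  rw [hs.tsum_prod' fun u => hs.prod_factor u]
  rw [tsum_eq_sum (s := (shiftVecs k Δ).filter (fun u => ∑ i, u i = 0))]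
  · have hv0 : (v : ℂ) ≠ 0 := by
      have : v ≠ 0 := by linarith
      exact_mod_cast this
    have : ∀ u ∈ (shiftVecs k Δ).filter (fun u => ∑ i, u i = 0),
        ∑' t, (lattice k Δ).indicator (Hterm Φ V w θ Δ v) (u, t) =
        (v : ℂ) ^ k * ∑' m : Fin k → ℤ,
          if ∑ i, m i = 0 then ∫ β in (0 : ℝ)..1, Fprod Φ V θ v u m β else 0 := by
      intro u hu
      rw [← hc.tsum_Hterm h₁ h₂ h₃ h₄ θ hΔ hv u (Finset.mem_filter.1 hu).2]
      refine tsum_congr fun t => ?_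
      rw [Set.indicator_apply]
      simp only [mem_lattice_iff, hu, true_and]
    rw [Finset.sum_congr rfl this, ← Finset.mul_sum, density]
    congr 1
    rw [Complex.ofReal_zpow, zpow_sub₀ hv0, zpow_natCast, zpow_one]
    field_simp
  · intro u hu
    convert tsum_zero with t
    rw [Set.indicator_of_notMem]
    rw [mem_lattice_iff]
    tauto

end Poisson

/-! ### Regularity of the products `Fprod` and of the density -/

lemma norm_prod_sub_prod_le {ι : Type*} (s : Finset ι) (a b : ι → ℂ) (A : ι → ℝ) {δ : ℝ}
    (ha : ∀ i, ‖a i‖ ≤ A i) (hb : ∀ i, ‖b i‖ ≤ A i) (hab : ∀ i, ‖a i - b i‖ ≤ A i * δ) :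
    ‖∏ i ∈ s, a i - ∏ i ∈ s, b i‖ ≤ s.card * δ * ∏ i ∈ s, A i := by
  classical
  induction s using Finset.induction_on with
  | empty => simp
  | insert i s hi ih =>
    rw [Finset.prod_insert hi, Finset.prod_insert hi, Finset.prod_insert hi,
      Finset.card_insert_of_notMem hi]
    have hA : ∀ i, 0 ≤ A i := fun i => (norm_nonneg _).trans (ha i)
    have h1 : ‖∏ j ∈ s, a j‖ ≤ ∏ j ∈ s, A j := by
      rw [norm_prod]; exact Finset.prod_le_prod (fun _ _ => norm_nonneg _) fun j _ => ha j
    rw [show a i * ∏ j ∈ s, a j - b i * ∏ j ∈ s, b j = (a i - b i) * ∏ j ∈ s, a j +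
      b i * (∏ j ∈ s, a j - ∏ j ∈ s, b j) by ring]
    refine (norm_add_le _ _).trans ?_
    rw [norm_mul, norm_mul]
    calc _ ≤ A i * δ * ∏ j ∈ s, A j + A i * (s.card * δ * ∏ j ∈ s, A j) := by
          refine add_le_add (mul_le_mul (hab i) h1 (norm_nonneg _)
            ((norm_nonneg _).trans (hab i))) (mul_le_mul (hb i) ih (norm_nonneg _) (hA i))
      _ = _ := by push_cast; ring

lemma Cutoffs.F_lipschitz_lattice (hc : Cutoffs Φ V) : ∃ C, 1 ≤ C ∧
    (∀ θ η v m α : ℝ, 1 ≤ v → ∀ D, |α| ≤ D →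
      ‖F Φ V θ (v * (m + α)) η‖ ≤ C * (1 + D) ^ 3 * (1 / (1 + |m|) ^ 3)) ∧
    (∀ θ η v m u β β' D L : ℝ, |θ| ≤ 1 → 1 ≤ v → v ≤ L → β ∈ Set.Icc (0 : ℝ) 1 →
      β' ∈ Set.Icc (0 : ℝ) 1 → |u| ≤ D →
      ‖F Φ V θ (v * (m + u * β)) η - F Φ V θ (v * (m + u * β')) η‖ ≤
        C * (1 + D) ^ 3 * (1 / (1 + |m|) ^ 3) * (2 * L * D * |β - β'|)) ∧
    (∀ θ v v' m u β D : ℝ, |θ| ≤ 1 → 1 ≤ v → 1 ≤ v' → β ∈ Set.Icc (0 : ℝ) 1 → |u| ≤ D →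
      ‖F Φ V θ (v * (m + u * β)) (u / v) - F Φ V θ (v' * (m + u * β)) (u / v')‖ ≤
        C * (1 + D) ^ 3 * (1 / (1 + |m|) ^ 2) * (4 * (1 + D) * |v - v'|)) := by
  obtain ⟨C₁, hC₁, h1⟩ := hc.F_lattice_bound
  obtain ⟨C₂, hC₂, -, h2⟩ := hc.F_bound
  have hmul : ∀ u β D : ℝ, β ∈ Set.Icc (0 : ℝ) 1 → |u| ≤ D → |u * β| ≤ D := by
    intro u β D hβ hu
    rw [abs_mul, abs_of_nonneg hβ.1]
    exact (mul_le_of_le_one_right (abs_nonneg _) hβ.2).trans hu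
  have hT : ∀ m α D v : ℝ, |α| ≤ D → 1 ≤ v → (1 + |m|) / (1 + D) ≤ 1 + |v * (m + α)| := by
    intro m α D v hα hv
    have := abs_nonneg α
    refine le_trans ?_ (one_add_abs_le_mul hv m α)
    gcongr
  refine ⟨C₁ + C₂ + 1, by linarith, ?_, ?_, ?_⟩
  · intro θ η v m α hv D hα
    refine (h1 _ _ _ _ _ hv).trans ?_
    have := abs_nonneg α
    gcongr
    linarith
  · intro θ η v m u β β' D L hθ hv hL hβ hβ' hu
    have hD : 0 ≤ D := (abs_nonneg u).trans hu
    have h3 := h2 θ (v * (m + u * β)) (v * (m + u * β')) η η ((1 + |m|) / (1 + D))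
      (by positivity) ?_
    · refine h3.trans ?_
      have h4 : |v * (m + u * β) - v * (m + u * β')| ≤ L * D * |β - β'| := by
        rw [show v * (m + u * β) - v * (m + u * β') = v * u * (β - β') by ring, abs_mul, abs_mul,
          abs_of_nonneg (by linarith : 0 ≤ v)]
        have : 0 ≤ L := by linarith
        gcongr
      rw [sub_self, abs_zero, add_zero]
      calc _ ≤ C₂ * (1 + 1) * (L * D * |β - β'|) / ((1 + |m|) / (1 + D)) ^ 3 := by gcongr
        _ = C₂ * (1 + D) ^ 3 * (1 / (1 + |m|) ^ 3) * (2 * L * D * |β - β'|) := by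
          field_simp; ring
        _ ≤ _ := by
          have : 0 ≤ L := by linarith
          gcongr; linarith
    · intro σ hσ
      obtain ⟨γ, hγ, rfl⟩ : σ ∈ (fun γ => v * (m + u * γ)) '' Set.uIcc β β' := by
        have : (fun γ => v * (m + u * γ)) = (fun x => v * x) ∘ (fun x => m + x) ∘
          fun x => u * x := by ext; simp
        rw [this, Set.image_comp, Set.image_comp, Set.image_const_mul_uIcc,
          Set.image_const_add_uIcc, Set.image_const_mul_uIcc]
        exact hσ
      exact hT _ _ _ _ (hmul u γ D (Set.uIcc_subset_Icc hβ hβ' hγ) hu) hv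
  · intro θ v v' m u β D hθ hv hv' hβ hu
    have hD : 0 ≤ D := (abs_nonneg u).trans hu
    have h3 := h2 θ (v * (m + u * β)) (v' * (m + u * β)) (u / v) (u / v') ((1 + |m|) / (1 + D))
      (by positivity) ?_
    · refine h3.trans ?_
      have h4 : |v * (m + u * β) - v' * (m + u * β)| ≤ (1 + |m|) * (1 + D) * |v - v'| := by
        rw [← sub_mul, abs_mul, mul_comm]
        gcongr
        refine (abs_add_le _ _).trans ?_
        nlinarith [hmul u β D hβ hu, abs_nonneg m]
      have h5 : |u / v - u / v'| ≤ (1 + |m|) * (1 + D) * |v - v'| := by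
        have hv0 : v ≠ 0 := by linarith
        have hv0' : v' ≠ 0 := by linarith
        rw [show u / v - u / v' = u * (v' - v) / (v * v') by field_simp, abs_div, abs_mul,
          abs_sub_comm v', abs_of_nonneg (by positivity : 0 ≤ v * v')]
        refine (div_le_self (by positivity) (by nlinarith)).trans ?_
        gcongr
        nlinarith [abs_nonneg m]
      calc _ ≤ C₂ * (1 + 1) * ((1 + |m|) * (1 + D) * |v - v'| + (1 + |m|) * (1 + D) * |v - v'|)
            / ((1 + |m|) / (1 + D)) ^ 3 := by gcongr
        _ = C₂ * (1 + D) ^ 3 * (1 / (1 + |m|) ^ 2) * (4 * (1 + D) * |v - v'|) := by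
          field_simp; ring
        _ ≤ _ := by gcongr; linarith
    · intro σ hσ
      obtain ⟨γ, hγ, rfl⟩ : σ ∈ (fun γ => γ * (m + u * β)) '' Set.uIcc v v' := by
        rw [Set.image_mul_const_uIcc]; exact hσ
      refine hT _ _ _ _ (hmul u β D hβ hu) ?_
      have := hγ.1
      exact (le_min hv hv').trans this

/-- Size and regularity of `Fprod`, with a polynomial loss in `Δ`. -/
lemma Cutoffs.Fprod_regular (hc : Cutoffs Φ V) (k : ℕ) : ∃ C, 1 ≤ C ∧
    ∀ (θ Δ v : ℝ) (u m : Fin k → ℤ), |θ| ≤ 1 → 1 ≤ Δ → v ∈ Set.Icc Δ (2 * Δ) →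
      u ∈ shiftVecs k Δ →
      (∀ β ∈ Set.Icc (0 : ℝ) 1, ‖Fprod Φ V θ v u m β‖ ≤ C * Δ ^ (12 * k + 5) * weight 3 m) ∧
      (∀ β ∈ Set.Icc (0 : ℝ) 1, ∀ β' ∈ Set.Icc (0 : ℝ) 1,
        ‖Fprod Φ V θ v u m β - Fprod Φ V θ v u m β'‖ ≤
          C * Δ ^ (12 * k + 5) * weight 3 m * |β - β'|) ∧
      (∀ v' ∈ Set.Icc Δ (2 * Δ), ∀ β ∈ Set.Icc (0 : ℝ) 1,
        ‖Fprod Φ V θ v u m β - Fprod Φ V θ v' u m β‖ ≤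
          C * Δ ^ (12 * k + 5) * weight 2 m * |v - v'|) := by
  obtain ⟨C, hC, h1, h2, h3⟩ := hc.F_lipschitz_lattice
  refine ⟨(8 * C) ^ k * (8 * (k + 1)), ?_, fun θ Δ v u m hθ hΔ hv hu => ?_⟩
  · have : (1 : ℝ) ≤ (8 * C) ^ k := one_le_pow₀ (by linarith)
    have hk : (0 : ℝ) ≤ k := by positivity
    nlinarith
  set D := Δ ^ 4 with hD
  have hD1 : 1 ≤ D := one_le_pow₀ hΔ
  have hv1 : 1 ≤ v := hΔ.trans hv.1
  have huD : ∀ i, |(u i : ℝ)| ≤ D := fun i => by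
    have := (mem_shiftVecs.1 hu i).2
    push_cast at this; exact this
  have hG : (C * (1 + D) ^ 3) ^ k ≤ (8 * C) ^ k * Δ ^ (12 * k) := by
    rw [pow_mul, ← mul_pow]
    refine pow_le_pow_left₀ (by positivity) ?_ k
    calc C * (1 + D) ^ 3 ≤ C * (D + D) ^ 3 := by gcongr
      _ = 8 * C * Δ ^ 12 := by rw [hD]; ring
  have hprod : ∀ n : ℕ, ∏ i, (C * (1 + D) ^ 3 * (1 / (1 + |(m i : ℝ)|) ^ n)) =
      (C * (1 + D) ^ 3) ^ k * weight n m := fun n => by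
    rw [Finset.prod_mul_distrib, Finset.prod_const, Finset.card_univ, Fintype.card_fin, weight]
  have hw3 := weight_nonneg 3 m
  have hw2 := weight_nonneg 2 m
  have hk : (0 : ℝ) ≤ k := by positivity
  have hαD : ∀ β ∈ Set.Icc (0 : ℝ) 1, ∀ i, |(u i : ℝ) * β| ≤ D := by
    intro β hβ i
    rw [abs_mul, abs_of_nonneg hβ.1]
    exact (mul_le_of_le_one_right (abs_nonneg _) hβ.2).trans (huD i)
  have hw : ∀ i, 1 / (1 + |(m i : ℝ)|) ^ 3 ≤ 1 / (1 + |(m i : ℝ)|) ^ 2 := fun i => by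
    gcongr <;> linarith [abs_nonneg (m i : ℝ)]
  refine ⟨fun β hβ => ?_, fun β hβ β' hβ' => ?_, fun v' hv' β hβ => ?_⟩
  · rw [Fprod, norm_prod]
    refine (Finset.prod_le_prod (fun _ _ => norm_nonneg _)
      fun i _ => h1 _ _ _ _ _ hv1 D (hαD β hβ i)).trans ?_
    rw [hprod]
    have h4 : Δ ^ (12 * k) ≤ Δ ^ (12 * k + 5) := pow_le_pow_right₀ hΔ (by omega)
    gcongr
    refine hG.trans ?_
    gcongr
    exact le_mul_of_one_le_right (by positivity) (by linarith)
  · refine (norm_prod_sub_prod_le Finset.univ _ _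
      (fun i => C * (1 + D) ^ 3 * (1 / (1 + |(m i : ℝ)|) ^ 3)) (δ := 2 * (2 * Δ) * D * |β - β'|)
      (fun i => h1 _ _ _ _ _ hv1 D (hαD β hβ i)) (fun i => h1 _ _ _ _ _ hv1 D (hαD β' hβ' i))
      fun i => h2 _ _ _ _ _ _ _ _ _ hθ hv1 hv.2 hβ hβ' (huD i)).trans ?_
    rw [hprod, Finset.card_univ, Fintype.card_fin]
    calc _ ≤ (k : ℝ) * (2 * (2 * Δ) * D * |β - β'|) *
          ((8 * C) ^ k * Δ ^ (12 * k) * weight 3 m) := by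
          gcongr
      _ = (8 * C) ^ k * (4 * k) * Δ ^ (12 * k + 5) * weight 3 m * |β - β'| := by
          rw [hD]; ring
      _ ≤ _ := by gcongr <;> linarith
  · have hv1' : 1 ≤ v' := hΔ.trans hv'.1
    refine (norm_prod_sub_prod_le Finset.univ _ _
      (fun i => C * (1 + D) ^ 3 * (1 / (1 + |(m i : ℝ)|) ^ 2)) (δ := 4 * (1 + D) * |v - v'|)
      (fun i => (h1 _ _ _ _ _ hv1 D (hαD β hβ i)).trans ?_)
      (fun i => (h1 _ _ _ _ _ hv1' D (hαD β hβ i)).trans ?_)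
      fun i => h3 _ _ _ _ _ _ _ hθ hv1 hv1' hβ (huD i)).trans ?_
    · have := hw i; gcongr
    · have := hw i; gcongr
    rw [hprod, Finset.card_univ, Fintype.card_fin]
    calc _ ≤ (k : ℝ) * (4 * (D + D) * |v - v'|) * ((8 * C) ^ k * Δ ^ (12 * k) * weight 2 m) := by
          gcongr
      _ = (8 * C) ^ k * (8 * k) * Δ ^ (12 * k + 4) * weight 2 m * |v - v'| := by
          rw [hD]; ring
      _ ≤ _ := by
          have h5 : Δ ^ (12 * k + 4) ≤ Δ ^ (12 * k + 5) := pow_le_pow_right₀ hΔ (by omega)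
          gcongr
          linarith

lemma card_shiftVecs_le {k : ℕ} {Δ : ℝ} (hΔ : 1 ≤ Δ) :
    ((shiftVecs k Δ).card : ℝ) ≤ 3 ^ k * Δ ^ (4 * k) := by
  have h1 : ((shifts Δ).card : ℝ) ≤ 3 * Δ ^ 4 := by
    have h2 : (shifts Δ).card ≤ (2 * ⌊Δ ^ 4⌋ + 1).toNat := by
      refine (Finset.card_erase_le).trans_eq ?_
      rw [Int.card_Icc]; congr 1; ring
    have h3 : (0 : ℤ) ≤ ⌊Δ ^ 4⌋ := Int.floor_nonneg.2 (by positivity)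
    have h4 : (((2 * ⌊Δ ^ 4⌋ + 1).toNat : ℕ) : ℝ) = 2 * ⌊Δ ^ 4⌋ + 1 := by
      rw [← Int.cast_natCast, Int.toNat_of_nonneg (by omega)]
      push_cast; rfl
    calc ((shifts Δ).card : ℝ) ≤ ((2 * ⌊Δ ^ 4⌋ + 1).toNat : ℕ) := by exact_mod_cast h2
      _ ≤ 2 * Δ ^ 4 + 1 := by rw [h4]; linarith [Int.floor_le (Δ ^ 4)]
      _ ≤ _ := by linarith [one_le_pow₀ (n := 4) hΔ]
  rw [shiftVecs, Fintype.card_piFinset, Finset.prod_const, Finset.card_univ, Fintype.card_fin,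
    pow_mul, ← mul_pow]
  push_cast
  gcongr

/-- The density is bounded and Lipschitz in `v`, with a polynomial loss in `Δ`. -/
lemma Cutoffs.density_regular (hc : Cutoffs Φ V) (k : ℕ) : ∃ C, 1 ≤ C ∧
    ∀ θ Δ v : ℝ, |θ| ≤ 1 → 1 ≤ Δ → v ∈ Set.Icc Δ (2 * Δ) →
      ‖density Φ V k Δ θ v‖ ≤ C * Δ ^ (16 * k + 5) ∧
      ∀ v' ∈ Set.Icc Δ (2 * Δ),
        ‖density Φ V k Δ θ v - density Φ V k Δ θ v'‖ ≤ C * Δ ^ (16 * k + 5) * |v - v'| := by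
  obtain ⟨C, hC, h⟩ := hc.Fprod_regular k
  set W := ∑' m : Fin k → ℤ, weight 2 m
  have hsW := summable_weight (n := 2) le_rfl k
  have hW : 0 ≤ W := tsum_nonneg fun m => weight_nonneg 2 m
  have h32 : ∀ m : Fin k → ℤ, weight 3 m ≤ weight 2 m := fun m =>
    Finset.prod_le_prod (fun i _ => by positivity) fun i _ => by
      gcongr <;> linarith [abs_nonneg (m i : ℝ)]
  refine ⟨3 ^ k * (C * W) + 1, by linarith [(by positivity : 0 ≤ 3 ^ k * (C * W))],
    fun θ Δ v hθ hΔ hv => ?_⟩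
  set T : ℝ → (Fin k → ℤ) → (Fin k → ℤ) → ℂ := fun v u m =>
    if ∑ i, m i = 0 then ∫ β in (0 : ℝ)..1, Fprod Φ V θ v u m β else 0 with hT
  have hT1 : ∀ v ∈ Set.Icc Δ (2 * Δ), ∀ u ∈ shiftVecs k Δ, ∀ m,
      ‖T v u m‖ ≤ C * Δ ^ (12 * k + 5) * weight 2 m := by
    intro v hv u hu m
    have hw := weight_nonneg 2 m
    simp only [hT]
    split_ifs
    · have := intervalIntegral.norm_integral_le_of_norm_le_const (a := 0) (b := 1)
        (f := Fprod Φ V θ v u m) (C := C * Δ ^ (12 * k + 5) * weight 2 m) fun β hβ => by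
          rw [Set.uIoc_of_le zero_le_one] at hβ
          refine ((h θ Δ v u m hθ hΔ hv hu).1 β ⟨hβ.1.le, hβ.2⟩).trans ?_
          have := h32 m
          gcongr
      simpa using this
    · rw [norm_zero]; positivity
  have hTs : ∀ v ∈ Set.Icc Δ (2 * Δ), ∀ u ∈ shiftVecs k Δ, Summable (T v u) := fun v hv u hu =>
    Summable.of_norm_bounded (hsW.mul_left _) fun m => hT1 v hv u hu m
  have hcard : ∀ S : ℝ, 0 ≤ S → ∀ f : (Fin k → ℤ) → ℂ,
      (∀ u ∈ shiftVecs k Δ, ‖f u‖ ≤ C * Δ ^ (12 * k + 5) * S * W) →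
      ‖∑ u ∈ (shiftVecs k Δ).filter (fun u => ∑ i, u i = 0), f u‖ ≤
        (3 ^ k * (C * W) + 1) * Δ ^ (16 * k + 5) * S := by
    intro S hS f hf
    refine (norm_sum_le_of_le _ fun u hu => hf u (Finset.mem_filter.1 hu).1).trans ?_
    rw [Finset.sum_const, nsmul_eq_mul]
    have : (((shiftVecs k Δ).filter (fun u => ∑ i, u i = 0)).card : ℝ) ≤ 3 ^ k * Δ ^ (4 * k) :=
      le_trans (by exact_mod_cast Finset.card_filter_le _ _) (card_shiftVecs_le hΔ)
    calc _ ≤ 3 ^ k * Δ ^ (4 * k) * (C * Δ ^ (12 * k + 5) * S * W) := by gcongr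
      _ = 3 ^ k * (C * W) * Δ ^ (16 * k + 5) * S := by
        rw [show 16 * k + 5 = 4 * k + (12 * k + 5) by ring, pow_add Δ (4 * k)]; ring
      _ ≤ _ := by gcongr; linarith
  constructor
  · have := hcard 1 zero_le_one (fun u => ∑' m, T v u m) fun u hu => by
      refine (tsum_of_norm_bounded (hsW.mul_left _).hasSum (hT1 v hv u hu)).trans_eq ?_
      rw [tsum_mul_left]; ring
    rwa [mul_one] at this
  · intro v' hv'
    rw [density, density, ← Finset.sum_sub_distrib]
    refine hcard _ (abs_nonneg _) (fun u => ∑' m, T v u m - ∑' m, T v' u m) fun u hu => ?_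
    rw [← (hTs v hv u hu).tsum_sub (hTs v' hv' u hu)]
    refine (tsum_of_norm_bounded (hsW.mul_left (C * Δ ^ (12 * k + 5) * |v - v'|)).hasSum
      fun m => ?_).trans_eq (by rw [tsum_mul_left])
    simp only [hT]
    split_ifs
    · rw [← intervalIntegral.integral_sub
        ((hc.continuous_Fprod _ _ _ _).intervalIntegrable _ _)
        ((hc.continuous_Fprod _ _ _ _).intervalIntegrable _ _)]
      have := intervalIntegral.norm_integral_le_of_norm_le_const (a := 0) (b := 1)
        (f := fun β => Fprod Φ V θ v u m β - Fprod Φ V θ v' u m β)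
        (C := C * Δ ^ (12 * k + 5) * weight 2 m * |v - v'|) fun β hβ => by
          rw [Set.uIoc_of_le zero_le_one] at hβ
          exact (h θ Δ v u m hθ hΔ hv hu).2.2 v' hv' β ⟨hβ.1.le, hβ.2⟩
      refine this.trans_eq ?_
      simp; ring
    · rw [sub_zero, norm_zero]
      have := weight_nonneg 2 m
      positivity

/-- Joint continuity of the density in `θ` and `v`; the truncation of `v` avoids the
singularity of `u / v`. -/
lemma Cutoffs.continuous_density (hc : Cutoffs Φ V) (k : ℕ) (Δ : ℝ) :
    Continuous fun x : ℝ × ℝ => density Φ V k Δ x.1 (max x.2 1) := by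
  obtain ⟨C, hC, hb⟩ := hc.Fprod_bound
  refine continuous_finsetSum _ fun u hu => ?_
  have hu' := (Finset.mem_filter.1 hu).1
  have huD : ∀ i, |(u i : ℝ)| ≤ Δ ^ 4 := fun i => by
    have := (mem_shiftVecs.1 hu' i).2
    push_cast at this; exact this
  refine continuous_tsum (u := fun m => (C * (1 + Δ ^ 4) ^ 3) ^ k * weight 3 m) (fun m => ?_)
    ((summable_weight (by norm_num) k).mul_left _) fun m x => ?_
  · split_ifs
    · refine intervalIntegral.continuous_parametric_intervalIntegral_of_continuous'
        (f := fun x : ℝ × ℝ => Fprod Φ V x.1 (max x.2 1) u m) ?_ _ _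
      simp only [Function.uncurry_def, Fprod]
      refine continuous_finsetProd _ fun i _ => hc.continuous_F.comp
        (f := fun p : (ℝ × ℝ) × ℝ => (p.1.1, max p.1.2 1 * (m i + u i * p.2),
          (u i : ℝ) / max p.1.2 1)) ?_
      have : Continuous fun p : (ℝ × ℝ) × ℝ => (u i : ℝ) / max p.1.2 1 :=
        Continuous.div (by fun_prop) (by fun_prop) fun p =>
          (lt_of_lt_of_le one_pos (le_max_right _ _)).ne'
      fun_prop
    · exact continuous_const
  · have h0 : 0 ≤ (C * (1 + Δ ^ 4) ^ 3) ^ k * weight 3 m :=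
      mul_nonneg (pow_nonneg (by positivity) _) (weight_nonneg 3 m)
    split_ifs
    · have := intervalIntegral.norm_integral_le_of_norm_le_const (a := 0) (b := 1)
        (f := Fprod Φ V x.1 (max x.2 1) u m) (C := (C * (1 + Δ ^ 4) ^ 3) ^ k * weight 3 m)
        fun β hβ => by
          rw [Set.uIoc_of_le zero_le_one] at hβ
          exact hb k x.1 (max x.2 1) β (Δ ^ 4) u m (le_max_right _ _) ⟨hβ.1.le, hβ.2⟩ huD
      simpa using this
    · simpa using h0

lemma Cutoffs.integrableOn_mainIntegrand (hc : Cutoffs Φ V) {w φ : ℝ → ℝ}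
    (h₁ : HasCompactSupport w) (h₂ : ContDiff ℝ ∞ w)
    (h₃ : tsupport w ⊆ Set.Ioo (-1 / 2) (1 / 2)) (h₄ : w 0 = 1)
    (hφ : Continuous φ) (hφs : tsupport φ ⊆ Set.Icc (-1 / 100) (1 / 100)) (k : ℕ) {Δ : ℝ}
    (hΔ : 1 ≤ Δ) :
    IntegrableOn (fun x : ℝ × ℝ => mainIntegrand Φ V w φ k Δ x.1 x.2)
      (Set.univ ×ˢ Set.Icc Δ (2 * Δ)) := by
  have hcd := hc.continuous_density k Δ
  have hcont : Continuous fun x : ℝ × ℝ =>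
      (x.2 : ℂ) * density Φ V k Δ x.1 (max x.2 1) * (φ x.1 : ℂ) := by fun_prop
  have h5 : IntegrableOn (fun x : ℝ × ℝ =>
      (x.2 : ℂ) * density Φ V k Δ x.1 (max x.2 1) * (φ x.1 : ℂ))
      (Set.univ ×ˢ Set.Icc Δ (2 * Δ)) := by
    refine IntegrableOn.of_forall_sdiff_eq_zero
      (hcont.continuousOn.integrableOn_compact
        ((isCompact_Icc (a := (-1 / 100 : ℝ)) (b := 1 / 100)).prod
          (isCompact_Icc (a := Δ) (b := 2 * Δ))))
      (MeasurableSet.univ.prod measurableSet_Icc) ?_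
    rintro ⟨θ, v⟩ ⟨⟨-, hv⟩, hx⟩
    have : φ θ = 0 := by
      by_contra hne
      exact hx ⟨hφs (subset_tsupport _ hne), hv⟩
    simp [this]
  refine h5.congr_fun ?_ (MeasurableSet.univ.prod measurableSet_Icc)
  rintro ⟨θ, v⟩ ⟨-, hv⟩
  simp only
  rw [max_eq_left (hΔ.trans hv.1), hc.mainIntegrand_eq h₁ h₂ h₃ h₄ φ k θ hΔ (hΔ.trans hv.1)]

/-! ### The moments of `R~` as sums over `ℤᵏ` -/

/-- The additive character `x ↦ e(x/n)` of `ℤ/n`. -/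
noncomputable def ez (n : ℕ) (x : ZMod n) : ℂ := e (x.val / n)

lemma ez_eq_stdAddChar (n : ℕ) [NeZero n] (x : ZMod n) : ez n x = ZMod.stdAddChar x := by
  conv_rhs => rw [← ZMod.natCast_zmod_val x, ← Int.cast_natCast, ZMod.stdAddChar_coe]
  rw [ez, e]; congr 1; push_cast; ring

lemma ez_intCast (n : ℕ) [NeZero n] (z : ℤ) : ez n (z : ZMod n) = e (z / n) := by
  rw [ez_eq_stdAddChar, ZMod.stdAddChar_coe, e]; congr 1; push_cast; ring

lemma norm_ez (n : ℕ) (x : ZMod n) : ‖ez n x‖ = 1 := norm_e _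

lemma ez_sum {ι : Type*} (n : ℕ) [NeZero n] (s : Finset ι) (f : ι → ZMod n) :
    ez n (∑ i ∈ s, f i) = ∏ i ∈ s, ez n (f i) := by
  classical
  simp_rw [ez_eq_stdAddChar]
  induction s using Finset.induction_on with
  | empty => simp
  | insert i s hi ih =>
    rw [Finset.sum_insert hi, Finset.prod_insert hi, AddChar.map_add_eq_mul, ih]

/-- The residue class modulo `q²` of `4⁻¹ (U h⁻¹ - q M h⁻²)`. -/
noncomputable def phaseArg (q : ℕ) (U M : ℤ) (h : ℕ) : ZMod (q ^ 2) :=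
  4⁻¹ * (U * (h : ZMod (q ^ 2))⁻¹ - q * M * ((h : ZMod (q ^ 2))⁻¹) ^ 2)

/-- The phase `e((4⁻¹ (U h⁻¹ - q M h⁻²)) / q²)`. -/
noncomputable def phase (q : ℕ) (U M : ℤ) (h : ℕ) : ℂ := ez (q ^ 2) (phaseArg q U M h)

lemma norm_phase (q : ℕ) (U M : ℤ) (h : ℕ) : ‖phase q U M h‖ = 1 := norm_ez _ _

lemma phase_sum {k : ℕ} (q : ℕ) [NeZero q] (u m : Fin k → ℤ) (h : ℕ) :
    ∏ i, phase q (u i) (m i) h = phase q (∑ i, u i) (∑ i, m i) h := by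
  simp only [phase]
  rw [← ez_sum]
  congr 1
  simp only [phaseArg]
  rw [← Finset.mul_sum, Finset.sum_sub_distrib, ← Finset.sum_mul, ← Finset.sum_mul,
    ← Finset.mul_sum]
  push_cast
  rfl

lemma zmod_mul_inv {n a : ℕ} (h : Nat.Coprime a n) : (a : ZMod n) * (a : ZMod n)⁻¹ = 1 :=
  ZMod.coe_mul_inv_eq_one a h

/-- Reciprocity: the phases in `R~`, which involve inverses modulo `4v`, are additive characters
modulo `q²`. -/
lemma e_reciprocity {q : ℕ} (hq : 0 < q) (hq2 : Nat.Coprime 4 q) {h : ℕ} (hh : Nat.Coprime h q)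
    {u m v : ℤ} (hv : v = u * h + q * m) (hv0 : v ≠ 0) (hvq : Nat.Coprime q v.natAbs) :
    e (-((qbar q v : ℝ) ^ 2 * (u : ℝ) ^ 2 / (4 * (v : ℝ))) +
      (u : ℝ) ^ 2 / (4 * (v : ℝ) * (q : ℝ) ^ 2)) = phase q u m h := by
  have : NeZero q := ⟨hq.ne'⟩
  set x := phaseArg q u m h with hx
  have h1 : (4 : ZMod (q ^ 2)) * v * x = u ^ 2 := by
    have h4 : (4 : ZMod (q ^ 2)) * 4⁻¹ = 1 := by
      have := zmod_mul_inv (a := 4) (n := q ^ 2) (hq2.pow_right 2)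
      exact_mod_cast this
    have hh' : (h : ZMod (q ^ 2)) * (h : ZMod (q ^ 2))⁻¹ = 1 := zmod_mul_inv (hh.pow_right 2)
    have hqq : (q : ZMod (q ^ 2)) ^ 2 = 0 := by exact_mod_cast ZMod.natCast_self (q ^ 2)
    rw [hx, phaseArg, hv]
    push_cast
    set y := (h : ZMod (q ^ 2))⁻¹
    linear_combination ((u : ZMod (q ^ 2)) * h + q * m) * (u * y - q * m * y ^ 2) * h4 +
      ((u : ZMod (q ^ 2)) ^ 2 - u * q * m * y) * hh' - m ^ 2 * y ^ 2 * hqq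
  -- `4 v ρ - u² + (q q̄)² u²` is divisible by `q²` because `4 v ρ = u²` modulo `q²`, and by `4 v`
  -- because `q q̄ = 1` modulo `4 v`
  set ρ : ℤ := (x.val : ℤ) with hρ
  have hxρ : (ρ : ZMod (q ^ 2)) = x := by simp [hρ]
  have d1 : ((q : ℤ) ^ 2) ∣ 4 * v * ρ - u ^ 2 + (q * qbar q v) ^ 2 * u ^ 2 := by
    have : (((4 * v * ρ - u ^ 2 : ℤ)) : ZMod (q ^ 2)) = 0 := by
      push_cast; rw [hxρ, h1, sub_self]
    rw [ZMod.intCast_zmod_eq_zero_iff_dvd] at this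
    push_cast at this
    refine dvd_add this ?_
    rw [mul_pow, mul_assoc]; exact dvd_mul_right _ _
  have hcop : Nat.Coprime q (4 * v.natAbs) := Nat.Coprime.mul_right hq2.symm hvq
  have d2 : 4 * v ∣ 4 * v * ρ - u ^ 2 + (q * qbar q v) ^ 2 * u ^ 2 := by
    have h2 := qbar_spec q v hcop
    have h3 : ((4 * v.natAbs : ℕ) : ℤ) ∣ 1 - q * qbar q v := by
      have := Nat.modEq_iff_dvd.1 h2
      push_cast at this ⊢; exact this
    have h4 : 4 * v ∣ 1 - (q * qbar q v : ℤ) := by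
      refine dvd_trans ?_ h3
      push_cast
      exact mul_dvd_mul_left 4 (self_dvd_abs v)
    rw [show 4 * v * ρ - u ^ 2 + (q * qbar q v) ^ 2 * u ^ 2 =
      4 * v * ρ - (1 - (q * qbar q v : ℤ)) * ((1 + q * qbar q v) * u ^ 2) by ring]
    exact dvd_sub (dvd_mul_right _ _) (h4.mul_right _)
  have hcop' : IsCoprime ((q : ℤ) ^ 2) (4 * v) := by
    refine IsCoprime.pow_left ?_
    rw [Int.isCoprime_iff_nat_coprime, Int.natAbs_mul]
    exact hcop
  obtain ⟨s, hs⟩ := hcop'.mul_dvd d1 d2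
  have hq0 : (q : ℝ) ≠ 0 := by positivity
  have hvr : (v : ℝ) ≠ 0 := by exact_mod_cast hv0
  have hs' : 4 * (v : ℝ) * ρ - (u : ℝ) ^ 2 + (q * qbar q v) ^ 2 * (u : ℝ) ^ 2 =
      (q : ℝ) ^ 2 * (4 * v) * s := by exact_mod_cast hs
  have hfin : (ρ : ℝ) / ((q ^ 2 : ℕ) : ℝ) = (-((qbar q v : ℝ) ^ 2 * (u : ℝ) ^ 2 / (4 * (v : ℝ))) +
      (u : ℝ) ^ 2 / (4 * (v : ℝ) * (q : ℝ) ^ 2)) + s := by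
    push_cast
    field_simp
    linarith
  rw [phase, ← hx, ← hxρ, ez_intCast, hfin, e_add _ (s : ℝ), e_int, mul_one]

/-- The hypotheses on a modulus that enter the evaluation of `R~`. -/
structure RoughModulus (Δ : ℝ) (q : ℕ) : Prop where
  one_lt : 1 < q
  odd : Nat.Coprime 4 q
  coprime : ∀ u ∈ shifts Δ, Nat.Coprime q u.natAbs

lemma RoughModulus.pos {Δ : ℝ} {q : ℕ} (hq : RoughModulus Δ q) : 0 < q := by
  have := hq.one_lt; omega

section Expansion
variable {Δ N : ℝ} {q a h : ℕ}

lemma exists_inverse (hq : RoughModulus Δ q) (ha : Nat.Coprime a q) :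
    ∃ h : ℕ, h < q ∧ Nat.Coprime h q ∧ 2 * a * h ≡ 1 [MOD q] := by
  have : NeZero q := ⟨hq.pos.ne'⟩
  have h2a : Nat.Coprime (2 * a) q :=
    Nat.Coprime.mul_left (Nat.Coprime.coprime_dvd_left (by norm_num) hq.odd) ha
  refine ⟨((2 * a : ℕ) : ZMod q)⁻¹.val, ZMod.val_lt _, ?_, ?_⟩
  · rw [← ZMod.isUnit_iff_coprime, ZMod.natCast_zmod_val]
    exact IsUnit.of_mul_eq_one _ (by rw [mul_comm]; exact zmod_mul_inv h2a)
  · rw [← ZMod.natCast_eq_natCast_iff]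
    push_cast
    have := zmod_mul_inv h2a
    push_cast at this
    simpa using this

lemma param_mem_B (hh : 2 * a * h ≡ 1 [MOD q]) {u : ℤ} (hu : u ∈ shifts Δ) (m : ℤ) :
    (u, u * h + q * m) ∈ B Δ a q := by
  have hh' : (2 * a * h : ℤ) ≡ 1 [ZMOD q] := by exact_mod_cast (Int.natCast_modEq_iff).2 hh
  have hp := mem_shifts.1 hu
  refine ⟨hp.1, hp.2, ?_⟩
  have h1 := hh'.mul_left u
  have h2 : 2 * (u * h + q * m) * a ≡ u * (2 * a * h) [ZMOD q] := by
    rw [Int.modEq_iff_dvd]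
    exact ⟨-(2 * m * a), by ring⟩
  simpa using (h2.trans h1).symm

/-- The parametrization `v = uh + qm` of the pairs in `B_{a,Δ,q}`, where `2ah ≡ 1 mod q`. -/
def paramB (hh : 2 * a * h ≡ 1 [MOD q]) (p : shifts Δ × ℤ) : B Δ a q :=
  ⟨((p.1 : ℤ), (p.1 : ℤ) * h + q * p.2), param_mem_B hh p.1.2 p.2⟩

lemma paramB_bijective (hq : 0 < q) (hh : 2 * a * h ≡ 1 [MOD q]) :
    Function.Bijective (paramB (Δ := Δ) hh) := by
  have hh' : (2 * a * h : ℤ) ≡ 1 [ZMOD q] := by exact_mod_cast (Int.natCast_modEq_iff).2 hh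
  have hq0 : (q : ℤ) ≠ 0 := by exact_mod_cast hq.ne'
  constructor
  · rintro ⟨⟨u, hu⟩, m⟩ ⟨⟨u', hu'⟩, m'⟩ heq
    have h0 := congrArg Subtype.val heq
    simp only [paramB, Prod.mk.injEq] at h0
    obtain ⟨rfl, h2⟩ := h0
    rw [mul_left_cancel₀ hq0 (add_left_cancel h2)]
  · rintro ⟨⟨u, v⟩, h1, h2, h3⟩
    simp only at h1 h2 h3
    have h4 : u * h ≡ v [ZMOD q] := by
      have h5 := h3.mul_right (h : ℤ)
      have h6 := hh'.mul_left v
      rw [show v * (2 * a * h) = 2 * v * a * h by ring, mul_one] at h6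
      exact h5.trans h6
    obtain ⟨m, hm⟩ := (Int.modEq_iff_dvd).1 h4
    refine ⟨⟨⟨u, mem_shifts.2 ⟨h1, h2⟩⟩, m⟩, Subtype.ext (Prod.ext rfl ?_)⟩
    change u * h + q * m = v
    linarith

lemma Rterm_paramB (hN : 0 < N) (hq : RoughModulus Δ q) (hhq : Nat.Coprime h q)
    (hh : 2 * a * h ≡ 1 [MOD q]) (θ : ℝ) (p : shifts Δ × ℤ) :
    Rterm Φ V N q θ (paramB hh p : B Δ a q) = phase q (p.1 : ℤ) p.2 h *
      F Φ V (N * θ) (q / √N * (p.2 + (p.1 : ℤ) * ((h : ℝ) / q))) ((p.1 : ℤ) / (q / √N)) := by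
  obtain ⟨⟨u, hu⟩, m⟩ := p
  have hvq : Nat.Coprime q (u * h + q * m : ℤ).natAbs := by
    rw [← Int.natAbs_natCast q, ← Int.isCoprime_iff_nat_coprime]
    have h1 : IsCoprime (q : ℤ) u := by
      rw [Int.isCoprime_iff_nat_coprime]; exact hq.coprime u hu
    have h2 : IsCoprime (q : ℤ) h := by
      rw [Int.isCoprime_iff_nat_coprime]; exact hhq.symm
    have := (h1.mul_right h2).add_mul_left_right m
    simpa using this
  have hv0 : u * h + q * m ≠ 0 := by
    intro hv0
    rw [hv0, Int.natAbs_zero, Nat.coprime_zero_right] at hvq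
    exact hq.one_lt.ne' hvq
  have hs : √N ≠ 0 := (Real.sqrt_pos.2 hN).ne'
  have hq0 : (q : ℝ) ≠ 0 := by exact_mod_cast hq.pos.ne'
  simp only [paramB, Rterm]
  rw [e_reciprocity hq.pos hq.odd hhq rfl hv0 hvq]
  congr 2
  push_cast
  field_simp
  ring

/-- The summand of `R~` in the variables `(u, m)`. -/
noncomputable def Rsummand (Φ V : ℝ → ℝ) (q h : ℕ) (θ v : ℝ) (u m : ℤ) : ℂ :=
  phase q u m h * F Φ V θ (v * (m + u * ((h : ℝ) / q))) (u / v)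

lemma Cutoffs.summable_Rsummand (hc : Cutoffs Φ V) (q h : ℕ) (θ : ℝ) {v : ℝ} (hv : 1 ≤ v)
    (u : ℤ) : Summable fun m : ℤ => ‖Rsummand Φ V q h θ v u m‖ := by
  refine (hc.summable_F θ (u / v) (u * ((h : ℝ) / q)) hv).congr fun m => ?_
  rw [Rsummand, norm_mul, norm_phase, one_mul]

lemma Cutoffs.summable_Rterm (hc : Cutoffs Φ V) (hN : 0 < N) (hq : RoughModulus Δ q)
    (hv : 1 ≤ q / √N) (ha : Nat.Coprime a q) (θ : ℝ) :
    Summable fun p : B Δ a q => Rterm Φ V N q θ p := by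
  obtain ⟨h, -, hhq, hh⟩ := exists_inverse hq ha
  rw [← (Equiv.ofBijective _ (paramB_bijective (Δ := Δ) hq.pos hh)).summable_iff]
  have h1 : Summable fun p : shifts Δ × ℤ => Rsummand Φ V q h (N * θ) (q / √N) p.1 p.2 := by
    refine Summable.of_norm ((summable_prod_of_nonneg fun _ => norm_nonneg _).2
      ⟨fun u => hc.summable_Rsummand q h _ hv u, (hasSum_fintype _).summable⟩)
  exact h1.congr fun p => (Rterm_paramB hN hq hhq hh θ p).symm

lemma Cutoffs.Rtilde_eq (hc : Cutoffs Φ V) (hN : 0 < N) (hq : RoughModulus Δ q)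
    (hv : 1 ≤ q / √N) (hhq : Nat.Coprime h q) (hh : 2 * a * h ≡ 1 [MOD q]) (θ : ℝ) :
    Rtilde Φ V Δ N a q θ =
      ∑ u ∈ shifts Δ, ∑' m : ℤ, Rsummand Φ V q h (N * θ) (q / √N) u m := by
  rw [Rtilde, ← (Equiv.ofBijective _ (paramB_bijective (Δ := Δ) hq.pos hh)).tsum_eq]
  have h1 : Summable fun p : shifts Δ × ℤ => Rsummand Φ V q h (N * θ) (q / √N) p.1 p.2 := by
    refine Summable.of_norm ((summable_prod_of_nonneg fun _ => norm_nonneg _).2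
      ⟨fun u => hc.summable_Rsummand q h _ hv u, (hasSum_fintype _).summable⟩)
  calc _ = ∑' p : shifts Δ × ℤ, Rsummand Φ V q h (N * θ) (q / √N) p.1 p.2 :=
        tsum_congr fun p => Rterm_paramB hN hq hhq hh θ p
    _ = ∑' u : shifts Δ, ∑' m : ℤ, Rsummand Φ V q h (N * θ) (q / √N) u m :=
        h1.tsum_prod' fun u => (hc.summable_Rsummand q h _ hv u).of_norm
    _ = _ := by
        rw [tsum_fintype]
        exact Finset.sum_coe_sort (shifts Δ)
          fun u => ∑' m : ℤ, Rsummand Φ V q h (N * θ) (q / √N) u m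

/-- The expanded `k`-th power. -/
noncomputable def Rpow (Φ V : ℝ → ℝ) (k : ℕ) (Δ : ℝ) (q h : ℕ) (θ v : ℝ) : ℂ :=
  ∑ u ∈ shiftVecs k Δ, ∑' m : Fin k → ℤ,
    phase q (∑ i, u i) (∑ i, m i) h * Fprod Φ V θ v u m ((h : ℝ) / q)

lemma Cutoffs.Rtilde_pow (hc : Cutoffs Φ V) (k : ℕ) (hN : 0 < N) (hq : RoughModulus Δ q)
    (hv : 1 ≤ q / √N) (hhq : Nat.Coprime h q) (hh : 2 * a * h ≡ 1 [MOD q]) (θ : ℝ) :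
    Rtilde Φ V Δ N a q θ ^ k = Rpow Φ V k Δ q h (N * θ) (q / √N) := by
  have : NeZero q := ⟨hq.pos.ne'⟩
  rw [hc.Rtilde_eq hN hq hv hhq hh]
  have h1 : ∀ S : ℂ, S ^ k = ∏ _i : Fin k, S := fun S => by simp
  rw [h1, Finset.prod_univ_sum, Rpow]
  refine Finset.sum_congr rfl fun u _ => ?_
  rw [(summable_norm_prod_and_prod_tsum fun i => hc.summable_Rsummand q h _ hv (u i)).2]
  refine tsum_congr fun m => ?_
  simp only [Rsummand]
  rw [Finset.prod_mul_distrib, phase_sum]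
  rfl

lemma Cutoffs.continuous_Rpow (hc : Cutoffs Φ V) (k : ℕ) (hhq : h ≤ q) {v : ℝ} (hv : 1 ≤ v) :
    Continuous fun θ => Rpow Φ V k Δ q h θ v := by
  obtain ⟨C, hC, hb⟩ := hc.Fprod_bound
  refine continuous_finsetSum _ fun u hu => ?_
  have huD : ∀ i, |(u i : ℝ)| ≤ Δ ^ 4 := fun i => by
    have := (mem_shiftVecs.1 hu i).2
    push_cast at this; exact this
  refine continuous_tsum (u := fun m => (C * (1 + Δ ^ 4) ^ 3) ^ k * weight 3 m) (fun m => ?_)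
    ((summable_weight (by norm_num) k).mul_left _) fun m θ => ?_
  · refine continuous_const.mul (continuous_finsetProd _ fun i _ => hc.continuous_F.comp
      (f := fun θ : ℝ => (θ, v * (m i + u i * ((h : ℝ) / q)), (u i : ℝ) / v)) (by fun_prop))
  · rw [norm_mul, norm_phase, one_mul]
    refine hb k θ v _ (Δ ^ 4) u m hv ⟨by positivity, div_le_one_of_le₀ ?_ (by positivity)⟩ huD
    exact_mod_cast hhq

/-- Summing over `a` coprime to `q` amounts to summing over its partner `h`. -/
lemma sum_coprime_reindex (hq : RoughModulus Δ q) (f g : ℕ → ℂ)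
    (hfg : ∀ a h, Nat.Coprime a q → Nat.Coprime h q → h < q → 2 * a * h ≡ 1 [MOD q] →
      f a = g h) :
    ∑ a ∈ (Finset.Icc 1 q).filter (fun a => Nat.Coprime a q), f a =
      ∑ h ∈ (Finset.range q).filter (fun h => Nat.Coprime h q), g h := by
  choose! i hi1 hi2 hi3 using fun a (ha : Nat.Coprime a q) => exists_inverse hq ha
  have hlt : ∀ a, a ≤ q → Nat.Coprime a q → a < q := fun a h1 h2 => by
    rcases h1.lt_or_eq with h | rfl
    · exact h
    · rw [Nat.coprime_self] at h2
      have := hq.one_lt; omega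
  have hpos : ∀ h, Nat.Coprime h q → 1 ≤ h := fun h h2 => by
    rcases Nat.eq_zero_or_pos h with rfl | h'
    · rw [Nat.coprime_zero_left] at h2
      have := hq.one_lt; omega
    · exact h'
  have hinv : ∀ a, a < q → Nat.Coprime a q → i (i a) = a := by
    intro a ha1 ha2
    have h1 := hi3 a ha2
    have h2 := hi3 _ (hi2 a ha2)
    have h3 : 2 * i a * i (i a) ≡ 2 * i a * a [MOD q] := by
      refine h2.trans (h1.symm.trans ?_)
      rw [show 2 * a * i a = 2 * i a * a by ring]
    have h4 : Nat.Coprime q (2 * i a) :=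
      Nat.Coprime.mul_right (Nat.Coprime.coprime_dvd_left (by norm_num) hq.odd).symm
        (hi2 a ha2).symm
    have h5 := Nat.ModEq.cancel_left_of_coprime (by simpa using h4) h3
    exact Nat.ModEq.eq_of_lt_of_lt h5 (hi1 _ (hi2 a ha2)) ha1
  refine Finset.sum_bij' (fun a _ => i a) (fun h _ => i h) ?_ ?_ ?_ ?_ ?_
  · intro a ha
    rw [Finset.mem_filter] at ha ⊢
    exact ⟨Finset.mem_range.2 (hi1 a ha.2), hi2 a ha.2⟩
  · intro h hh
    rw [Finset.mem_filter] at hh ⊢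
    exact ⟨Finset.mem_Icc.2 ⟨hpos _ (hi2 h hh.2), (hi1 h hh.2).le⟩, hi2 h hh.2⟩
  · intro a ha
    rw [Finset.mem_filter, Finset.mem_Icc] at ha
    exact hinv a (hlt a ha.1.2 ha.2) ha.2
  · intro h hh
    rw [Finset.mem_filter, Finset.mem_range] at hh
    exact hinv h hh.1 hh.2
  · intro a ha
    rw [Finset.mem_filter] at ha
    exact hfg a (i a) ha.2 (hi2 a ha.2) (hi1 a ha.2) (hi3 a ha.2)

end Expansion

/-! ### Tools for exponential sums -/

/-- Partial summation against a sequence of bounded size and variation. -/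
lemma norm_sum_mul_le_of_partial_sums {n : ℕ} (a g : ℕ → ℂ) {E D L : ℝ}
    (hE : ∀ j ≤ n, ‖∑ i ∈ Finset.range j, a i‖ ≤ E) (hD : ∀ i < n, ‖g i‖ ≤ D)
    (hL : ∀ i, i + 1 < n → ‖g (i + 1) - g i‖ ≤ L) (hD0 : 0 ≤ D) (hL0 : 0 ≤ L) :
    ‖∑ i ∈ Finset.range n, a i * g i‖ ≤ E * (D + n * L) := by
  have hE0 : 0 ≤ E := (norm_nonneg _).trans (hE 0 (Nat.zero_le _))
  rcases Nat.eq_zero_or_pos n with rfl | hn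
  · simpa using mul_nonneg hE0 hD0
  have h := Finset.sum_range_by_parts g a n
  simp only [smul_eq_mul] at h
  simp_rw [mul_comm (a _)]
  rw [h]
  refine (norm_sub_le _ _).trans ?_
  have h1 : ‖g (n - 1) * ∑ i ∈ Finset.range n, a i‖ ≤ D * E := by
    rw [norm_mul]
    exact mul_le_mul (hD _ (by omega)) (hE n le_rfl) (norm_nonneg _) hD0
  have h2 : ‖∑ i ∈ Finset.range (n - 1), (g (i + 1) - g i) * ∑ i ∈ Finset.range (i + 1), a i‖ ≤
      n * (L * E) := by
    refine (norm_sum_le_of_le (f := fun i => (g (i + 1) - g i) *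
      ∑ i ∈ Finset.range (i + 1), a i) (n := fun _ => L * E) _ fun i hi => ?_).trans ?_
    · rw [Finset.mem_range] at hi
      rw [norm_mul]
      exact mul_le_mul (hL i (by omega)) (hE _ (by omega)) (norm_nonneg _) hL0
    · rw [Finset.sum_const, Finset.card_range, nsmul_eq_mul]
      gcongr
      omega
  linarith

/-- Counting residues modulo a squarefree number prime by prime. -/
lemma card_le_prod_of_squarefree {n : ℕ} (hn : Squarefree n) (S : Finset (ZMod n)) (d : ℕ → ℕ)
    (h : ∀ p ∈ n.primeFactors, ∃ T : Finset (ZMod p), T.card ≤ d p ∧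
      ∀ x ∈ S, (x.val : ZMod p) ∈ T) :
    S.card ≤ ∏ p ∈ n.primeFactors, d p := by
  classical
  have : NeZero n := ⟨hn.ne_zero⟩
  choose! T hT1 hT2 using h
  refine le_trans ?_ (Finset.prod_le_prod' hT1)
  rw [← Finset.card_pi]
  refine Finset.card_le_card_of_injOn (fun x p _ => (x.val : ZMod p)) ?_ ?_
  · intro x hx
    exact Finset.mem_pi.2 fun p hp => hT2 p hp x hx
  · intro x _ y _ hxy
    have h1 : ∀ p ∈ n.primeFactors, (p : ℤ) ∣ (x.val : ℤ) - y.val := by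
      intro p hp
      have h2 : (x.val : ZMod p) = y.val := congrFun (congrFun hxy p) hp
      rw [← ZMod.intCast_zmod_eq_zero_iff_dvd]
      push_cast
      rw [h2, sub_self]
    have h2 : ((n : ℕ) : ℤ) ∣ (x.val : ℤ) - y.val := by
      have h3 : ((n : ℕ) : ℤ) = ∏ p ∈ n.primeFactors, (p : ℤ) := by
        rw [← Nat.cast_prod, Nat.prod_primeFactors_of_squarefree hn]
      rw [h3]
      refine Finset.prod_dvd_of_coprime (fun p hp p' hp' hne => ?_) h1
      rw [Function.onFun, Int.isCoprime_iff_nat_coprime]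
      exact (Nat.coprime_primes (Nat.prime_of_mem_primeFactors hp)
        (Nat.prime_of_mem_primeFactors hp')).2 hne
    rw [← ZMod.intCast_zmod_eq_zero_iff_dvd] at h2
    push_cast at h2
    rw [ZMod.natCast_zmod_val, ZMod.natCast_zmod_val, sub_eq_zero] at h2
    exact h2

/-- The number of roots modulo a squarefree `n` of a family of polynomials that are nonzero of
degree at most `d` modulo all primes not dividing `z`. -/
lemma card_le_of_polynomial {n : ℕ} (hn : Squarefree n) (S : Finset (ZMod n)) {z : ℤ} (hz : z ≠ 0)
    {d : ℕ} (hd : 1 ≤ d)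
    (h : ∀ p ∈ n.primeFactors, ¬ (p : ℤ) ∣ z → ∃ f : Polynomial (ZMod p), f ≠ 0 ∧
      f.natDegree ≤ d ∧ ∀ x ∈ S, f.eval (x.val : ZMod p) = 0) :
    S.card ≤ d ^ n.primeFactors.card * z.natAbs := by
  classical
  refine (card_le_prod_of_squarefree hn S (fun p => if (p : ℤ) ∣ z then p else d)
    fun p hp => ?_).trans ?_
  · have : Fact p.Prime := ⟨Nat.prime_of_mem_primeFactors hp⟩
    split_ifs with hpz
    · exact ⟨Finset.univ, by simp [ZMod.card], fun x _ => Finset.mem_univ _⟩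
    · obtain ⟨f, hf0, hfd, hf⟩ := h p hp hpz
      refine ⟨f.roots.toFinset, (Multiset.toFinset_card_le _).trans
        ((Polynomial.card_roots' f).trans hfd), fun x hx => ?_⟩
      rw [Multiset.mem_toFinset, Polynomial.mem_roots hf0]
      exact hf x hx
  · rw [Finset.prod_ite, Finset.prod_const, mul_comm]
    refine Nat.mul_le_mul (Nat.pow_le_pow_right hd (Finset.card_filter_le _ _)) ?_
    refine Nat.le_of_dvd (Int.natAbs_pos.2 hz) ?_
    refine Finset.prod_primes_dvd _ (fun p hp => ?_) fun p hp => ?_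
    · exact (Nat.prime_of_mem_primeFactors (Finset.mem_filter.1 hp).1).prime
    · exact Int.natCast_dvd.1 (Finset.mem_filter.1 hp).2

/-- The bound for a geometric sum with ratio `e(r/c)`: trivial for `r = 0`, and in terms of the
distance of `r/c` to the nearest integer otherwise. -/
noncomputable def geomBound (c : ℕ) (B : ℝ) (r : ZMod c) : ℝ :=
  if r = 0 then B else c / 2 * (1 / (r.val : ℝ) + 1 / ((c : ℝ) - r.val))

lemma geomBound_nonneg (c : ℕ) [NeZero c] {B : ℝ} (hB : 0 ≤ B) (r : ZMod c) :
    0 ≤ geomBound c B r := by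
  rw [geomBound]
  split_ifs
  · exact hB
  · have : (r.val : ℝ) ≤ c := by exact_mod_cast (ZMod.val_lt r).le
    have : 0 ≤ (c : ℝ) - r.val := by linarith
    positivity

lemma sin_pi_mul_ge {x : ℝ} (h0 : 0 ≤ x) (h1 : x ≤ 1 / 2) : 2 * x ≤ Real.sin (Real.pi * x) := by
  have := Real.mul_le_sin (x := Real.pi * x) (by positivity) (by nlinarith [Real.pi_pos])
  calc 2 * x = 2 / Real.pi * (Real.pi * x) := by field_simp
    _ ≤ _ := this

lemma norm_one_sub_e (x : ℝ) : ‖1 - e x‖ = 2 * |Real.sin (Real.pi * x)| := by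
  rw [norm_sub_rev]
  have : e x = Complex.exp (Complex.I * ((2 * Real.pi * x : ℝ) : ℂ)) := by
    rw [e]; congr 1; push_cast; ring
  rw [this, Complex.norm_exp_I_mul_ofReal_sub_one, norm_mul, Real.norm_eq_abs, Real.norm_eq_abs,
    abs_two]
  congr 3; ring

lemma norm_geom_sum_le (c : ℕ) [NeZero c] (r : ZMod c) {Y : ℕ} {B : ℝ} (hY : (Y : ℝ) ≤ B) :
    ‖∑ y ∈ Finset.range Y, ez c (r * y)‖ ≤ geomBound c B r := by
  have hpow : ∀ y : ℕ, ez c (r * y) = ez c r ^ y := by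
    intro y
    rw [ez_eq_stdAddChar, ez_eq_stdAddChar, ← AddChar.map_nsmul_eq_pow, nsmul_eq_mul, mul_comm]
  rw [geomBound]
  split_ifs with hr
  · refine (norm_sum_le_of_le _ fun y _ => (norm_ez _ _).le).trans ?_
    simpa using hY
  · simp_rw [hpow]
    have hc0 : (0 : ℝ) < c := by exact_mod_cast NeZero.pos c
    have hv0 : 0 < (r.val : ℝ) := by
      have : r.val ≠ 0 := by rwa [Ne, ZMod.val_eq_zero]
      positivity
    have hvc : (r.val : ℝ) < c := by exact_mod_cast ZMod.val_lt r
    have hmul := mul_neg_geom_sum (ez c r) Y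
    have h2 : ‖(1 - ez c r) * ∑ i ∈ Finset.range Y, ez c r ^ i‖ ≤ 2 := by
      rw [hmul]
      refine (norm_sub_le _ _).trans ?_
      rw [norm_one, norm_pow, norm_ez, one_pow]; norm_num
    rw [norm_mul, ez, norm_one_sub_e] at h2
    set S := ‖∑ i ∈ Finset.range Y, e (r.val / c) ^ i‖
    have hS : 0 ≤ S := norm_nonneg _
    rcases le_total ((r.val : ℝ) / c) (1 / 2) with h | h
    · have h3 := sin_pi_mul_ge (by positivity) h
      have h4 : S ≤ c / 2 * (1 / r.val) := by
        rw [mul_one_div, div_div, le_div_iff₀ (by positivity)]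
        have h5 : 2 * (2 * (r.val / c)) * S ≤ 2 := by
          refine le_trans ?_ h2
          gcongr
          exact h3.trans (le_abs_self _)
        have h6 : 2 * (2 * (r.val / c)) * S = 4 * r.val * S / c := by ring
        rw [h6, div_le_iff₀ hc0] at h5
        linarith
      refine h4.trans ?_
      have : 0 ≤ 1 / ((c : ℝ) - r.val) := by
        have : 0 < (c : ℝ) - r.val := by linarith
        positivity
      gcongr; linarith
    · have hx : (r.val : ℝ) / c ≤ 1 := div_le_one_of_le₀ hvc.le hc0.le
      have h3 := sin_pi_mul_ge (x := 1 - r.val / c) (by linarith) (by linarith)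
      rw [show Real.pi * (1 - r.val / c) = Real.pi - Real.pi * (r.val / c) by ring,
        Real.sin_pi_sub] at h3
      have hcv : 0 < (c : ℝ) - r.val := by linarith
      have h4 : S ≤ c / 2 * (1 / (c - r.val)) := by
        rw [mul_one_div, div_div, le_div_iff₀ (by positivity)]
        have h5 : 2 * (2 * (1 - r.val / c)) * S ≤ 2 := by
          refine le_trans ?_ h2
          gcongr
          exact h3.trans (le_abs_self _)
        have h6 : 2 * (2 * (1 - r.val / c)) * S = 4 * (c - r.val) * S / c := by
          field_simp; ring
        rw [h6, div_le_iff₀ hc0] at h5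
        linarith
      refine h4.trans ?_
      have : 0 ≤ 1 / (r.val : ℝ) := by positivity
      gcongr; linarith

lemma sum_zmod_eq_sum_range {M : Type*} [AddCommMonoid M] (n : ℕ) [NeZero n] (f : ℕ → M) :
    ∑ x : ZMod n, f x.val = ∑ i ∈ Finset.range n, f i := by
  refine Finset.sum_bij (fun x _ => x.val) (fun x _ => Finset.mem_range.2 (ZMod.val_lt x))
    (fun x _ y _ h => ZMod.val_injective n h) (fun i hi => ⟨(i : ZMod n), Finset.mem_univ _, ?_⟩)
    (fun _ _ => rfl)
  exact ZMod.val_cast_of_lt (Finset.mem_range.1 hi)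

lemma sum_geomBound_le (c : ℕ) [NeZero c] {B : ℝ} :
    ∑ r : ZMod c, geomBound c B r ≤ B + c * (1 + Real.log c) := by
  have hc : 0 < c := NeZero.pos c
  have h1 : ∑ r : ZMod c, geomBound c B r = ∑ i ∈ Finset.range c, if i = 0 then B else
      (c : ℝ) / 2 * (1 / (i : ℝ) + 1 / ((c : ℝ) - i)) := by
    rw [← sum_zmod_eq_sum_range]
    refine Finset.sum_congr rfl fun r _ => ?_
    simp only [geomBound, ZMod.val_eq_zero]
  rw [h1]
  clear h1
  obtain ⟨c', rfl⟩ : ∃ c', c = c' + 1 := ⟨c - 1, by omega⟩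
  rw [Finset.sum_range_succ']
  simp only [Nat.add_eq_zero_iff, one_ne_zero, and_false, if_false, if_true]
  rw [← Finset.mul_sum, Finset.sum_add_distrib]
  have h2 : ∑ i ∈ Finset.range c', 1 / ((i + 1 : ℕ) : ℝ) = (harmonic c' : ℝ) := by
    rw [harmonic]; push_cast; simp [one_div]
  have h3 : ∑ i ∈ Finset.range c', 1 / (((c' + 1 : ℕ) : ℝ) - (i + 1 : ℕ)) = (harmonic c' : ℝ) := by
    rw [← h2, ← Finset.sum_range_reflect]
    refine Finset.sum_congr rfl fun i hi => ?_
    rw [Finset.mem_range] at hi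
    congr 1
    have : ((c' - 1 - i : ℕ) : ℝ) = (c' : ℝ) - 1 - i := by
      rw [Nat.cast_sub (by omega), Nat.cast_sub (by omega)]; simp
    push_cast
    rw [this]; ring
  rw [h2, h3]
  have h4 : (harmonic c' : ℝ) ≤ 1 + Real.log ((c' + 1 : ℕ) : ℝ) := by
    refine (harmonic_le_one_add_log c').trans ?_
    rcases Nat.eq_zero_or_pos c' with rfl | hc'
    · simp
    · gcongr; simp
  have h5 : (0 : ℝ) ≤ ((c' + 1 : ℕ) : ℝ) := by positivity
  nlinarith

/-- Completion: an incomplete sum is controlled by the Fourier coefficients of the summand. -/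
lemma norm_incomplete_sum_le (q : ℕ) [NeZero q] (f : ZMod q → ℂ) {T : ℝ}
    (hT : ∀ l : ZMod q, ‖∑ x, f x * ez q (l * x)‖ ≤ T) {X : ℕ} (hX : X ≤ q) :
    ‖∑ h ∈ Finset.range X, f h‖ ≤ T * (2 + Real.log q) := by
  classical
  have hq0 : (q : ℂ) ≠ 0 := by exact_mod_cast NeZero.ne q
  have horth : ∀ x y : ZMod q, ∑ l : ZMod q, ez q (l * (x - y)) = if x = y then (q : ℂ) else 0 := by
    intro x y
    simp_rw [ez_eq_stdAddChar]
    rw [AddChar.sum_mulShift (x - y) (ZMod.isPrimitive_stdAddChar q)]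
    simp only [sub_eq_zero, ZMod.card]
    split_ifs <;> simp
  have h1 : (q : ℂ) * ∑ h ∈ Finset.range X, f h =
      ∑ l : ZMod q, (∑ x, f x * ez q (l * x)) * ∑ y ∈ Finset.range X, ez q (-l * y) := by
    calc (q : ℂ) * ∑ h ∈ Finset.range X, f h
        = ∑ y ∈ Finset.range X, ∑ x : ZMod q, f x * (if x = (y : ZMod q) then (q : ℂ) else 0) := by
          rw [Finset.mul_sum]
          refine Finset.sum_congr rfl fun y _ => ?_
          simp [mul_comm]
      _ = ∑ y ∈ Finset.range X, ∑ x : ZMod q, ∑ l : ZMod q,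
            f x * ez q (l * x) * ez q (-l * y) := by
          refine Finset.sum_congr rfl fun y _ => Finset.sum_congr rfl fun x _ => ?_
          rw [← horth, Finset.mul_sum]
          refine Finset.sum_congr rfl fun l _ => ?_
          rw [mul_assoc]
          congr 1
          simp_rw [ez_eq_stdAddChar]
          rw [← AddChar.map_add_eq_mul]; congr 1; ring
      _ = _ := by
          rw [Finset.sum_congr rfl fun y _ => Finset.sum_comm, Finset.sum_comm]
          refine Finset.sum_congr rfl fun l _ => ?_
          rw [Finset.sum_comm, Finset.sum_mul_sum]
  have hT0 : 0 ≤ T := (norm_nonneg _).trans (hT 0)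
  have h2 : ‖(q : ℂ) * ∑ h ∈ Finset.range X, f h‖ ≤ T * (q + q * (1 + Real.log q)) := by
    rw [h1]
    refine (norm_sum_le_of_le (n := fun l => T * geomBound q q (-l)) _ fun l _ => ?_).trans ?_
    · rw [norm_mul]
      refine mul_le_mul (hT l) (norm_geom_sum_le q (-l) (by exact_mod_cast hX)) (norm_nonneg _) hT0
    · rw [← Finset.mul_sum, ← Equiv.sum_comp (Equiv.neg (ZMod q))]
      simp only [Equiv.neg_apply, neg_neg]
      gcongr
      exact sum_geomBound_le q
  rw [norm_mul, Complex.norm_natCast] at h2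
  have hq1 : (0 : ℝ) < q := by exact_mod_cast NeZero.pos q
  have h3 : T * (q + q * (1 + Real.log q)) = q * (T * (2 + Real.log q)) := by ring
  rw [h3] at h2
  exact le_of_mul_le_mul_left h2 hq1

/-! ### Fourth moments: the phases with `U = 0` -/

section FourthMoment

lemma val_eq_castHom {n p : ℕ} [NeZero n] (h : p ∣ n) (x : ZMod n) :
    (x.val : ZMod p) = ZMod.castHom h (ZMod p) x := by
  conv_rhs => rw [← ZMod.natCast_zmod_val x]
  rw [map_natCast]

lemma castHom_inv {n m : ℕ} (hmn : m ∣ n) {h : ℕ} (hh : Nat.Coprime h n) :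
    ZMod.castHom hmn (ZMod m) (h : ZMod n)⁻¹ = (h : ZMod m)⁻¹ := by
  have h1 : (h : ZMod m) * ZMod.castHom hmn (ZMod m) (h : ZMod n)⁻¹ = 1 := by
    have := congrArg (ZMod.castHom hmn (ZMod m)) (zmod_mul_inv hh)
    rwa [map_mul, map_natCast, map_one] at this
  have h2 := zmod_mul_inv (Nat.Coprime.coprime_dvd_right hmn hh)
  calc _ = (h : ZMod m)⁻¹ * ((h : ZMod m) * ZMod.castHom hmn (ZMod m) (h : ZMod n)⁻¹) := by
        rw [← mul_assoc, mul_comm (h : ZMod m)⁻¹, h2, one_mul]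
    _ = _ := by rw [h1, mul_one]

lemma ez_sq_mul (q : ℕ) [NeZero q] (z : ZMod (q ^ 2)) :
    ez (q ^ 2) ((q : ZMod (q ^ 2)) * z) =
      ez q (ZMod.castHom (dvd_pow_self q two_ne_zero) (ZMod q) z) := by
  rw [← val_eq_castHom]
  have h1 : (q : ZMod (q ^ 2)) * z = ((q * z.val : ℤ) : ZMod (q ^ 2)) := by
    push_cast; rw [ZMod.natCast_zmod_val]
  have h2 : (z.val : ZMod q) = ((z.val : ℤ) : ZMod q) := by push_cast; rfl
  rw [h1, h2, ez_intCast, ez_intCast]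
  congr 1
  have : (q : ℝ) ≠ 0 := by exact_mod_cast NeZero.ne q
  push_cast
  field_simp

lemma two_ne_zero_of_mem {n p : ℕ} (hn : Nat.Coprime 4 n) (hp : p ∈ n.primeFactors) :
    (2 : ZMod p) ≠ 0 := by
  have hpp := Nat.prime_of_mem_primeFactors hp
  intro h
  have : ((2 : ℕ) : ZMod p) = 0 := by exact_mod_cast h
  rw [ZMod.natCast_eq_zero_iff] at this
  have h4 := Nat.dvd_gcd (dvd_trans this (by norm_num : 2 ∣ 4)) (Nat.dvd_of_mem_primeFactors hp)
  rw [hn] at h4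
  exact hpp.one_lt.ne' (Nat.dvd_one.1 h4)

lemma coeff_quartic {R : Type*} [CommRing R] (a b c d e' : R) :
    (Polynomial.C a * Polynomial.X ^ 4 + Polynomial.C b * Polynomial.X ^ 3 +
      Polynomial.C c * Polynomial.X ^ 2 + Polynomial.C d * Polynomial.X +
      Polynomial.C e').coeff 4 = a ∧
    (Polynomial.C a * Polynomial.X ^ 4 + Polynomial.C b * Polynomial.X ^ 3 +
      Polynomial.C c * Polynomial.X ^ 2 + Polynomial.C d * Polynomial.X +
      Polynomial.C e').coeff 2 = c := by
  exact ⟨by simp, by simp⟩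

/-- Few pairs of units have given values of `x₁ + x₂` and `x₁⁻² + x₂⁻²`. -/
lemma card_pairs_le {q : ℕ} [NeZero q] (hq : Squarefree q) (hq4 : Nat.Coprime 4 q)
    (r s : ZMod q) :
    ((Finset.univ : Finset ((ZMod q)ˣ × (ZMod q)ˣ)).filter fun x =>
      ((x.1⁻¹ : (ZMod q)ˣ) : ZMod q) ^ 2 + ((x.2⁻¹ : (ZMod q)ˣ) : ZMod q) ^ 2 = r ∧
      (x.1 : ZMod q) + x.2 = s).card ≤ 4 ^ q.primeFactors.card := by
  classical
  set S := (Finset.univ : Finset ((ZMod q)ˣ × (ZMod q)ˣ)).filter fun x =>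
      ((x.1⁻¹ : (ZMod q)ˣ) : ZMod q) ^ 2 + ((x.2⁻¹ : (ZMod q)ˣ) : ZMod q) ^ 2 = r ∧
      (x.1 : ZMod q) + x.2 = s with hS
  have hinj : Set.InjOn (fun x : (ZMod q)ˣ × (ZMod q)ˣ => (x.1 : ZMod q)) S := by
    rintro ⟨x1, x2⟩ hx ⟨y1, y2⟩ hy hxy
    simp only [hS, Finset.coe_filter, Finset.mem_univ, true_and, Set.mem_ofPred_eq] at hx hy
    simp only at hxy
    have h2 : (x2 : ZMod q) = y2 := by
      have := hx.2.trans hy.2.symm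
      rw [hxy] at this
      exact add_left_cancel this
    rw [Units.ext hxy, Units.ext h2]
  rw [← Finset.card_image_of_injOn hinj]
  have := card_le_of_polynomial hq (S.image fun x => (x.1 : ZMod q)) (z := 1) one_ne_zero
    (d := 4) (by norm_num) fun p hp _ => ?_
  · simpa using this
  have : Fact p.Prime := ⟨Nat.prime_of_mem_primeFactors hp⟩
  have hpq := Nat.dvd_of_mem_primeFactors hp
  set c := ZMod.castHom hpq (ZMod p)
  -- clear denominators in `x₁⁻² + x₂⁻² = r` and substitute `x₂ = s - x₁`; the leading coefficient
  -- `r` and the coefficient `r s² - 2` of `X²` cannot both vanish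
  open Polynomial in
  refine ⟨C (c r) * X ^ 4 + C (-2 * c r * c s) * X ^ 3 + C (c r * c s ^ 2 - 2) * X ^ 2 +
    C (2 * c s) * X + C (-(c s) ^ 2), ?_, by compute_degree, ?_⟩
  · intro h0
    obtain ⟨h4, h2⟩ := coeff_quartic (c r) (-2 * c r * c s) (c r * c s ^ 2 - 2) (2 * c s)
      (-(c s) ^ 2)
    rw [h0, Polynomial.coeff_zero] at h4 h2
    rw [← h4] at h2
    exact two_ne_zero_of_mem hq4 hp (by linear_combination h2)
  · intro y hy
    rw [Finset.mem_image] at hy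
    obtain ⟨⟨x1, x2⟩, hx, rfl⟩ := hy
    simp only [hS, Finset.mem_filter, Finset.mem_univ, true_and] at hx
    rw [val_eq_castHom hpq]
    have hr : (x1 : ZMod q) ^ 2 + (x2 : ZMod q) ^ 2 = r * x1 ^ 2 * x2 ^ 2 := by
      rw [← hx.1]
      have e1 : (x1 : ZMod q) * ((x1⁻¹ : (ZMod q)ˣ) : ZMod q) = 1 := Units.mul_inv x1
      have e2 : (x2 : ZMod q) * ((x2⁻¹ : (ZMod q)ˣ) : ZMod q) = 1 := Units.mul_inv x2
      linear_combination (-(x2 : ZMod q) ^ 2 * (x1 * ((x1⁻¹ : (ZMod q)ˣ) : ZMod q) + 1)) * e1 -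
        ((x1 : ZMod q) ^ 2 * (x2 * ((x2⁻¹ : (ZMod q)ˣ) : ZMod q) + 1)) * e2
    have h1 := congrArg c hr
    have h2 := congrArg c hx.2
    simp only [map_add, map_mul, map_pow] at h1 h2
    have h3 : c (x2 : ZMod q) = c s - c (x1 : ZMod q) := by rw [← h2]; ring
    rw [h3] at h1
    simp only [Polynomial.eval_add, Polynomial.eval_mul, Polynomial.eval_C, Polynomial.eval_pow,
      Polynomial.eval_X]
    rw [show ZMod.castHom hpq (ZMod p) (x1 : ZMod q) = c x1 from rfl]
    linear_combination -h1

/-- The Parseval identity behind the moment computation. -/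
lemma sum_norm_sq_eq {q : ℕ} [NeZero q] {I : Type*} [Fintype I] [DecidableEq I]
    (R s : I → ZMod q) :
    ∑ α : ZMod q, ∑ l : ZMod q, ‖∑ i, ez q (α * R i + l * s i)‖ ^ 2 =
      (q : ℝ) ^ 2 * ∑ i, ((Finset.univ.filter fun j => R j = R i ∧ s j = s i).card : ℝ) := by
  have horth : ∀ x y : ZMod q, ∑ l : ZMod q, ez q (l * (x - y)) = if x = y then (q : ℂ) else 0 := by
    intro x y
    simp_rw [ez_eq_stdAddChar]
    rw [AddChar.sum_mulShift (x - y) (ZMod.isPrimitive_stdAddChar q)]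
    simp only [sub_eq_zero, ZMod.card]
    split_ifs <;> simp
  have hsq : ∀ α l : ZMod q, ((‖∑ i, ez q (α * R i + l * s i)‖ ^ 2 : ℝ) : ℂ) =
      ∑ i, ∑ j, ez q (α * (R j - R i)) * ez q (l * (s j - s i)) := by
    intro α l
    rw [Complex.ofReal_pow, ← Complex.conj_mul', map_sum, Finset.sum_mul_sum]
    refine Finset.sum_congr rfl fun i _ => Finset.sum_congr rfl fun j _ => ?_
    simp_rw [ez_eq_stdAddChar]
    rw [← AddChar.map_neg_eq_conj, ← AddChar.map_add_eq_mul, ← AddChar.map_add_eq_mul]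
    congr 1; ring
  have key : ∑ α : ZMod q, ∑ l : ZMod q, ((‖∑ i, ez q (α * R i + l * s i)‖ ^ 2 : ℝ) : ℂ) =
      (q : ℂ) ^ 2 * ∑ i, ((Finset.univ.filter fun j => R j = R i ∧ s j = s i).card : ℂ) := by
    calc _ = ∑ i, ∑ j, (∑ α : ZMod q, ez q (α * (R j - R i))) *
          ∑ l : ZMod q, ez q (l * (s j - s i)) := by
          simp_rw [hsq, Finset.sum_mul_sum]
          rw [Finset.sum_congr rfl fun α _ => Finset.sum_comm, Finset.sum_comm]
          refine Finset.sum_congr rfl fun i _ => ?_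
          rw [Finset.sum_congr rfl fun α _ => Finset.sum_comm, Finset.sum_comm]
      _ = ∑ i, ∑ j, if R j = R i ∧ s j = s i then (q : ℂ) ^ 2 else 0 := by
          refine Finset.sum_congr rfl fun i _ => Finset.sum_congr rfl fun j _ => ?_
          rw [horth, horth]
          by_cases h1 : R j = R i <;> by_cases h2 : s j = s i <;> simp [h1, h2, sq]
      _ = _ := by
          rw [Finset.mul_sum]
          refine Finset.sum_congr rfl fun i _ => ?_
          rw [← Finset.sum_filter, Finset.sum_const, nsmul_eq_mul, mul_comm]
  exact_mod_cast key

variable {q : ℕ} [NeZero q]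

/-- The complete sum `∑_x e((α x⁻² + l x)/q)` over the units modulo `q`. -/
noncomputable def invSqSum (q : ℕ) [NeZero q] (α l : ZMod q) : ℂ :=
  ∑ x : (ZMod q)ˣ, ez q (α * ((x⁻¹ : (ZMod q)ˣ) : ZMod q) ^ 2 + l * x)

/-- The substitution `x ↦ yx` moves the pair `(α, l)` along an orbit of `(ℤ/q)ˣ`. -/
lemma invSqSum_smul (α l : ZMod q) (y : (ZMod q)ˣ) :
    invSqSum q (α * ((y⁻¹ : (ZMod q)ˣ) : ZMod q) ^ 2) (l * y) = invSqSum q α l := by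
  rw [invSqSum, invSqSum, ← Equiv.sum_comp (Equiv.mulLeft y)
    fun x : (ZMod q)ˣ => ez q (α * ((x⁻¹ : (ZMod q)ˣ) : ZMod q) ^ 2 + l * x)]
  refine Finset.sum_congr rfl fun x _ => ?_
  simp only [Equiv.coe_mulLeft, mul_inv, Units.val_mul]
  congr 1; ring

/-- The fourth moment over all frequencies, of square-root size on average. -/
lemma sum_invSqSum_pow_four_le (hq : Squarefree q) (hq4 : Nat.Coprime 4 q) :
    ∑ α : ZMod q, ∑ l : ZMod q, ‖invSqSum q α l‖ ^ 4 ≤ 4 ^ q.primeFactors.card * (q : ℝ) ^ 4 := by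
  classical
  set R : (ZMod q)ˣ × (ZMod q)ˣ → ZMod q := fun x =>
    ((x.1⁻¹ : (ZMod q)ˣ) : ZMod q) ^ 2 + ((x.2⁻¹ : (ZMod q)ˣ) : ZMod q) ^ 2 with hR
  set s : (ZMod q)ˣ × (ZMod q)ˣ → ZMod q := fun x => (x.1 : ZMod q) + x.2 with hs
  have h1 : ∀ α l, ‖invSqSum q α l‖ ^ 4 = ‖∑ i, ez q (α * R i + l * s i)‖ ^ 2 := by
    intro α l
    rw [show ‖invSqSum q α l‖ ^ 4 = (‖invSqSum q α l‖ ^ 2) ^ 2 by ring, ← norm_pow]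
    congr 2
    rw [invSqSum, sq, Finset.sum_mul_sum, Fintype.sum_prod_type]
    refine Finset.sum_congr rfl fun x _ => Finset.sum_congr rfl fun y _ => ?_
    simp_rw [ez_eq_stdAddChar]
    rw [← AddChar.map_add_eq_mul]
    congr 1; simp only [hR, hs]; ring
  simp_rw [h1]
  rw [sum_norm_sq_eq]
  have h2 : ∑ i, ((Finset.univ.filter fun j => R j = R i ∧ s j = s i).card : ℝ) ≤
      ∑ _i : (ZMod q)ˣ × (ZMod q)ˣ, (4 : ℝ) ^ q.primeFactors.card :=
    Finset.sum_le_sum fun i _ => by exact_mod_cast card_pairs_le hq hq4 (R i) (s i)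
  rw [Finset.sum_const, Finset.card_univ, Fintype.card_prod, nsmul_eq_mul,
    ZMod.card_units_eq_totient] at h2
  have h3 : ((q.totient * q.totient : ℕ) : ℝ) ≤ (q : ℝ) ^ 2 := by
    rw [sq]; exact_mod_cast Nat.mul_le_mul (Nat.totient_le q) (Nat.totient_le q)
  calc _ ≤ (q : ℝ) ^ 2 * (((q.totient * q.totient : ℕ) : ℝ) * 4 ^ q.primeFactors.card) := by gcongr
    _ ≤ (q : ℝ) ^ 2 * ((q : ℝ) ^ 2 * 4 ^ q.primeFactors.card) := by gcongr
    _ = _ := by ring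

/-- The orbit of a nonzero frequency visits every point rarely. -/
lemma card_fiber_le (hq : Squarefree q) {M : ℤ} (hM : M ≠ 0)
    {A : ZMod q} (hA : 4 * A = -M) (α : ZMod q) :
    ((Finset.univ : Finset (ZMod q)ˣ).filter fun y =>
      A * ((y⁻¹ : (ZMod q)ˣ) : ZMod q) ^ 2 = α).card ≤ 2 ^ q.primeFactors.card * M.natAbs := by
  classical
  set S := (Finset.univ : Finset (ZMod q)ˣ).filter fun y =>
      A * ((y⁻¹ : (ZMod q)ˣ) : ZMod q) ^ 2 = α with hS
  rw [← Finset.card_image_of_injective S (f := fun y : (ZMod q)ˣ => (y : ZMod q))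
    fun x y h => Units.ext h]
  refine card_le_of_polynomial hq _ hM (d := 2) (by norm_num) fun p hp hpM => ?_
  have : Fact p.Prime := ⟨Nat.prime_of_mem_primeFactors hp⟩
  have hpq := Nat.dvd_of_mem_primeFactors hp
  set c := ZMod.castHom hpq (ZMod p)
  open Polynomial in
  refine ⟨C (c α) * X ^ 2 + C (-c A), ?_, by compute_degree, ?_⟩
  · intro h0
    have h4 := congrArg (fun f => Polynomial.coeff f 0) h0
    simp at h4
    have h5 := congrArg c hA
    rw [map_mul, h4, mul_zero, map_neg, map_intCast, eq_comm, neg_eq_zero,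
      ZMod.intCast_zmod_eq_zero_iff_dvd] at h5
    exact hpM h5
  · intro y hy
    rw [Finset.mem_image] at hy
    obtain ⟨x, hx, rfl⟩ := hy
    simp only [hS, Finset.mem_filter, Finset.mem_univ, true_and] at hx
    rw [val_eq_castHom hpq]
    have hr : α * (x : ZMod q) ^ 2 = A := by
      rw [← hx]
      have e1 : (x : ZMod q) * ((x⁻¹ : (ZMod q)ˣ) : ZMod q) = 1 := Units.mul_inv x
      linear_combination (A * (x * ((x⁻¹ : (ZMod q)ˣ) : ZMod q) + 1)) * e1
    have h1 := congrArg c hr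
    simp only [map_mul, map_pow] at h1
    simp only [Polynomial.eval_add, Polynomial.eval_mul, Polynomial.eval_C, Polynomial.eval_pow,
      Polynomial.eval_X]
    rw [show ZMod.castHom hpq (ZMod p) (x : ZMod q) = c x from rfl]
    linear_combination h1

lemma le_two_pow_mul_totient (hq : Squarefree q) :
    q ≤ 2 ^ q.primeFactors.card * q.totient := by
  have h1 := Nat.totient_mul_prod_primeFactors q
  rw [Nat.prod_primeFactors_of_squarefree hq, mul_comm] at h1
  have h2 := Nat.eq_of_mul_eq_mul_left (NeZero.pos q) h1
  rw [h2, ← Finset.prod_const, ← Finset.prod_mul_distrib]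
  conv_lhs => rw [← Nat.prod_primeFactors_of_squarefree hq]
  refine Finset.prod_le_prod' fun p hp => ?_
  have := (Nat.prime_of_mem_primeFactors hp).two_le
  omega

/-- Kloosterman's argument: the modulus of the complete sum is constant along a large orbit, so the
fourth moment bounds each individual sum. -/
lemma norm_invSqSum_pow_four_le (hq : Squarefree q) (hq4 : Nat.Coprime 4 q) {M : ℤ} (hM : M ≠ 0)
    {A : ZMod q} (hA : 4 * A = -M) (l : ZMod q) :
    ‖invSqSum q A l‖ ^ 4 ≤ 16 ^ q.primeFactors.card * M.natAbs * (q : ℝ) ^ 3 := by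
  classical
  set G : ZMod q × ZMod q → ℝ := fun x => ‖invSqSum q x.1 x.2‖ ^ 4 with hG
  set f : (ZMod q)ˣ → ZMod q × ZMod q := fun y =>
    (A * ((y⁻¹ : (ZMod q)ˣ) : ZMod q) ^ 2, l * y) with hf
  set w := q.primeFactors.card
  have h1 : ∑ y : (ZMod q)ˣ, G (f y) = q.totient * ‖invSqSum q A l‖ ^ 4 := by
    have : ∀ y, G (f y) = ‖invSqSum q A l‖ ^ 4 := fun y => by
      simp only [hG, hf]; rw [invSqSum_smul]
    simp_rw [this]
    rw [Finset.sum_const, Finset.card_univ, ZMod.card_units_eq_totient, nsmul_eq_mul]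
  have h2 : ∑ y : (ZMod q)ˣ, G (f y) ≤ 2 ^ w * M.natAbs * ∑ x, G x := by
    rw [← Finset.sum_fiberwise (s := Finset.univ) (g := f) (f := fun y => G (f y)),
      Finset.mul_sum]
    refine Finset.sum_le_sum fun x _ => ?_
    rw [Finset.sum_congr rfl fun y hy => by rw [(Finset.mem_filter.1 hy).2], Finset.sum_const,
      nsmul_eq_mul]
    have hG0 : 0 ≤ G x := by simp only [hG]; positivity
    refine mul_le_mul_of_nonneg_right ?_ hG0
    have h3 : (Finset.univ.filter fun y => f y = x).card ≤ 2 ^ w * M.natAbs := by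
      refine le_trans (Finset.card_le_card ?_) (card_fiber_le hq hM hA x.1)
      intro y hy
      rw [Finset.mem_filter] at hy ⊢
      exact ⟨Finset.mem_univ _, congrArg Prod.fst hy.2⟩
    exact_mod_cast h3
  have h3 : ∑ x, G x ≤ 4 ^ w * (q : ℝ) ^ 4 := by
    rw [Fintype.sum_prod_type]
    exact sum_invSqSum_pow_four_le hq hq4
  have h4 : (q : ℝ) ≤ 2 ^ w * q.totient := by exact_mod_cast le_two_pow_mul_totient hq
  have hq0 : (0 : ℝ) < q := by exact_mod_cast NeZero.pos q
  have h5 : (q : ℝ) * ‖invSqSum q A l‖ ^ 4 ≤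
      q * (16 ^ w * M.natAbs * (q : ℝ) ^ 3) := by
    calc (q : ℝ) * ‖invSqSum q A l‖ ^ 4 ≤ 2 ^ w * q.totient * ‖invSqSum q A l‖ ^ 4 := by gcongr
      _ = 2 ^ w * ∑ y : (ZMod q)ˣ, G (f y) := by rw [h1]; ring
      _ ≤ 2 ^ w * (2 ^ w * M.natAbs * (4 ^ w * (q : ℝ) ^ 4)) := by
        gcongr
        exact h2.trans (by gcongr)
      _ = _ := by
        have : (16 : ℝ) ^ w = 2 ^ w * 2 ^ w * 4 ^ w := by
          rw [← mul_pow, ← mul_pow]; norm_num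
        rw [this]; ring
  exact le_of_mul_le_mul_left h5 hq0

/-- The incomplete sums of the phases with `U = 0`. -/
lemma norm_sum_phase_zero_le (hq : Squarefree q) (hq4 : Nat.Coprime 4 q) {M : ℤ} (hM : M ≠ 0)
    {X : ℕ} (hX : X ≤ q) :
    ‖∑ h ∈ (Finset.range X).filter (fun h => Nat.Coprime h q), phase q 0 M h‖ ≤
      2 ^ q.primeFactors.card * M.natAbs * (2 + Real.log q) * (q : ℝ) ^ (3 / 4 : ℝ) := by
  classical
  set A : ZMod q := -(4 : ZMod q)⁻¹ * M with hAdef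
  have h44 : (4 : ZMod q) * 4⁻¹ = 1 := by exact_mod_cast zmod_mul_inv (a := 4) hq4
  have hA : 4 * A = -M := by rw [hAdef]; linear_combination (-(M : ZMod q)) * h44
  set f : ZMod q → ℂ := fun x => if IsUnit x then ez q (A * x⁻¹ ^ 2) else 0 with hf
  have h1 : ∑ h ∈ (Finset.range X).filter (fun h => Nat.Coprime h q), phase q 0 M h =
      ∑ h ∈ Finset.range X, f h := by
    rw [Finset.sum_filter]
    refine Finset.sum_congr rfl fun h _ => ?_
    simp only [hf, ZMod.isUnit_iff_coprime]
    split_ifs with hh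
    · have hdvd : q ∣ q ^ 2 := dvd_pow_self q two_ne_zero
      have : phaseArg q 0 M h = q * (-(4⁻¹ * M * (h : ZMod (q ^ 2))⁻¹ ^ 2)) := by
        rw [phaseArg]; push_cast; ring
      rw [phase, this, ez_sq_mul, map_neg, map_mul, map_mul, map_pow, map_intCast,
        castHom_inv hdvd (hh.pow_right 2)]
      have h4 := castHom_inv hdvd (h := 4) (hq4.pow_right 2)
      push_cast at h4
      rw [h4, hAdef]
      congr 1; ring
    · rfl
  rw [h1]
  set w := q.primeFactors.card
  have hq0 : (0 : ℝ) ≤ q := by positivity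
  have hM1 : (1 : ℝ) ≤ M.natAbs := by
    exact_mod_cast Int.natAbs_pos.2 hM
  have hlog : 0 ≤ Real.log q := Real.log_natCast_nonneg q
  refine (norm_incomplete_sum_le q f (T := 2 ^ w * M.natAbs * (q : ℝ) ^ (3 / 4 : ℝ))
    (fun l => ?_) hX).trans_eq (by ring)
  have h2 : ∑ x, f x * ez q (l * x) = invSqSum q A l := by
    rw [invSqSum]
    have h3 : ∀ x : ZMod q, f x * ez q (l * x) =
        if IsUnit x then ez q (A * x⁻¹ ^ 2 + l * x) else 0 := by
      intro x
      simp only [hf]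
      split_ifs
      · simp_rw [ez_eq_stdAddChar]; rw [← AddChar.map_add_eq_mul]
      · rw [zero_mul]
    simp_rw [h3]
    rw [← Finset.sum_filter]
    refine (Finset.sum_bij (fun (u : (ZMod q)ˣ) _ => (u : ZMod q)) ?_ ?_ ?_ ?_).symm
    · intro u _; simp
    · intro u _ v _ h; exact Units.ext h
    · intro x hx
      obtain ⟨u, hu⟩ := (Finset.mem_filter.1 hx).2
      exact ⟨u, Finset.mem_univ _, hu⟩
    · intro u _
      rw [ZMod.inv_coe_unit]
  rw [h2]
  have h3 := norm_invSqSum_pow_four_le hq hq4 hM hA l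
  refine le_of_pow_le_pow_left₀ (n := 4) (by norm_num) (by positivity) (h3.trans ?_)
  rw [mul_pow, mul_pow, ← pow_mul, mul_comm w 4, pow_mul, ← Real.rpow_mul_natCast hq0]
  norm_num
  gcongr
  exact le_self_pow₀ (by simpa using hM1) (by norm_num)

end FourthMoment

/-! ### Shifts along a divisor: the phases with `U ≠ 0` -/

section Shifts

/-- The Chinese remainder theorem for additive characters. -/
lemma ez_mul_coprime {m n N : ℕ} [NeZero m] [NeZero n] [NeZero N] (h : Nat.Coprime m n)
    (hN : N = m * n) (z : ℤ) :
    ez N (z : ZMod N) = ez m ((n : ZMod m)⁻¹ * z) * ez n ((m : ZMod n)⁻¹ * z) := by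
  subst hN
  set s : ℤ := (((n : ZMod m)⁻¹).val : ℤ) with hs
  set t : ℤ := (((m : ZMod n)⁻¹).val : ℤ) with ht
  have hs' : ((s : ℤ) : ZMod m) = (n : ZMod m)⁻¹ := by simp [hs]
  have ht' : ((t : ℤ) : ZMod n) = (m : ZMod n)⁻¹ := by simp [ht]
  have d1 : (m : ℤ) ∣ 1 - n * s - m * t := by
    rw [← ZMod.intCast_zmod_eq_zero_iff_dvd]
    push_cast
    rw [hs', zmod_mul_inv h.symm, ZMod.natCast_self]; ring
  have d2 : (n : ℤ) ∣ 1 - n * s - m * t := by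
    rw [← ZMod.intCast_zmod_eq_zero_iff_dvd]
    push_cast
    rw [ht', zmod_mul_inv h, ZMod.natCast_self]; ring
  obtain ⟨r, hr⟩ := (Int.isCoprime_iff_nat_coprime.2 (by simpa using h) :
    IsCoprime (m : ℤ) n).mul_dvd d1 d2
  have e1 : (n : ZMod m)⁻¹ * z = ((s * z : ℤ) : ZMod m) := by push_cast; rw [hs']
  have e2 : (m : ZMod n)⁻¹ * z = ((t * z : ℤ) : ZMod n) := by push_cast; rw [ht']
  rw [e1, e2, ez_intCast, ez_intCast, ez_intCast, ← e_add]
  have hm : (m : ℝ) ≠ 0 := by exact_mod_cast NeZero.ne m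
  have hn : (n : ℝ) ≠ 0 := by exact_mod_cast NeZero.ne n
  have hr' : (1 : ℝ) - n * s - m * t = m * n * r := by exact_mod_cast hr
  have : (z : ℝ) / ((m * n : ℕ) : ℝ) = ((s * z : ℤ) : ℝ) / m + ((t * z : ℤ) : ℝ) / n +
      ((r * z : ℤ) : ℝ) := by
    push_cast
    field_simp
    linear_combination (z : ℝ) * hr'
  rw [this, e_add _ (((r * z : ℤ)) : ℝ), e_int, mul_one]

/-- The component modulo `n²` of a phase, extended by zero to arguments not coprime to `n`. -/
noncomputable def localPhase (n : ℕ) (κ : ZMod (n ^ 2)) (U M : ℤ) (h : ℕ) : ℂ :=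
  if Nat.Coprime h n then
    ez (n ^ 2) (κ * ((U : ZMod (n ^ 2)) * (h : ZMod (n ^ 2))⁻¹ -
      (n : ZMod (n ^ 2)) * (M : ZMod (n ^ 2)) * (h : ZMod (n ^ 2))⁻¹ ^ 2)) else 0

lemma norm_localPhase_le (n : ℕ) (κ : ZMod (n ^ 2)) (U M : ℤ) (h : ℕ) :
    ‖localPhase n κ U M h‖ ≤ 1 := by
  rw [localPhase]
  split_ifs
  · rw [norm_ez]
  · simp

lemma localPhase_add_sq_mul (n : ℕ) (κ : ZMod (n ^ 2)) (U M : ℤ) (h j : ℕ) :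
    localPhase n κ U M (h + n ^ 2 * j) = localPhase n κ U M h := by
  have h1 : ((h + n ^ 2 * j : ℕ) : ZMod (n ^ 2)) = h := by
    rw [Nat.cast_add, Nat.cast_mul, ZMod.natCast_self, zero_mul, add_zero]
  have h2 : Nat.Coprime (h + n ^ 2 * j) n ↔ Nat.Coprime h n := by
    rw [sq, mul_assoc, Nat.coprime_add_mul_left_left]
  rw [localPhase, localPhase, h1]
  simp only [h2]

lemma phase_eq_localPhase_mul {b c : ℕ} [NeZero b] [NeZero c] (hbc : Nat.Coprime b c)
    (h4 : Nat.Coprime 4 (b * c)) (U M : ℤ) {h : ℕ} (hh : Nat.Coprime h (b * c)) :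
    phase (b * c) U M h = localPhase b (((c ^ 2 : ℕ) : ZMod (b ^ 2))⁻¹ * 4⁻¹) U (c * M) h *
      localPhase c (((b ^ 2 : ℕ) : ZMod (c ^ 2))⁻¹ * 4⁻¹) U (b * M) h := by
  have hb : Nat.Coprime h b := hh.coprime_dvd_right (dvd_mul_right _ _)
  have hc : Nat.Coprime h c := hh.coprime_dvd_right (dvd_mul_left _ _)
  have d1 : b ^ 2 ∣ (b * c) ^ 2 := pow_dvd_pow_of_dvd (dvd_mul_right _ _) 2
  have d2 : c ^ 2 ∣ (b * c) ^ 2 := pow_dvd_pow_of_dvd (dvd_mul_left _ _) 2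
  have i4 := hh.pow_right 2
  have j4 : Nat.Coprime 4 ((b * c) ^ 2) := h4.pow_right 2
  have k1 := castHom_inv d1 j4
  have k2 := castHom_inv d2 j4
  push_cast at k1 k2
  rw [phase, localPhase, localPhase, if_pos hb, if_pos hc]
  conv_lhs => rw [← ZMod.natCast_zmod_val (phaseArg (b * c) U M h), ← Int.cast_natCast]
  rw [ez_mul_coprime (hbc.pow 2 2) (mul_pow b c 2), Int.cast_natCast, Int.cast_natCast,
    val_eq_castHom d1, val_eq_castHom d2, phaseArg]
  simp only [map_mul, map_sub, map_pow, map_intCast, map_natCast, castHom_inv d1 i4,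
    castHom_inv d2 i4, k1, k2]
  congr 1 <;> · congr 1; push_cast; ring

/-- The frequency of `y ↦ localPhase n κ U M (x + n y)`. -/
noncomputable def linCoeff (n : ℕ) (κ : ZMod (n ^ 2)) (U : ℤ) (x : ℕ) : ZMod n :=
  -(ZMod.castHom (dvd_pow_self n two_ne_zero) (ZMod n) κ * U * (x : ZMod n)⁻¹ ^ 2)

lemma localPhase_add_mul (n : ℕ) [NeZero n] (κ : ZMod (n ^ 2)) (U M : ℤ) (x y : ℕ) :
    localPhase n κ U M (x + n * y) = localPhase n κ U M x * ez n (linCoeff n κ U x * y) := by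
  have h2 : Nat.Coprime (x + n * y) n ↔ Nat.Coprime x n := by
    rw [Nat.coprime_add_mul_left_left]
  rw [localPhase, localPhase]
  simp only [h2]
  split_ifs with hx
  · have hx2 := hx.pow_right 2
    have hxy2 : Nat.Coprime (x + n * y) (n ^ 2) := (h2.2 hx).pow_right 2
    have e1 := zmod_mul_inv hx2
    have e2 := zmod_mul_inv hxy2
    have hn2 : (n : ZMod (n ^ 2)) ^ 2 = 0 := by exact_mod_cast ZMod.natCast_self (n ^ 2)
    set i := (x : ZMod (n ^ 2))⁻¹ with hi
    set i' := ((x + n * y : ℕ) : ZMod (n ^ 2))⁻¹ with hi'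
    -- the inverse of `x + n y` modulo `n²` is linear in `y`, since `n² = 0`
    have h3 : i' = i - n * y * i ^ 2 := by
      push_cast at e2
      have : ((x : ZMod (n ^ 2)) + n * y) * (i - n * y * i ^ 2) = 1 := by
        linear_combination (1 - n * y * i) * e1 - y ^ 2 * i ^ 2 * hn2
      calc i' = i' * (((x : ZMod (n ^ 2)) + n * y) * (i - n * y * i ^ 2)) := by rw [this, mul_one]
        _ = (((x : ZMod (n ^ 2)) + n * y) * i') * (i - n * y * i ^ 2) := by ring
        _ = _ := by rw [e2, one_mul]
    have h4 : linCoeff n κ U x * y =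
        ZMod.castHom (dvd_pow_self n two_ne_zero) (ZMod n) (-(κ * U * i ^ 2) * y) := by
      rw [linCoeff, map_mul, map_neg, map_mul, map_mul, map_pow, hi, castHom_inv _ hx2, map_intCast,
        map_natCast]
    rw [h4, ← ez_sq_mul, ez_eq_stdAddChar, ez_eq_stdAddChar, ez_eq_stdAddChar,
      ← AddChar.map_add_eq_mul, h3]
    congr 1
    linear_combination (κ * M * i ^ 3 * (2 * y - n * y ^ 2 * i)) * hn2
  · rw [zero_mul]

/-- Splitting an interval into residue classes. -/
lemma sum_range_eq_sum_residues {A : Type*} [AddCommMonoid A] (c X : ℕ) (hc : 0 < c) (f : ℕ → A) :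
    ∑ h ∈ Finset.range X, f h =
      ∑ x ∈ Finset.range c, ∑ y ∈ Finset.range ((X + c - 1 - x) / c), f (x + c * y) := by
  rw [Finset.sum_sigma']
  refine Finset.sum_bij' (fun h _ => ⟨h % c, h / c⟩) (fun p _ => p.1 + c * p.2) ?_ ?_ ?_ ?_ ?_
  · intro h hh
    rw [Finset.mem_range] at hh
    rw [Finset.mem_sigma, Finset.mem_range, Finset.mem_range]
    refine ⟨Nat.mod_lt _ hc, ?_⟩
    rw [← Nat.succ_le_iff, Nat.le_div_iff_mul_le hc]
    have := Nat.div_add_mod h c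
    have h2 := Nat.mod_lt h hc
    rw [Nat.succ_eq_add_one, add_mul, one_mul, mul_comm]
    dsimp only
    omega
  · rintro ⟨x, y⟩ hp
    rw [Finset.mem_sigma, Finset.mem_range, Finset.mem_range] at hp
    obtain ⟨h1, h2⟩ := hp
    simp only at h1 h2
    rw [← Nat.succ_le_iff, Nat.le_div_iff_mul_le hc, Nat.succ_eq_add_one, add_mul, one_mul,
      mul_comm] at h2
    rw [Finset.mem_range]
    dsimp only
    omega
  · intro h _
    exact Nat.mod_add_div h c
  · rintro ⟨x, y⟩ hp
    rw [Finset.mem_sigma, Finset.mem_range, Finset.mem_range] at hp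
    have h1 : (x + c * y) % c = x := by rw [Nat.add_mul_mod_self_left, Nat.mod_eq_of_lt hp.1]
    have h2 : (x + c * y) / c = y := by
      rw [Nat.add_mul_div_left _ _ hc, Nat.div_eq_of_lt hp.1, zero_add]
    simp [h1, h2]
  · intro h _
    simp [Nat.mod_add_div h c]

lemma coeff_quartic_one {R : Type*} [CommRing R] (a b c d e' : R) :
    (Polynomial.C a * Polynomial.X ^ 4 + Polynomial.C b * Polynomial.X ^ 3 +
      Polynomial.C c * Polynomial.X ^ 2 + Polynomial.C d * Polynomial.X +
      Polynomial.C e').coeff 1 = d := by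
  simp [Polynomial.coeff_C]

variable {c : ℕ} [NeZero c]

/-- The difference of the frequencies at `x + s₁` and `x + s₂` rarely takes a given value. -/
lemma card_linCoeff_sub_le (hc : Squarefree c) (h4 : Nat.Coprime 4 c) {κ : ZMod (c ^ 2)}
    (hκ : IsUnit κ) {U : ℤ} (hU : U ≠ 0) {b : ℕ} (hb : Nat.Coprime b c) {j₁ j₂ : ℕ}
    (hj : j₁ ≠ j₂) (r : ZMod c) :
    ((Finset.range c).filter fun x => Nat.Coprime (x + b ^ 2 * j₁) c ∧
      Nat.Coprime (x + b ^ 2 * j₂) c ∧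
      linCoeff c κ U (x + b ^ 2 * j₁) - linCoeff c κ U (x + b ^ 2 * j₂) = r).card ≤
      4 ^ c.primeFactors.card * (U * ((j₁ : ℤ) - j₂)).natAbs := by
  classical
  set S := (Finset.range c).filter fun x => Nat.Coprime (x + b ^ 2 * j₁) c ∧
      Nat.Coprime (x + b ^ 2 * j₂) c ∧
      linCoeff c κ U (x + b ^ 2 * j₁) - linCoeff c κ U (x + b ^ 2 * j₂) = r with hS
  have hinj : Set.InjOn (fun x : ℕ => (x : ZMod c)) S := by
    intro x hx y hy hxy
    rw [Finset.mem_coe, hS, Finset.mem_filter, Finset.mem_range] at hx hy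
    have := (ZMod.natCast_eq_natCast_iff _ _ _).1 hxy
    exact Nat.ModEq.eq_of_lt_of_lt this hx.1 hy.1
  rw [← Finset.card_image_of_injOn hinj]
  have hjz : ((j₁ : ℤ) - j₂) ≠ 0 := sub_ne_zero.2 (by exact_mod_cast hj)
  refine card_le_of_polynomial hc _ (mul_ne_zero hU hjz) (d := 4) (by norm_num)
    fun p hp hpz => ?_
  have : Fact p.Prime := ⟨Nat.prime_of_mem_primeFactors hp⟩
  have hpc := Nat.dvd_of_mem_primeFactors hp
  set f := ZMod.castHom hpc (ZMod p) with hf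
  set k : ZMod c := ZMod.castHom (dvd_pow_self c two_ne_zero) (ZMod c) κ with hk
  obtain ⟨s₁, hs₁⟩ : ∃ s : ZMod p, s = ((b ^ 2 * j₁ : ℕ) : ZMod p) := ⟨_, rfl⟩
  obtain ⟨s₂, hs₂⟩ : ∃ s : ZMod p, s = ((b ^ 2 * j₂ : ℕ) : ZMod p) := ⟨_, rfl⟩
  obtain ⟨ρ, hρ⟩ : ∃ s : ZMod p, s = f r := ⟨_, rfl⟩
  obtain ⟨A, hA⟩ : ∃ s : ZMod p, s = f k * U := ⟨_, rfl⟩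
  have hA0 : A ≠ 0 := by
    rw [hA]
    refine mul_ne_zero ((hκ.map _).map f).ne_zero ?_
    rw [Ne, ZMod.intCast_zmod_eq_zero_iff_dvd]
    exact fun h => hpz (h.mul_right _)
  have hs0 : s₂ - s₁ ≠ 0 := by
    have h1 : s₂ - s₁ = (b : ZMod p) ^ 2 * -((((j₁ : ℤ) - j₂ : ℤ)) : ZMod p) := by
      rw [hs₁, hs₂]; push_cast; ring
    rw [h1]
    refine mul_ne_zero (pow_ne_zero 2 ?_) (neg_ne_zero.2 ?_)
    · rw [Ne, ZMod.natCast_eq_zero_iff]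
      intro h
      have h2 := Nat.dvd_gcd h hpc
      rw [hb] at h2
      exact (Fact.out : p.Prime).one_lt.ne' (Nat.dvd_one.1 h2)
    · rw [Ne, ZMod.intCast_zmod_eq_zero_iff_dvd]
      exact fun h => hpz (h.mul_left _)
  have h20 := two_ne_zero_of_mem h4 hp
  -- clear denominators in `-A (X + s₁)⁻² + A (X + s₂)⁻² = ρ`; if the leading coefficient `ρ`
  -- vanishes, then the linear coefficient is `2 A (s₂ - s₁) ≠ 0`
  open Polynomial in
  refine ⟨C ρ * X ^ 4 + C (ρ * (2 * (s₁ + s₂))) * X ^ 3 +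
    C (ρ * (s₁ ^ 2 + 4 * s₁ * s₂ + s₂ ^ 2)) * X ^ 2 +
    C (ρ * (2 * s₁ * s₂ * (s₁ + s₂)) + 2 * A * (s₂ - s₁)) * X +
    C (ρ * (s₁ ^ 2 * s₂ ^ 2) + A * (s₂ ^ 2 - s₁ ^ 2)), ?_, by compute_degree, ?_⟩
  · intro h0
    have e4 := (coeff_quartic ρ (ρ * (2 * (s₁ + s₂))) (ρ * (s₁ ^ 2 + 4 * s₁ * s₂ + s₂ ^ 2))
      (ρ * (2 * s₁ * s₂ * (s₁ + s₂)) + 2 * A * (s₂ - s₁))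
      (ρ * (s₁ ^ 2 * s₂ ^ 2) + A * (s₂ ^ 2 - s₁ ^ 2))).1
    have e1 := coeff_quartic_one ρ (ρ * (2 * (s₁ + s₂))) (ρ * (s₁ ^ 2 + 4 * s₁ * s₂ + s₂ ^ 2))
      (ρ * (2 * s₁ * s₂ * (s₁ + s₂)) + 2 * A * (s₂ - s₁))
      (ρ * (s₁ ^ 2 * s₂ ^ 2) + A * (s₂ ^ 2 - s₁ ^ 2))
    rw [h0, Polynomial.coeff_zero] at e4 e1
    rw [← e4, zero_mul, zero_add] at e1
    exact mul_ne_zero (mul_ne_zero h20 hA0) hs0 e1.symm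
  · intro y hy
    rw [Finset.mem_image] at hy
    obtain ⟨x, hx, rfl⟩ := hy
    rw [hS, Finset.mem_filter] at hx
    obtain ⟨-, hx1, hx2, hx3⟩ := hx
    have i1 := zmod_mul_inv (hx1.coprime_dvd_right hpc)
    have i2 := zmod_mul_inv (hx2.coprime_dvd_right hpc)
    have h5 := congrArg f hx3
    rw [linCoeff, linCoeff, ← hk, map_sub, map_neg, map_neg, map_mul, map_mul, map_mul, map_mul,
      map_pow, map_pow, map_intCast, ← hA, ← hρ, hf, castHom_inv hpc hx1, castHom_inv hpc hx2] at h5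
    rw [val_eq_castHom hpc, map_natCast]
    rw [Nat.cast_add, ← hs₁] at i1 h5
    rw [Nat.cast_add, ← hs₂] at i2 h5
    set X₁ := (x : ZMod p) + s₁ with hX₁
    set X₂ := (x : ZMod p) + s₂ with hX₂
    have h6 : ρ * X₁ ^ 2 * X₂ ^ 2 = -A * X₂ ^ 2 + A * X₁ ^ 2 := by
      rw [← h5]
      linear_combination (-A * X₂ ^ 2 * (X₁ * X₁⁻¹ + 1)) * i1 +
        (A * X₁ ^ 2 * (X₂ * X₂⁻¹ + 1)) * i2
    simp only [Polynomial.eval_add, Polynomial.eval_mul, Polynomial.eval_C, Polynomial.eval_pow,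
      Polynomial.eval_X]
    rw [hX₁, hX₂] at h6
    linear_combination h6

/-- The correlations of the component modulo `c²`: on every residue class modulo `c` they are
geometric sums, and the frequencies of these are spread out. -/
lemma norm_correlation_le (hc : Squarefree c) (h4 : Nat.Coprime 4 c) {κ : ZMod (c ^ 2)}
    (hκ : IsUnit κ) {U : ℤ} (hU : U ≠ 0) (M : ℤ) {b : ℕ} (hb : Nat.Coprime b c) {j₁ j₂ : ℕ}
    (hj : j₁ ≠ j₂) {X : ℕ} (hX : X ≤ b * c) :
    ‖∑ h ∈ Finset.range X, localPhase c κ U M (h + b ^ 2 * j₁) *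
      (starRingEnd ℂ) (localPhase c κ U M (h + b ^ 2 * j₂))‖ ≤
      4 ^ c.primeFactors.card * (U * ((j₁ : ℤ) - j₂)).natAbs * (b + c * (1 + Real.log c)) := by
  classical
  have hc0 : 0 < c := NeZero.pos c
  set D : ℕ → ZMod c := fun x =>
    linCoeff c κ U (x + b ^ 2 * j₁) - linCoeff c κ U (x + b ^ 2 * j₂) with hD
  rw [sum_range_eq_sum_residues c X hc0]
  set T := (Finset.range c).filter fun x => Nat.Coprime (x + b ^ 2 * j₁) c ∧
      Nat.Coprime (x + b ^ 2 * j₂) c with hT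
  have h1 : ∀ x ∈ Finset.range c, ‖∑ y ∈ Finset.range ((X + c - 1 - x) / c),
      localPhase c κ U M (x + c * y + b ^ 2 * j₁) *
      (starRingEnd ℂ) (localPhase c κ U M (x + c * y + b ^ 2 * j₂))‖ ≤
      if Nat.Coprime (x + b ^ 2 * j₁) c ∧ Nat.Coprime (x + b ^ 2 * j₂) c then
        geomBound c b (D x) else 0 := by
    intro x _
    have h2 : ∀ y, localPhase c κ U M (x + c * y + b ^ 2 * j₁) *
        (starRingEnd ℂ) (localPhase c κ U M (x + c * y + b ^ 2 * j₂)) =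
        (localPhase c κ U M (x + b ^ 2 * j₁) *
          (starRingEnd ℂ) (localPhase c κ U M (x + b ^ 2 * j₂))) * ez c (D x * y) := by
      intro y
      rw [show x + c * y + b ^ 2 * j₁ = x + b ^ 2 * j₁ + c * y by ring,
        show x + c * y + b ^ 2 * j₂ = x + b ^ 2 * j₂ + c * y by ring, localPhase_add_mul,
        localPhase_add_mul, map_mul]
      have : ez c (linCoeff c κ U (x + b ^ 2 * j₁) * y) *
          (starRingEnd ℂ) (ez c (linCoeff c κ U (x + b ^ 2 * j₂) * y)) = ez c (D x * y) := by
        simp_rw [ez_eq_stdAddChar]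
        rw [← AddChar.map_neg_eq_conj, ← AddChar.map_add_eq_mul]
        congr 1; simp only [hD]; ring
      rw [← this]; ring
    simp_rw [h2]
    rw [← Finset.mul_sum, norm_mul]
    split_ifs with hx
    · have h3 : ‖localPhase c κ U M (x + b ^ 2 * j₁) *
          (starRingEnd ℂ) (localPhase c κ U M (x + b ^ 2 * j₂))‖ ≤ 1 := by
        rw [norm_mul, RCLike.norm_conj]
        exact mul_le_one₀ (norm_localPhase_le ..) (norm_nonneg _) (norm_localPhase_le ..)
      refine (mul_le_of_le_one_left (norm_nonneg _) h3).trans (norm_geom_sum_le c _ ?_)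
      have : (X + c - 1 - x) / c ≤ b := by
        rw [← Nat.lt_succ_iff, Nat.div_lt_iff_lt_mul hc0, Nat.succ_eq_add_one, add_mul, one_mul]
        omega
      exact_mod_cast this
    · have h3 : localPhase c κ U M (x + b ^ 2 * j₁) *
          (starRingEnd ℂ) (localPhase c κ U M (x + b ^ 2 * j₂)) = 0 := by
        rw [localPhase, localPhase]
        rcases not_and_or.1 hx with h | h
        · rw [if_neg h, zero_mul]
        · rw [if_neg h, map_zero, mul_zero]
      rw [h3, norm_zero, zero_mul]
  refine (norm_sum_le_of_le _ h1).trans ?_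
  rw [← Finset.sum_filter, ← hT, ← Finset.sum_fiberwise (s := T) (g := D)
    (f := fun x => geomBound c b (D x))]
  have h5 : ∀ r : ZMod c, ∑ x ∈ T with D x = r, geomBound c b (D x) ≤
      (4 ^ c.primeFactors.card * (U * ((j₁ : ℤ) - j₂)).natAbs : ℝ) * geomBound c b r := by
    intro r
    rw [Finset.sum_congr rfl fun x hx => by rw [(Finset.mem_filter.1 hx).2], Finset.sum_const,
      nsmul_eq_mul]
    refine mul_le_mul_of_nonneg_right ?_ (geomBound_nonneg c (Nat.cast_nonneg b) r)
    have := card_linCoeff_sub_le hc h4 hκ hU hb hj r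
    rw [hT, Finset.filter_filter]
    simp only [and_assoc, hD]
    exact_mod_cast this
  refine (Finset.sum_le_sum fun r _ => h5 r).trans ?_
  rw [← Finset.mul_sum]
  gcongr
  exact sum_geomBound_le c

/-- The effect of a shift on a sum of bounded terms. -/
lemma norm_sum_range_shift_sub_le (f : ℕ → ℂ) (hf : ∀ h, ‖f h‖ ≤ 1) (X s : ℕ) :
    ‖∑ h ∈ Finset.range X, f h - ∑ h ∈ Finset.range X, f (h + s)‖ ≤ 2 * s := by
  have hb : ∀ g : ℕ → ℂ, (∀ h, ‖g h‖ ≤ 1) → ‖∑ h ∈ Finset.range s, g h‖ ≤ s := by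
    intro g hg
    refine (norm_sum_le_of_le _ fun h _ => hg h).trans ?_
    simp
  have h1 := Finset.sum_range_add f X s
  have h2 := Finset.sum_range_add f s X
  rw [add_comm s X, h1] at h2
  have h3 : ∑ h ∈ Finset.range X, f h - ∑ h ∈ Finset.range X, f (h + s) =
      ∑ h ∈ Finset.range s, f h - ∑ h ∈ Finset.range s, f (X + h) := by
    simp_rw [add_comm _ s]
    linear_combination h2
  rw [h3]
  refine (norm_sub_le _ _).trans ?_
  linarith [hb f hf, hb (fun h => f (X + h)) fun h => hf _]

end Shifts

/-! ### Van der Corput shifts and the bound for all nontrivial phases -/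

section Shifts

/-- Van der Corput's inequality with shifts along the period of one of the two factors. -/
lemma norm_sq_sum_mul_le_of_shift (f₁ f₂ : ℕ → ℂ) (h₁ : ∀ h, ‖f₁ h‖ ≤ 1) (h₂ : ∀ h, ‖f₂ h‖ ≤ 1)
    {s : ℕ} (hper : ∀ h j, f₁ (h + s * j) = f₁ h) {J : ℕ} (hJ : 0 < J) (X : ℕ) {R : ℝ}
    (hR0 : 0 ≤ R)
    (hR : ∀ j₁ < J, ∀ j₂ < J, j₁ ≠ j₂ → ‖∑ h ∈ Finset.range X, f₂ (h + s * j₁) *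
      (starRingEnd ℂ) (f₂ (h + s * j₂))‖ ≤ R) :
    ‖∑ h ∈ Finset.range X, f₁ h * f₂ h‖ ^ 2 ≤ 8 * (s * J) ^ 2 + 2 * (X * (X / J + R)) := by
  have hJ0 : (0 : ℝ) < J := by exact_mod_cast hJ
  set S := ∑ h ∈ Finset.range X, f₁ h * f₂ h with hS
  set G : ℕ → ℂ := fun h => ∑ j ∈ Finset.range J, f₂ (h + s * j) with hG
  have e1 : ‖(J : ℂ) * S - ∑ h ∈ Finset.range X, f₁ h * G h‖ ≤ J * (2 * (s * J)) := by
    have e2 : (J : ℂ) * S - ∑ h ∈ Finset.range X, f₁ h * G h =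
        ∑ j ∈ Finset.range J, (S - ∑ h ∈ Finset.range X, f₁ h * f₂ (h + s * j)) := by
      rw [Finset.sum_sub_distrib, Finset.sum_const, Finset.card_range, nsmul_eq_mul,
        Finset.sum_comm]
      simp_rw [hG, Finset.mul_sum]
    rw [e2]
    refine (norm_sum_le_of_le (n := fun _ => 2 * ((s : ℝ) * J)) _ fun j hj => ?_).trans ?_
    · rw [Finset.mem_range] at hj
      have e3 := norm_sum_range_shift_sub_le (fun h => f₁ h * f₂ h) (fun h => by
        rw [norm_mul]; exact mul_le_one₀ (h₁ h) (norm_nonneg _) (h₂ h)) X (s * j)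
      simp only [hper] at e3
      refine e3.trans ?_
      push_cast
      gcongr
    · rw [Finset.sum_const, Finset.card_range, nsmul_eq_mul]
  have e2 : ∑ h ∈ Finset.range X, ‖G h‖ ^ 2 ≤ J * X + J ^ 2 * R := by
    have e3 : ((∑ h ∈ Finset.range X, ‖G h‖ ^ 2 : ℝ) : ℂ) =
        ∑ j₁ ∈ Finset.range J, ∑ j₂ ∈ Finset.range J, ∑ h ∈ Finset.range X,
          f₂ (h + s * j₁) * (starRingEnd ℂ) (f₂ (h + s * j₂)) := by
      push_cast
      rw [Finset.sum_congr rfl fun j₁ _ => Finset.sum_comm, Finset.sum_comm]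
      refine Finset.sum_congr rfl fun h _ => ?_
      rw [← Complex.mul_conj', hG, map_sum, Finset.sum_mul_sum]
    have e4 : ∑ h ∈ Finset.range X, ‖G h‖ ^ 2 = ‖((∑ h ∈ Finset.range X, ‖G h‖ ^ 2 : ℝ) : ℂ)‖ := by
      rw [Complex.norm_real, Real.norm_of_nonneg (Finset.sum_nonneg fun _ _ => by positivity)]
    rw [e4, e3]
    refine (norm_sum_le_of_le (n := fun _ => (X : ℝ) + J * R) _ fun j₁ hj₁ => ?_).trans ?_
    · rw [Finset.mem_range] at hj₁
      refine (norm_sum_le_of_le (n := fun j₂ => (if j₁ = j₂ then (X : ℝ) else 0) + R) _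
        fun j₂ hj₂ => ?_).trans ?_
      · rw [Finset.mem_range] at hj₂
        split_ifs with hj
        · refine (norm_sum_le_of_le (n := fun _ => (1 : ℝ)) _ fun h _ => ?_).trans ?_
          · rw [norm_mul, RCLike.norm_conj]
            exact mul_le_one₀ (h₂ _) (norm_nonneg _) (h₂ _)
          · simpa using hR0
        · rw [zero_add]
          exact hR j₁ hj₁ j₂ hj₂ hj
      · rw [Finset.sum_add_distrib, Finset.sum_ite_eq, if_pos (Finset.mem_range.2 hj₁)]
        simp
    · rw [Finset.sum_const, Finset.card_range, nsmul_eq_mul]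
      exact le_of_eq (by ring)
  set A := ‖∑ h ∈ Finset.range X, f₁ h * G h‖ with hA
  have e3 : A ≤ ∑ h ∈ Finset.range X, ‖G h‖ := by
    refine norm_sum_le_of_le _ fun h _ => ?_
    rw [norm_mul]
    exact mul_le_of_le_one_left (norm_nonneg _) (h₁ h)
  have e4 : A ^ 2 ≤ X * (J * X + J ^ 2 * R) := by
    calc A ^ 2 ≤ (∑ h ∈ Finset.range X, ‖G h‖) ^ 2 := by
          have : 0 ≤ A := norm_nonneg _
          gcongr
      _ ≤ (Finset.range X).card * ∑ h ∈ Finset.range X, ‖G h‖ ^ 2 := sq_sum_le_card_mul_sum_sq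
      _ ≤ _ := by rw [Finset.card_range]; gcongr
  have e5 : J * ‖S‖ ≤ J * (2 * (s * J)) + A := by
    have := norm_add_le ((J : ℂ) * S - ∑ h ∈ Finset.range X, f₁ h * G h)
      (∑ h ∈ Finset.range X, f₁ h * G h)
    rw [sub_add_cancel, norm_mul, Complex.norm_natCast] at this
    linarith
  have e6 : ((J : ℝ) * ‖S‖) ^ 2 ≤ J ^ 2 * (8 * (s * J) ^ 2 + 2 * (X * (X / J + R))) := by
    have e7 : (J : ℝ) ^ 2 * (8 * (s * J) ^ 2 + 2 * (X * (X / J + R))) =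
        2 * (J * (2 * (s * J))) ^ 2 + 2 * (X * (J * X + J ^ 2 * R)) := by
      field_simp; ring
    rw [e7]
    calc ((J : ℝ) * ‖S‖) ^ 2 ≤ (J * (2 * (s * J)) + A) ^ 2 := by gcongr
      _ ≤ 2 * (J * (2 * (s * J))) ^ 2 + 2 * A ^ 2 := by
        nlinarith [sq_nonneg (J * (2 * ((s : ℝ) * J)) - A)]
      _ ≤ _ := by gcongr
  rw [mul_pow] at e6
  exact le_of_mul_le_mul_left e6 (by positivity)

lemma sum_coprime_phase_eq {b c : ℕ} [NeZero b] [NeZero c] (hbc : Nat.Coprime b c)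
    (h4 : Nat.Coprime 4 (b * c)) (U M : ℤ) (X : ℕ) :
    ∑ h ∈ (Finset.range X).filter (fun h => Nat.Coprime h (b * c)), phase (b * c) U M h =
      ∑ h ∈ Finset.range X, localPhase b (((c ^ 2 : ℕ) : ZMod (b ^ 2))⁻¹ * 4⁻¹) U (c * M) h *
        localPhase c (((b ^ 2 : ℕ) : ZMod (c ^ 2))⁻¹ * 4⁻¹) U (b * M) h := by
  rw [Finset.sum_filter]
  refine Finset.sum_congr rfl fun h _ => ?_
  split_ifs with hh
  · exact phase_eq_localPhase_mul hbc h4 U M hh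
  · rw [Nat.coprime_mul_iff_right, not_and_or] at hh
    rw [localPhase, localPhase]
    rcases hh with hh | hh
    · rw [if_neg hh, zero_mul]
    · rw [if_neg hh, mul_zero]

/-- The incomplete sums of the phases with `U ≠ 0`, for moduli with a small factor `b`. The saving
`b^(1/4)` comes from shifts by about `√b` multiples of `b²`. -/
lemma norm_sum_phase_ne_zero_le {b c : ℕ} [NeZero b] [NeZero c] (hq : Squarefree (b * c))
    (h4 : Nat.Coprime 4 (b * c)) {U : ℤ} (hU : U ≠ 0) (M : ℤ) (hb3 : b ^ 3 ≤ b * c) {X : ℕ}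
    (hX : X ≤ b * c) :
    ‖∑ h ∈ (Finset.range X).filter (fun h => Nat.Coprime h (b * c)), phase (b * c) U M h‖ ≤
      8 * 2 ^ (b * c).primeFactors.card * U.natAbs * (2 + Real.log ((b * c : ℕ) : ℝ)) *
        ((b * c : ℕ) : ℝ) * (b : ℝ) ^ (-(1 / 4) : ℝ) := by
  have hbc : Nat.Coprime b c := Nat.coprime_of_squarefree_mul hq
  have h4c : Nat.Coprime 4 c := h4.coprime_dvd_right (dvd_mul_left _ _)
  have hqc : Squarefree c := hq.squarefree_of_dvd (dvd_mul_left _ _)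
  have hb1 : (1 : ℝ) ≤ b := by exact_mod_cast NeZero.one_le
  have hc1 : (1 : ℝ) ≤ c := by exact_mod_cast NeZero.one_le
  have hb0 : (0 : ℝ) < b := by linarith
  rw [sum_coprime_phase_eq hbc h4]
  set κ : ZMod (c ^ 2) := ((b ^ 2 : ℕ) : ZMod (c ^ 2))⁻¹ * 4⁻¹ with hκdef
  have hκ : IsUnit κ := by
    have i1 := zmod_mul_inv (hbc.pow 2 2)
    have i2 : (4 : ZMod (c ^ 2)) * 4⁻¹ = 1 := by
      exact_mod_cast zmod_mul_inv (a := 4) (h4c.pow_right 2)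
    refine IsUnit.of_mul_eq_one (((b ^ 2 : ℕ) : ZMod (c ^ 2)) * 4) ?_
    rw [hκdef]
    linear_combination (4 * 4⁻¹ : ZMod (c ^ 2)) * i1 + i2
  -- the diagonal contributes about `q / J` and the correlations about `q J / b`; this choice of the
  -- number `J` of shifts balances the two
  set J := ⌈√(b : ℝ)⌉₊ with hJ
  have hsb : 1 ≤ √(b : ℝ) := Real.one_le_sqrt.2 hb1
  have hJ1 : √(b : ℝ) ≤ J := Nat.le_ceil _
  have hJ2 : (J : ℝ) ≤ 2 * √(b : ℝ) := by
    have := Nat.ceil_lt_add_one (Real.sqrt_nonneg (b : ℝ))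
    linarith
  have hJ0 : 0 < J := by
    have : (0 : ℝ) < J := by linarith
    exact_mod_cast this
  set w := (b * c).primeFactors.card
  have hw : c.primeFactors.card ≤ w :=
    Finset.card_le_card (Nat.primeFactors_mono (dvd_mul_left _ _) (NeZero.ne _))
  set Lq := 2 + Real.log ((b * c : ℕ) : ℝ) with hLq
  have hlogc : 0 ≤ Real.log c := Real.log_natCast_nonneg c
  have hlog : Real.log c ≤ Real.log ((b * c : ℕ) : ℝ) := by
    push_cast
    exact Real.log_le_log (by linarith) (by nlinarith)
  have hLq2 : 2 ≤ Lq := by linarith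
  have hU1 : (1 : ℝ) ≤ U.natAbs := by exact_mod_cast Int.natAbs_pos.2 hU
  have hbcR : (b : ℝ) ≤ c := by
    have h1 : (b : ℝ) ^ 3 ≤ b * c := by exact_mod_cast hb3
    have h2 : (b : ℝ) ^ 2 ≤ c := le_of_mul_le_mul_left (by linarith [h1]) hb0
    nlinarith
  have hR : ∀ j₁ < J, ∀ j₂ < J, j₁ ≠ j₂ → ‖∑ h ∈ Finset.range X,
      localPhase c κ U (b * M) (h + b ^ 2 * j₁) *
        (starRingEnd ℂ) (localPhase c κ U (b * M) (h + b ^ 2 * j₂))‖ ≤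
      4 ^ w * U.natAbs * (2 * √(b : ℝ)) * (c * Lq) := by
    intro j₁ hj₁ j₂ hj₂ hj
    refine (norm_correlation_le hqc h4c hκ hU (b * M) hbc hj hX).trans ?_
    have h5 : ((U * ((j₁ : ℤ) - j₂)).natAbs : ℝ) ≤ U.natAbs * (2 * √(b : ℝ)) := by
      rw [Int.natAbs_mul, Nat.cast_mul]
      have : ((j₁ : ℤ) - j₂).natAbs ≤ J := by omega
      have : ((((j₁ : ℤ) - j₂).natAbs : ℕ) : ℝ) ≤ J := by exact_mod_cast this
      gcongr
      linarith
    have h6 : (b : ℝ) + c * (1 + Real.log c) ≤ c * Lq := by nlinarith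
    have h7 : (4 : ℝ) ^ c.primeFactors.card ≤ 4 ^ w := pow_le_pow_right₀ (by norm_num) hw
    have h8 : 0 ≤ (b : ℝ) + c * (1 + Real.log c) := by positivity
    calc _ ≤ 4 ^ w * (U.natAbs * (2 * √(b : ℝ))) * (c * Lq) := by gcongr
      _ = _ := by ring
  have hLq0 : 0 ≤ Lq := by linarith
  have key := norm_sq_sum_mul_le_of_shift
    (localPhase b (((c ^ 2 : ℕ) : ZMod (b ^ 2))⁻¹ * 4⁻¹) U (c * M)) (localPhase c κ U (b * M))
    (norm_localPhase_le _ _ _ _) (norm_localPhase_le _ _ _ _) (localPhase_add_sq_mul _ _ _ _)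
    hJ0 X (by positivity) hR
  set S := ∑ h ∈ Finset.range X,
    localPhase b (((c ^ 2 : ℕ) : ZMod (b ^ 2))⁻¹ * 4⁻¹) U (c * M) h *
      localPhase c κ U (b * M) h
  set t := √(b : ℝ) with ht
  have ht2 : t * t = b := Real.mul_self_sqrt hb0.le
  have ht0 : 0 < t := by linarith
  obtain ⟨Q, hQ⟩ : ∃ Q : ℝ, Q = ((b * c : ℕ) : ℝ) := ⟨_, rfl⟩
  have hXQ : (X : ℝ) ≤ Q := by rw [hQ]; exact_mod_cast hX
  have hQbc : Q = b * c := by rw [hQ]; push_cast; rfl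
  have hQ0 : 0 < Q := by rw [hQbc]; positivity
  rw [← hQ]
  have hbQ : (b : ℝ) ^ 3 ≤ Q := by rw [hQ]; exact_mod_cast hb3
  have k1 : 8 * (((b ^ 2 : ℕ) : ℝ) * J) ^ 2 ≤ 32 * (Q ^ 2 / t) := by
    have : (((b ^ 2 : ℕ) : ℝ) * J) ^ 2 ≤ ((b : ℝ) ^ 2 * (2 * t)) ^ 2 := by
      push_cast; gcongr
    have h9 : ((b : ℝ) ^ 2 * (2 * t)) ^ 2 = 4 * (b : ℝ) ^ 5 := by
      rw [mul_pow, mul_pow, sq t, ht2]; ring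
    have h10 : (b : ℝ) ^ 5 ≤ Q ^ 2 / t := by
      rw [le_div_iff₀ ht0]
      have : t ≤ b := by nlinarith
      calc (b : ℝ) ^ 5 * t ≤ (b : ℝ) ^ 5 * b := by gcongr
        _ = ((b : ℝ) ^ 3) ^ 2 := by ring
        _ ≤ Q ^ 2 := by gcongr
    linarith
  have k2 : (X : ℝ) / J ≤ Q / t := by gcongr
  have k3 : 4 ^ w * U.natAbs * (2 * t) * (c * Lq) = 4 ^ w * U.natAbs * 2 * Lq * (Q / t) := by
    rw [hQbc, ← ht2]; field_simp
  rw [k3] at key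
  have k4 : ‖S‖ ^ 2 ≤ Q ^ 2 / t * (34 + 4 * (4 ^ w * U.natAbs * Lq)) := by
    have : (X : ℝ) * (X / J + 4 ^ w * U.natAbs * 2 * Lq * (Q / t)) ≤
        Q * (Q / t + 4 ^ w * U.natAbs * 2 * Lq * (Q / t)) := by gcongr
    have e1 : Q * (Q / t + 4 ^ w * U.natAbs * 2 * Lq * (Q / t)) =
        Q ^ 2 / t * (1 + 2 * (4 ^ w * U.natAbs * Lq)) := by ring
    linarith
  have h4w : (1 : ℝ) ≤ 4 ^ w := one_le_pow₀ (by norm_num)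
  have k5 : 34 + 4 * (4 ^ w * U.natAbs * Lq) ≤ 64 * (4 ^ w * (U.natAbs : ℝ) ^ 2 * Lq ^ 2) := by
    have a1 : 1 ≤ 4 ^ w * (U.natAbs : ℝ) := one_le_mul_of_one_le_of_one_le h4w hU1
    have a2 : 4 ^ w * U.natAbs * Lq ≤ 4 ^ w * (U.natAbs : ℝ) ^ 2 * Lq ^ 2 := by
      gcongr
      · exact le_self_pow₀ hU1 (by norm_num)
      · exact le_self_pow₀ (by linarith) (by norm_num)
    nlinarith
  have k6 : t = (b : ℝ) ^ (1 / 2 : ℝ) := by rw [ht, Real.sqrt_eq_rpow]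
  refine le_of_pow_le_pow_left₀ (n := 2) (by norm_num) (by positivity) ?_
  have k7 : ((b : ℝ) ^ (-(1 / 4) : ℝ)) ^ 2 = 1 / t := by
    rw [← Real.rpow_mul_natCast hb0.le, k6, one_div ((b : ℝ) ^ _), ← Real.rpow_neg hb0.le]; norm_num
  calc ‖S‖ ^ 2 ≤ Q ^ 2 / t * (34 + 4 * (4 ^ w * U.natAbs * Lq)) := k4
    _ ≤ Q ^ 2 / t * (64 * (4 ^ w * (U.natAbs : ℝ) ^ 2 * Lq ^ 2)) := by gcongr
    _ = (8 * 2 ^ w * U.natAbs * Lq * Q) ^ 2 * (1 / t) := by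
      have : (4 : ℝ) ^ w = (2 ^ w) ^ 2 := by rw [← pow_mul, mul_comm, pow_mul]; norm_num
      rw [this]; ring
    _ = _ := by rw [← k7]; ring

/-- The incomplete sums of all nontrivial phases. -/
lemma norm_sum_phase_le {b c : ℕ} [NeZero b] [NeZero c] (hq : Squarefree (b * c))
    (h4 : Nat.Coprime 4 (b * c)) {U M : ℤ} (hUM : ¬ (U = 0 ∧ M = 0)) (hb3 : b ^ 3 ≤ b * c) {X : ℕ}
    (hX : X ≤ b * c) :
    ‖∑ h ∈ (Finset.range X).filter (fun h => Nat.Coprime h (b * c)), phase (b * c) U M h‖ ≤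
      8 * 2 ^ (b * c).primeFactors.card * (U.natAbs + M.natAbs) *
        (2 + Real.log ((b * c : ℕ) : ℝ)) * ((b * c : ℕ) : ℝ) * (b : ℝ) ^ (-(1 / 4) : ℝ) := by
  have hlog : 0 ≤ Real.log ((b * c : ℕ) : ℝ) := Real.log_natCast_nonneg _
  by_cases hU : U = 0
  · have hM : M ≠ 0 := fun h => hUM ⟨hU, h⟩
    subst hU
    refine (norm_sum_phase_zero_le hq h4 hM hX).trans ?_
    have hb0 : (0 : ℝ) < b := by exact_mod_cast NeZero.pos b
    have hq0 : (0 : ℝ) < ((b * c : ℕ) : ℝ) := by exact_mod_cast NeZero.pos (b * c)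
    have hbq : (b : ℝ) ≤ ((b * c : ℕ) : ℝ) := by
      exact_mod_cast Nat.le_mul_of_pos_right b (NeZero.pos c)
    have h1 : ((b * c : ℕ) : ℝ) ^ (3 / 4 : ℝ) ≤
        ((b * c : ℕ) : ℝ) * (b : ℝ) ^ (-(1 / 4) : ℝ) := by
      calc ((b * c : ℕ) : ℝ) ^ (3 / 4 : ℝ)
          = ((b * c : ℕ) : ℝ) * ((b * c : ℕ) : ℝ) ^ (-(1 / 4) : ℝ) := by
            rw [← Real.rpow_one_add' hq0.le (by norm_num)]; norm_num
        _ ≤ _ := mul_le_mul_of_nonneg_left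
            (Real.rpow_le_rpow_of_nonpos hb0 hbq (by norm_num)) hq0.le
    rw [mul_assoc (_ * _ : ℝ) _ ((b : ℝ) ^ (-(1 / 4) : ℝ))]
    gcongr
    · nlinarith [show (0 : ℝ) < 2 ^ (b * c).primeFactors.card by positivity]
    · simp
  · refine (norm_sum_phase_ne_zero_le hq h4 hU M hb3 hX).trans ?_
    gcongr
    simp

end Shifts

/-! ### The average of `R~ᵏ` over the reduced residues to a fixed modulus -/

section FixedModulus

lemma continuousOn_of_norm_sub_le {G : ℝ → ℂ} {s : Set ℝ} {L : ℝ}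
    (hG : ∀ x ∈ s, ∀ y ∈ s, ‖G x - G y‖ ≤ L * |x - y|) : ContinuousOn G s := by
  refine (LipschitzOnWith.of_dist_le_mul (K := L.toNNReal) fun x hx y hy => ?_).continuousOn
  rw [dist_eq_norm, Real.dist_eq]
  exact (hG x hx y hy).trans (by gcongr; exact Real.le_coe_toNNReal L)

/-- Riemann sums with unit steps. -/
lemma norm_sum_sub_integral_le {G : ℝ → ℂ} {a : ℝ} {n : ℕ} {L : ℝ} (hL : 0 ≤ L)
    (hG : ∀ x ∈ Set.Icc a (a + n), ∀ y ∈ Set.Icc a (a + n), ‖G x - G y‖ ≤ L * |x - y|) :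
    ‖∑ i ∈ Finset.range n, G (a + i) - ∫ x in a..(a + n), G x‖ ≤ n * L := by
  have hc := continuousOn_of_norm_sub_le hG
  have hsub : ∀ i < n, Set.Icc (a + i) (a + (i + 1 : ℕ)) ⊆ Set.Icc a (a + n) := by
    intro i hi
    have : ((i + 1 : ℕ) : ℝ) ≤ n := by exact_mod_cast hi
    exact Set.Icc_subset_Icc (by simp) (by linarith)
  have hint : ∀ i < n, IntervalIntegrable G volume (a + i) (a + (i + 1 : ℕ)) := by
    intro i hi
    refine ContinuousOn.intervalIntegrable ?_
    rw [Set.uIcc_of_le (by push_cast; linarith)]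
    exact hc.mono (hsub i hi)
  have h1 := intervalIntegral.sum_integral_adjacent_intervals (f := G) (μ := volume)
    (a := fun i : ℕ => a + i) (n := n) hint
  simp only [Nat.cast_zero, add_zero] at h1
  rw [← h1, ← Finset.sum_sub_distrib]
  refine (norm_sum_le_of_le (n := fun _ => L) _ fun i hi => ?_).trans (by simp)
  rw [Finset.mem_range] at hi
  have hle : a + (i : ℝ) ≤ a + (i + 1 : ℕ) := by push_cast; linarith
  have h2 : G (a + i) - ∫ x in (a + i)..(a + (i + 1 : ℕ)), G x =
      ∫ x in (a + i)..(a + (i + 1 : ℕ)), (G (a + i) - G x) := by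
    rw [intervalIntegral.integral_sub (by simp) (hint i hi), intervalIntegral.integral_const]
    congr 1
    push_cast
    rw [show a + ((i : ℝ) + 1) - (a + i) = 1 by ring, one_smul]
  rw [h2]
  refine (intervalIntegral.norm_integral_le_of_norm_le_const (C := L) fun x hx => ?_).trans ?_
  · rw [Set.uIoc_of_le hle] at hx
    refine (hG _ (hsub i hi ⟨le_rfl, hle⟩) _ (hsub i hi ⟨hx.1.le, hx.2⟩)).trans ?_
    refine mul_le_of_le_one_right hL ?_
    have := hx.2
    push_cast at this
    rw [abs_le]; constructor <;> linarith [hx.1]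
  · push_cast
    rw [show a + ((i : ℝ) + 1) - (a + i) = 1 by ring, abs_one, mul_one]

lemma sum_moebius_dvd {h q : ℕ} (hq : q ≠ 0) :
    ∑ d ∈ q.divisors, (if d ∣ h then (ArithmeticFunction.moebius d : ℤ) else 0) =
      if Nat.Coprime h q then 1 else 0 := by
  have h1 := congrArg (fun f : ArithmeticFunction ℤ => f (Nat.gcd h q))
    ArithmeticFunction.moebius_mul_coe_zeta
  simp only [ArithmeticFunction.coe_mul_zeta_apply, ArithmeticFunction.one_apply] at h1
  simp only [Nat.coprime_iff_gcd_eq_one]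
  rw [← h1, ← Finset.sum_filter]
  refine Finset.sum_congr ?_ fun _ _ => rfl
  ext d
  simp only [Finset.mem_filter, Nat.mem_divisors, Nat.dvd_gcd_iff, ne_eq, Nat.gcd_eq_zero_iff]
  tauto

lemma sum_range_dvd {A : Type*} [AddCommMonoid A] {d q : ℕ} (hd : d ∣ q) (hq : 0 < q)
    (f : ℕ → A) :
    ∑ h ∈ (Finset.range q).filter (fun h => d ∣ h), f h =
      ∑ j ∈ Finset.range (q / d), f (d * j) := by
  have hd0 : 0 < d := Nat.pos_of_dvd_of_pos hd hq
  obtain ⟨r, rfl⟩ := hd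
  rw [Nat.mul_div_cancel_left _ hd0]
  refine (Finset.sum_bij (fun j _ => d * j) ?_ ?_ ?_ ?_).symm
  · intro j hj
    rw [Finset.mem_range] at hj
    exact Finset.mem_filter.2
      ⟨Finset.mem_range.2 ((Nat.mul_lt_mul_left hd0).2 hj), dvd_mul_right _ _⟩
  · intro i _ j _ h
    exact Nat.eq_of_mul_eq_mul_left hd0 h
  · intro h hh
    rw [Finset.mem_filter, Finset.mem_range] at hh
    obtain ⟨hlt, j, rfl⟩ := hh
    exact ⟨j, Finset.mem_range.2 ((Nat.mul_lt_mul_left hd0).1 hlt), rfl⟩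
  · intro _ _; rfl

lemma sum_coprime_eq_sum_moebius {q : ℕ} (hq : 0 < q) (f : ℕ → ℂ) :
    ∑ h ∈ (Finset.range q).filter (fun h => Nat.Coprime h q), f h =
      ∑ d ∈ q.divisors, (ArithmeticFunction.moebius d : ℂ) *
        ∑ j ∈ Finset.range (q / d), f (d * j) := by
  have h1 : ∀ h, (if Nat.Coprime h q then f h else 0) =
      ∑ d ∈ q.divisors, if d ∣ h then (ArithmeticFunction.moebius d : ℂ) * f h else 0 := by
    intro h
    have h2 := congrArg (fun z : ℤ => (z : ℂ) * f h) (sum_moebius_dvd (h := h) hq.ne')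
    simp only [Int.cast_sum, Finset.sum_mul] at h2
    calc (if Nat.Coprime h q then f h else 0)
        = ((if Nat.Coprime h q then 1 else 0 : ℤ) : ℂ) * f h := by split_ifs <;> simp
      _ = _ := by
        rw [← h2]
        exact Finset.sum_congr rfl fun d _ => by split_ifs <;> simp
  rw [Finset.sum_filter, Finset.sum_congr rfl fun h _ => h1 h, Finset.sum_comm]
  refine Finset.sum_congr rfl fun d hd => ?_
  rw [← Finset.sum_filter, ← Finset.mul_sum, sum_range_dvd (Nat.dvd_of_mem_divisors hd) hq]

lemma totient_eq_sum_moebius {q : ℕ} (hq : 0 < q) :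
    (q.totient : ℂ) = ∑ d ∈ q.divisors, (ArithmeticFunction.moebius d : ℂ) * ((q / d : ℕ) : ℂ) := by
  have := sum_coprime_eq_sum_moebius hq fun _ => (1 : ℂ)
  simp only [Finset.sum_const, Finset.card_range, nsmul_eq_mul, mul_one] at this
  rw [← this, Nat.totient_eq_card_coprime]
  congr 2
  exact Finset.filter_congr fun _ _ => Nat.coprime_comm

lemma card_divisors_of_squarefree {q : ℕ} (hq : Squarefree q) :
    q.divisors.card = 2 ^ q.primeFactors.card := by
  rw [Nat.card_divisors hq.ne_zero, ← Finset.prod_const]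
  refine Finset.prod_congr rfl fun p hp => ?_
  rw [Nat.factorization_eq_one_of_squarefree hq (Nat.prime_of_mem_primeFactors hp)
    (Nat.dvd_of_mem_primeFactors hp)]

/-- The fractions `h/q` with `h` coprime to `q` are well distributed in `[0, 1]`. -/
lemma norm_sum_coprime_sub_integral_le {q : ℕ} (hq : Squarefree q) {g : ℝ → ℂ} {L : ℝ}
    (hL : 0 ≤ L)
    (hg : ∀ x ∈ Set.Icc (0 : ℝ) 1, ∀ y ∈ Set.Icc (0 : ℝ) 1, ‖g x - g y‖ ≤ L * |x - y|) :
    ‖∑ h ∈ (Finset.range q).filter (fun h => Nat.Coprime h q), g (h / q) -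
      q.totient * ∫ β in (0 : ℝ)..1, g β‖ ≤ 2 ^ q.primeFactors.card * L := by
  have hq0 : 0 < q := Nat.pos_of_ne_zero hq.ne_zero
  rw [sum_coprime_eq_sum_moebius hq0, totient_eq_sum_moebius hq0, Finset.sum_mul,
    ← Finset.sum_sub_distrib]
  refine (norm_sum_le_of_le (n := fun _ => L) _ fun d hd => ?_).trans ?_
  · have hdq := Nat.dvd_of_mem_divisors hd
    obtain ⟨n, rfl⟩ := hdq
    have hd0 : 0 < d := Nat.pos_of_ne_zero fun h => hq0.ne' (by rw [h, zero_mul])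
    have hn0 : 0 < n := Nat.pos_of_ne_zero fun h => hq0.ne' (by rw [h, mul_zero])
    rw [Nat.mul_div_cancel_left _ hd0, mul_assoc, ← mul_sub, norm_mul]
    have hμ : ‖(ArithmeticFunction.moebius d : ℂ)‖ ≤ 1 := by
      rw [Complex.norm_intCast]
      exact_mod_cast ArithmeticFunction.abs_moebius_le_one
    refine (mul_le_of_le_one_left (norm_nonneg _) hμ).trans ?_
    have hnR : (0 : ℝ) < n := by exact_mod_cast hn0
    have h1 := norm_sum_sub_integral_le (G := fun x => g (x / n)) (a := 0) (n := n) (L := L / n)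
      (by positivity) fun x hx y hy => by
        rw [zero_add] at hx hy
        have h2 : ∀ z ∈ Set.Icc (0 : ℝ) n, z / n ∈ Set.Icc (0 : ℝ) 1 := fun z hz =>
          ⟨div_nonneg hz.1 hnR.le, div_le_one_of_le₀ hz.2 hnR.le⟩
        refine (hg _ (h2 x hx) _ (h2 y hy)).trans_eq ?_
        rw [← sub_div, abs_div, abs_of_pos hnR]; ring
    have h3 : ∫ x in (0 : ℝ)..(0 + n), g (x / n) = n * ∫ β in (0 : ℝ)..1, g β := by
      rw [intervalIntegral.integral_comp_div g hnR.ne']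
      simp [div_self hnR.ne']
    rw [h3, mul_div_cancel₀ _ hnR.ne'] at h1
    refine le_trans (le_of_eq ?_) h1
    congr 2
    refine Finset.sum_congr rfl fun j _ => ?_
    congr 1
    have : (d : ℝ) ≠ 0 := by exact_mod_cast hd0.ne'
    push_cast
    field_simp
    simp
  · rw [Finset.sum_const, card_divisors_of_squarefree hq, nsmul_eq_mul]
    push_cast; rfl

lemma one_add_sum_le_prod {ι : Type*} (s : Finset ι) (f : ι → ℝ) (hf : ∀ i, 0 ≤ f i) :
    1 + ∑ i ∈ s, f i ≤ ∏ i ∈ s, (1 + f i) := by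
  classical
  induction s using Finset.induction_on with
  | empty => simp
  | insert i s hi ih =>
    rw [Finset.sum_insert hi, Finset.prod_insert hi]
    have : 0 ≤ ∑ i ∈ s, f i := Finset.sum_nonneg fun i _ => hf i
    nlinarith [hf i]

/-- One power of the decay in `m` pays for the factor `|M|` in the exponential sum bounds. -/
lemma weight_three_mul_le {k : ℕ} (m : Fin k → ℤ) :
    (1 + ((∑ i, m i).natAbs : ℝ)) * weight 3 m ≤ weight 2 m := by
  have h1 : 1 + ((∑ i, m i).natAbs : ℝ) ≤ ∏ i, (1 + |(m i : ℝ)|) := by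
    refine le_trans ?_ (one_add_sum_le_prod _ _ fun i => abs_nonneg _)
    rw [Nat.cast_natAbs]
    push_cast
    gcongr
    exact Finset.abs_sum_le_sum_abs _ _
  refine (mul_le_mul_of_nonneg_right h1 (weight_nonneg 3 m)).trans_eq ?_
  rw [weight, weight, ← Finset.prod_mul_distrib]
  refine Finset.prod_congr rfl fun i _ => ?_
  have : 0 < 1 + |(m i : ℝ)| := by positivity
  field_simp

/-- The error made by replacing the average over reduced residues by the density. -/
noncomputable def modulusError (b c : ℕ) : ℝ :=
  2 ^ (b * c).primeFactors.card * (2 + Real.log ((b * c : ℕ) : ℝ)) * ((b * c : ℕ) : ℝ) *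
    (b : ℝ) ^ (-(1 / 4) : ℝ)

/-- The main terms, too, only contribute errors of the size of `modulusError`. -/
lemma two_pow_le_modulusError {b c : ℕ} (hb : 0 < b) (hc : 0 < c) :
    2 ^ (b * c).primeFactors.card ≤ modulusError b c := by
  have hb1 : (1 : ℝ) ≤ b := by exact_mod_cast hb
  have hc1 : (1 : ℝ) ≤ c := by exact_mod_cast hc
  have hlog : 0 ≤ Real.log ((b * c : ℕ) : ℝ) := Real.log_natCast_nonneg _
  have h1 : 1 ≤ ((b * c : ℕ) : ℝ) * (b : ℝ) ^ (-(1 / 4) : ℝ) := by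
    have : (b : ℝ) * (b : ℝ) ^ (-(1 / 4) : ℝ) = (b : ℝ) ^ (3 / 4 : ℝ) := by
      rw [← Real.rpow_one_add' (by linarith) (by norm_num)]; norm_num
    push_cast
    rw [mul_right_comm, this]
    exact one_le_mul_of_one_le_of_one_le (Real.one_le_rpow hb1 (by norm_num)) hc1
  rw [modulusError, mul_assoc, mul_assoc]
  refine le_mul_of_one_le_right (by positivity) ?_
  nlinarith

/-- The sum over `h` of the terms of `Rpow` with fixed `u`, `m`. -/
lemma Cutoffs.norm_sum_phase_mul_Fprod_le (hc : Cutoffs Φ V) (k : ℕ) : ∃ C, 1 ≤ C ∧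
    ∀ (θ Δ v : ℝ) (u m : Fin k → ℤ) (b c : ℕ), |θ| ≤ 1 → 1 ≤ Δ → v ∈ Set.Icc Δ (2 * Δ) →
      u ∈ shiftVecs k Δ → Squarefree (b * c) → Nat.Coprime 4 (b * c) → b ^ 3 ≤ b * c →
      ‖∑ h ∈ (Finset.range (b * c)).filter (fun h => Nat.Coprime h (b * c)),
          phase (b * c) (∑ i, u i) (∑ i, m i) h *
            Fprod Φ V θ v u m ((h : ℝ) / ((b * c : ℕ) : ℝ)) -
        (b * c).totient * (if ∑ i, u i = 0 ∧ ∑ i, m i = 0 then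
          ∫ β in (0 : ℝ)..1, Fprod Φ V θ v u m β else 0)‖ ≤
        C * Δ ^ (12 * k + 9) * modulusError b c * weight 2 m := by
  obtain ⟨C, hC, hreg⟩ := hc.Fprod_regular k
  refine ⟨16 * (k + 1) * C, ?_, fun θ Δ v u m b c hθ hΔ hv hu hq h4 hb3 => ?_⟩
  · have hk : (0 : ℝ) ≤ k := by positivity
    nlinarith
  obtain ⟨hD, hL, -⟩ := hreg θ Δ v u m hθ hΔ hv hu
  set D := C * Δ ^ (12 * k + 5) * weight 3 m with hDdef
  have hw3 := weight_nonneg 3 m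
  have hw2 := weight_nonneg 2 m
  have hD0 : 0 ≤ D := by positivity
  have hbc0 : b * c ≠ 0 := hq.ne_zero
  have hb0 : 0 < b := Nat.pos_of_ne_zero fun h => hbc0 (by rw [h, zero_mul])
  have hc0 : 0 < c := Nat.pos_of_ne_zero fun h => hbc0 (by rw [h, mul_zero])
  have : NeZero b := ⟨hb0.ne'⟩
  have : NeZero c := ⟨hc0.ne'⟩
  have hE := two_pow_le_modulusError hb0 hc0
  have hE0 : 0 ≤ modulusError b c := le_trans (by positivity) hE
  have hwm := weight_three_mul_le m
  have hΔ5 : Δ ^ (12 * k + 9) = Δ ^ (12 * k + 5) * Δ ^ 4 := by rw [← pow_add]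
  have hΔ4 : 1 ≤ Δ ^ 4 := one_le_pow₀ hΔ
  have hk0 : (0 : ℝ) ≤ k := by positivity
  split_ifs with hUM
  · rw [hUM.1, hUM.2]
    have h1 : ∀ h, phase (b * c) 0 0 h = 1 := by
      intro h
      rw [phase, phaseArg, ez_eq_stdAddChar]
      simp
    simp_rw [h1, one_mul]
    refine (norm_sum_coprime_sub_integral_le hq hD0 hL).trans ?_
    have hw32 : weight 3 m ≤ weight 2 m := by
      refine le_trans ?_ hwm
      exact le_mul_of_one_le_left hw3 (by simp)
    calc 2 ^ (b * c).primeFactors.card * D ≤ modulusError b c * D := by gcongr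
      _ = C * (Δ ^ (12 * k + 5) * 1) * modulusError b c * weight 3 m := by rw [hDdef]; ring
      _ ≤ C * (Δ ^ (12 * k + 5) * Δ ^ 4) * modulusError b c * weight 2 m := by gcongr
      _ ≤ 16 * (k + 1) * C * (Δ ^ (12 * k + 5) * Δ ^ 4) * modulusError b c * weight 2 m := by
        gcongr
        nlinarith
      _ = _ := by rw [hΔ5]
  · rw [mul_zero, sub_zero, Finset.sum_filter]
    set q := b * c with hqdef
    have hqR : (0 : ℝ) < q := by exact_mod_cast NeZero.pos (b * c)
    set E := 8 * (((∑ i, u i).natAbs : ℝ) + (∑ i, m i).natAbs) * modulusError b c with hEdef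
    have h1 := norm_sum_mul_le_of_partial_sums (n := q)
      (fun h => if Nat.Coprime h q then phase q (∑ i, u i) (∑ i, m i) h else 0)
      (fun h => Fprod Φ V θ v u m ((h : ℝ) / (q : ℝ))) (E := E) (D := D) (L := D / q)
      (fun j hj => by
        rw [← Finset.sum_filter]
        refine (norm_sum_phase_le hq h4 hUM hb3 hj).trans_eq ?_
        rw [hEdef, modulusError]; ring)
      (fun i hi => hD _ ⟨by positivity, div_le_one_of_le₀ (by exact_mod_cast hi.le) hqR.le⟩)
      (fun i hi => by
        refine (hL _ ⟨by positivity, div_le_one_of_le₀ (by exact_mod_cast hi.le) hqR.le⟩ _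
          ⟨by positivity, div_le_one_of_le₀ (by exact_mod_cast (by omega)) hqR.le⟩).trans_eq ?_
        rw [← sub_div]
        push_cast
        rw [add_sub_cancel_left, abs_of_pos (by positivity), mul_one_div])
      hD0 (by positivity)
    have h2 : ∑ h ∈ Finset.range q, (if Nat.Coprime h q then
        phase q (∑ i, u i) (∑ i, m i) h * Fprod Φ V θ v u m ((h : ℝ) / (q : ℝ)) else 0) =
        ∑ h ∈ Finset.range q, (if Nat.Coprime h q then phase q (∑ i, u i) (∑ i, m i) h else 0) *
          Fprod Φ V θ v u m ((h : ℝ) / (q : ℝ)) :=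
      Finset.sum_congr rfl fun h _ => by split_ifs <;> simp
    rw [h2]
    refine h1.trans ?_
    rw [mul_div_cancel₀ _ hqR.ne']
    have hU : ((∑ i, u i).natAbs : ℝ) ≤ k * Δ ^ 4 := by
      rw [Nat.cast_natAbs]
      push_cast
      refine (Finset.abs_sum_le_sum_abs _ _).trans ?_
      refine (Finset.sum_le_sum fun i _ => ?_ : _ ≤ ∑ _i : Fin k, Δ ^ 4).trans (by simp)
      have := (mem_shiftVecs.1 hu i).2
      push_cast at this; exact this
    have hUM' : ((∑ i, u i).natAbs : ℝ) + (∑ i, m i).natAbs ≤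
        (k + 1) * Δ ^ 4 * (1 + ((∑ i, m i).natAbs : ℝ)) := by
      have hM0 : (0 : ℝ) ≤ (∑ i, m i).natAbs := by positivity
      have : (0 : ℝ) ≤ k * Δ ^ 4 * (∑ i, m i).natAbs := by positivity
      nlinarith
    calc E * (D + D) = 16 * C * Δ ^ (12 * k + 5) * modulusError b c *
          (((∑ i, u i).natAbs : ℝ) + (∑ i, m i).natAbs) * weight 3 m := by
          rw [hEdef, hDdef]; ring
      _ ≤ 16 * C * Δ ^ (12 * k + 5) * modulusError b c *
          ((k + 1) * Δ ^ 4 * (1 + ((∑ i, m i).natAbs : ℝ))) * weight 3 m := by gcongr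
      _ = 16 * (k + 1) * C * Δ ^ (12 * k + 9) * modulusError b c *
          ((1 + ((∑ i, m i).natAbs : ℝ)) * weight 3 m) := by rw [hΔ5]; ring
      _ ≤ _ := by gcongr

/-- The average of `R~ᵏ` over the reduced residues to a modulus with a suitable factor. -/
lemma Cutoffs.norm_sum_Rpow_sub_density_le (hc : Cutoffs Φ V) (k : ℕ) : ∃ C, 1 ≤ C ∧
    ∀ (θ Δ v : ℝ) (b c : ℕ), |θ| ≤ 1 → 1 ≤ Δ → v ∈ Set.Icc Δ (2 * Δ) →
      Squarefree (b * c) → Nat.Coprime 4 (b * c) → b ^ 3 ≤ b * c →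
      ‖∑ h ∈ (Finset.range (b * c)).filter (fun h => Nat.Coprime h (b * c)),
          Rpow Φ V k Δ (b * c) h θ v - (b * c).totient * density Φ V k Δ θ v‖ ≤
        C * Δ ^ (16 * k + 9) * modulusError b c := by
  obtain ⟨C, hC, hb⟩ := hc.norm_sum_phase_mul_Fprod_le k
  obtain ⟨C', hC', hreg⟩ := hc.Fprod_regular k
  set W := ∑' m : Fin k → ℤ, weight 2 m
  have hsW := summable_weight (n := 2) le_rfl k
  have hsW3 := summable_weight (n := 3) (by norm_num) k
  have hW : 0 ≤ W := tsum_nonneg fun m => weight_nonneg 2 m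
  refine ⟨3 ^ k * (C * W) + 1, by linarith [(by positivity : 0 ≤ 3 ^ k * (C * W))],
    fun θ Δ v b c hθ hΔ hv hq h4 hb3 => ?_⟩
  have hbc0 : b * c ≠ 0 := hq.ne_zero
  have hb0 : 0 < b := Nat.pos_of_ne_zero fun h => hbc0 (by rw [h, zero_mul])
  have hc0 : 0 < c := Nat.pos_of_ne_zero fun h => hbc0 (by rw [h, mul_zero])
  have hE0 : 0 ≤ modulusError b c := le_trans (by positivity) (two_pow_le_modulusError hb0 hc0)
  set q := b * c with hqdef
  have hqR : (0 : ℝ) < q := by exact_mod_cast Nat.pos_of_ne_zero hbc0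
  set S := (Finset.range q).filter fun h => Nat.Coprime h q with hS
  set T : (Fin k → ℤ) → (Fin k → ℤ) → ℕ → ℂ := fun u m h =>
    phase q (∑ i, u i) (∑ i, m i) h * Fprod Φ V θ v u m ((h : ℝ) / (q : ℝ)) with hT
  set P : (Fin k → ℤ) → (Fin k → ℤ) → ℂ := fun u m =>
    if ∑ i, u i = 0 ∧ ∑ i, m i = 0 then ∫ β in (0 : ℝ)..1, Fprod Φ V θ v u m β else 0 with hP
  have hsT : ∀ u ∈ shiftVecs k Δ, ∀ h ∈ S, Summable fun m => T u m h := by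
    intro u hu h hh
    refine Summable.of_norm_bounded (hsW3.mul_left (C' * Δ ^ (12 * k + 5))) fun m => ?_
    simp only [hT]
    rw [norm_mul, norm_phase, one_mul]
    rw [hS, Finset.mem_filter, Finset.mem_range] at hh
    exact (hreg θ Δ v u m hθ hΔ hv hu).1 _
      ⟨by positivity, div_le_one_of_le₀ (by exact_mod_cast hh.1.le) hqR.le⟩
  have hsP : ∀ u ∈ shiftVecs k Δ, Summable fun m => P u m := by
    intro u hu
    refine Summable.of_norm_bounded (hsW3.mul_left (C' * Δ ^ (12 * k + 5))) fun m => ?_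
    have hw3 := weight_nonneg 3 m
    simp only [hP]
    split_ifs
    · refine (intervalIntegral.norm_integral_le_of_norm_le_const
        (C := C' * Δ ^ (12 * k + 5) * weight 3 m) fun β hβ => ?_).trans (by simp)
      rw [Set.uIoc_of_le zero_le_one] at hβ
      exact (hreg θ Δ v u m hθ hΔ hv hu).1 _ ⟨hβ.1.le, hβ.2⟩
    · rw [norm_zero]; positivity
  have h1 : ∑ h ∈ S, Rpow Φ V k Δ q h θ v = ∑ u ∈ shiftVecs k Δ, ∑' m, ∑ h ∈ S, T u m h := by
    simp only [Rpow]
    rw [Finset.sum_comm]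
    refine Finset.sum_congr rfl fun u hu => ?_
    rw [Summable.tsum_finsetSum fun h hh => hsT u hu h hh]
  have h2 : (q.totient : ℂ) * density Φ V k Δ θ v =
      ∑ u ∈ shiftVecs k Δ, ∑' m, q.totient * P u m := by
    rw [density, Finset.sum_filter, Finset.mul_sum]
    refine Finset.sum_congr rfl fun u hu => ?_
    rw [tsum_mul_left]
    congr 1
    split_ifs with hU
    · exact tsum_congr fun m => by simp only [hP, hU, true_and]
    · simp only [hP, hU, false_and, if_false, tsum_zero]
  rw [h1, h2, ← Finset.sum_sub_distrib]
  have h3 : ∀ u ∈ shiftVecs k Δ, ‖∑' m, ∑ h ∈ S, T u m h - ∑' m, q.totient * P u m‖ ≤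
      C * Δ ^ (12 * k + 9) * modulusError b c * W := by
    intro u hu
    rw [← Summable.tsum_sub (summable_sum fun h hh => hsT u hu h hh) ((hsP u hu).mul_left _),
      ← tsum_mul_left]
    exact tsum_of_norm_bounded (hsW.mul_left _).hasSum fun m =>
      hb θ Δ v u m b c hθ hΔ hv hu hq h4 hb3
  refine (norm_sum_le_of_le _ h3).trans ?_
  rw [Finset.sum_const, nsmul_eq_mul]
  calc _ ≤ 3 ^ k * Δ ^ (4 * k) * (C * Δ ^ (12 * k + 9) * modulusError b c * W) := by
        gcongr
        exact card_shiftVecs_le hΔ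
    _ = 3 ^ k * (C * W) * Δ ^ (16 * k + 9) * modulusError b c := by
        rw [show 16 * k + 9 = 4 * k + (12 * k + 9) by ring, pow_add]; ring
    _ ≤ _ := by gcongr; linarith

end FixedModulus

/-! ### Squarefree integers coprime to a given one -/

section RoughWeight

/-- Sums of a function that is a finite combination of indicator functions of progressions. -/
lemma abs_sum_sub_mul_le {I : Type*} (s : Finset I) (α : I → ℝ) (D : I → ℕ) (h : ℕ → ℝ) {Y : ℕ}
    (hh : ∀ c, 0 < c → c ≤ Y → h c = ∑ i ∈ s, if D i ∣ c then α i else 0) {t : ℕ}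
    (ht : t ≤ Y) :
    |∑ c ∈ Finset.Ioc 0 t, h c - (∑ i ∈ s, α i / D i) * t| ≤ ∑ i ∈ s, |α i| := by
  have h1 : ∑ c ∈ Finset.Ioc 0 t, h c = ∑ i ∈ s, α i * ((t / D i : ℕ) : ℝ) := by
    rw [Finset.sum_congr rfl fun c hc => hh c (Finset.mem_Ioc.1 hc).1
      ((Finset.mem_Ioc.1 hc).2.trans ht), Finset.sum_comm]
    refine Finset.sum_congr rfl fun i _ => ?_
    rw [← Finset.sum_filter, Finset.sum_const, Nat.Ioc_filter_dvd_card_eq_div, nsmul_eq_mul,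
      mul_comm]
  rw [h1, Finset.sum_mul, ← Finset.sum_sub_distrib]
  refine (Finset.abs_sum_le_sum_abs _ _).trans (Finset.sum_le_sum fun i _ => ?_)
  rw [div_mul_eq_mul_div, mul_div_assoc, ← mul_sub, abs_mul]
  refine mul_le_of_le_one_right (abs_nonneg _) ?_
  have e1 : ((t / D i : ℕ) : ℝ) = ⌊(t : ℝ) / D i⌋₊ := by rw [Nat.floor_div_eq_div]
  have e2 := Nat.floor_le (a := (t : ℝ) / D i) (by positivity)
  have e3 := Nat.lt_floor_add_one ((t : ℝ) / D i)
  rw [e1, abs_le]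
  constructor <;> linarith

/-- `φ(c)/c` if `c` is squarefree and coprime to `n`, and `0` otherwise. -/
noncomputable def roughWeight (n c : ℕ) : ℝ :=
  if Squarefree c ∧ Nat.Coprime c n then (c.totient : ℝ) / c else 0

lemma roughWeight_nonneg (n c : ℕ) : 0 ≤ roughWeight n c := by
  rw [roughWeight]; split_ifs <;> positivity

lemma roughWeight_le_one (n c : ℕ) : roughWeight n c ≤ 1 := by
  rw [roughWeight]
  split_ifs
  · exact div_le_one_of_le₀ (by exact_mod_cast Nat.totient_le c) (by positivity)
  · norm_num

lemma sum_moebius_sq_dvd {c Y : ℕ} (hc : 0 < c) (hcY : c ≤ Y) :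
    ∑ e ∈ Finset.Ioc 0 (Nat.sqrt Y),
      (if e ^ 2 ∣ c then (ArithmeticFunction.moebius e : ℤ) else 0) =
      if Squarefree c then 1 else 0 := by
  obtain ⟨a, b, rfl, ha⟩ := Nat.sq_mul_squarefree c
  have hb0 : b ≠ 0 := by rintro rfl; simp at hc
  have ha0 : a ≠ 0 := ha.ne_zero
  have h1 : (Finset.Ioc 0 (Nat.sqrt Y)).filter (fun e => e ^ 2 ∣ b ^ 2 * a) = b.divisors := by
    ext e
    rw [Finset.mem_filter, Finset.mem_Ioc, Nat.mem_divisors]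
    constructor
    · rintro ⟨⟨he0, -⟩, he⟩
      refine ⟨?_, hb0⟩
      rw [← Nat.factorization_le_iff_dvd he0.ne' hb0]
      intro p
      have h2 := (Nat.factorization_le_iff_dvd (pow_ne_zero 2 he0.ne') hc.ne').2 he p
      rw [Nat.factorization_mul (pow_ne_zero 2 hb0) ha0, Nat.factorization_pow,
        Nat.factorization_pow] at h2
      simp only [Finsupp.smul_apply, Finsupp.add_apply, smul_eq_mul] at h2
      have h3 := Squarefree.natFactorization_le_one p ha
      omega
    · rintro ⟨he, -⟩
      have h2 : e ^ 2 ∣ b ^ 2 * a := (pow_dvd_pow_of_dvd he 2).mul_right a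
      refine ⟨⟨Nat.pos_of_dvd_of_pos he (Nat.pos_of_ne_zero hb0), ?_⟩, h2⟩
      rw [Nat.le_sqrt, ← sq]
      exact (Nat.le_of_dvd hc h2).trans hcY
  have h2 := congrArg (fun f : ArithmeticFunction ℤ => f b)
    ArithmeticFunction.moebius_mul_coe_zeta
  simp only [ArithmeticFunction.coe_mul_zeta_apply, ArithmeticFunction.one_apply] at h2
  rw [← Finset.sum_filter, h1, h2]
  have h3 : b = 1 ↔ Squarefree (b ^ 2 * a) := by
    constructor
    · rintro rfl; simpa using ha
    · intro h
      exact Nat.isUnit_iff.1 (h b ⟨a, by ring⟩)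
  simp only [h3]

lemma totient_div_eq_sum {c Y : ℕ} (hc : 0 < c) (hcY : c ≤ Y) :
    (c.totient : ℝ) / c = ∑ d ∈ Finset.Ioc 0 Y,
      if d ∣ c then (ArithmeticFunction.moebius d : ℝ) / d else 0 := by
  have h1 : (c.totient : ℝ) =
      ∑ d ∈ c.divisors, (ArithmeticFunction.moebius d : ℝ) * ((c / d : ℕ) : ℝ) := by
    have := totient_eq_sum_moebius hc
    apply Complex.ofReal_injective
    push_cast
    exact this
  have h2 : (Finset.Ioc 0 Y).filter (fun d => d ∣ c) = c.divisors := by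
    ext d
    rw [Finset.mem_filter, Finset.mem_Ioc, Nat.mem_divisors]
    constructor
    · rintro ⟨-, h⟩; exact ⟨h, hc.ne'⟩
    · rintro ⟨h, -⟩
      exact ⟨⟨Nat.pos_of_dvd_of_pos h hc, (Nat.le_of_dvd hc h).trans hcY⟩, h⟩
  have hcR : (c : ℝ) ≠ 0 := by exact_mod_cast hc.ne'
  rw [← Finset.sum_filter, h2, h1, Finset.sum_div]
  refine Finset.sum_congr rfl fun d hd => ?_
  have hd0 : (d : ℝ) ≠ 0 := by exact_mod_cast (Nat.pos_of_mem_divisors hd).ne'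
  rw [Nat.cast_div (Nat.dvd_of_mem_divisors hd) hd0]
  field_simp

/-- The error term in the summatory function of `roughWeight n` up to `Y`. -/
noncomputable def roughError (n Y : ℕ) : ℝ := (1 + Real.log Y) * √Y * n.divisors.card

/-- The summatory function of `roughWeight n`. The factor `φ(c)/c = ∑_{d ∣ c} μ(d)/d` and the two
conditions on `c` are all expanded into divisor sums, so that the weight becomes a combination of
indicators of progressions through `0`. -/
lemma exists_density_roughWeight {n : ℕ} (hn : n ≠ 0) (Y : ℕ) : ∃ κ : ℝ, ∀ t ≤ Y,
    |∑ c ∈ Finset.Ioc 0 t, roughWeight n c - κ * t| ≤ roughError n Y := by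
  set s := Finset.Ioc 0 Y ×ˢ (Finset.Ioc 0 (Nat.sqrt Y) ×ˢ n.divisors) with hs
  set α : ℕ × ℕ × ℕ → ℝ := fun i => (ArithmeticFunction.moebius i.1 : ℝ) / i.1 *
    ((ArithmeticFunction.moebius i.2.1 : ℝ) * (ArithmeticFunction.moebius i.2.2 : ℝ)) with hα
  set D : ℕ × ℕ × ℕ → ℕ := fun i => Nat.lcm i.1 (Nat.lcm (i.2.1 ^ 2) i.2.2) with hD
  refine ⟨∑ i ∈ s, α i / D i, fun t ht => (abs_sum_sub_mul_le s α D (roughWeight n) (Y := Y)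
    (fun c hc hcY => ?_) ht).trans ?_⟩
  · have h1 := congrArg (Int.cast : ℤ → ℝ) (sum_moebius_sq_dvd hc hcY)
    have h2 := congrArg (Int.cast : ℤ → ℝ) (sum_moebius_dvd (h := c) hn)
    push_cast at h1 h2
    have h3 : roughWeight n c = (c.totient : ℝ) / c * ((if Squarefree c then 1 else 0) *
        (if Nat.Coprime c n then 1 else 0)) := by
      rw [roughWeight]
      by_cases a1 : Squarefree c <;> by_cases a2 : Nat.Coprime c n <;> simp [a1, a2]
    rw [h3, ← h1, ← h2, totient_div_eq_sum hc hcY, Finset.sum_mul_sum, ← Finset.sum_product',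
      Finset.sum_mul_sum, ← Finset.sum_product']
    refine Finset.sum_congr rfl fun i _ => ?_
    simp only [hD, hα, Nat.lcm_dvd_iff]
    by_cases a1 : i.1 ∣ c <;> by_cases a2 : i.2.1 ^ 2 ∣ c <;> by_cases a3 : i.2.2 ∣ c <;>
      simp [a1, a2, a3]
  · have hμ : ∀ m : ℕ, |(ArithmeticFunction.moebius m : ℝ)| ≤ 1 := fun m => by
      exact_mod_cast ArithmeticFunction.abs_moebius_le_one
    calc ∑ i ∈ s, |α i| ≤ ∑ i ∈ s, 1 / (i.1 : ℝ) * (1 * 1) := by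
          refine Finset.sum_le_sum fun i _ => ?_
          simp only [hα]
          rw [abs_mul, abs_mul, abs_div, Nat.abs_cast]
          gcongr <;> exact hμ _
      _ = (∑ d ∈ Finset.Ioc 0 Y, 1 / (d : ℝ)) * ((Nat.sqrt Y : ℝ) * n.divisors.card) := by
          rw [hs, Finset.sum_product]
          simp only [mul_one, Finset.sum_const, Finset.card_product, Nat.card_Ioc, tsub_zero,
            nsmul_eq_mul]
          rw [← Finset.mul_sum, mul_comm]
          push_cast; rfl
      _ ≤ (1 + Real.log Y) * (√Y * n.divisors.card) := by
          have h1 : ∑ d ∈ Finset.Ioc 0 Y, 1 / (d : ℝ) = (harmonic Y : ℝ) := by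
            rw [harmonic_eq_sum_Icc]
            push_cast
            simp only [one_div]
            rfl
          rw [h1]
          have h2 := harmonic_le_one_add_log Y
          have h3 : (Nat.sqrt Y : ℝ) ≤ √Y := Real.nat_sqrt_le_real_sqrt
          have h4 : (0 : ℝ) ≤ Real.log Y := Real.log_natCast_nonneg Y
          gcongr
      _ = _ := by rw [roughError]; ring

lemma sum_Ioc_sub_eq {A : Type*} [AddCommGroup A] (f : ℕ → A) {i₀ : ℕ} (hi₀ : 0 < i₀) (j : ℕ) :
    ∑ i ∈ Finset.range j, f (i₀ + i) =
      ∑ c ∈ Finset.Ioc 0 (i₀ - 1 + j), f c - ∑ c ∈ Finset.Ioc 0 (i₀ - 1), f c := by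
  obtain ⟨m, rfl⟩ : ∃ m, i₀ = m + 1 := ⟨i₀ - 1, by omega⟩
  rw [Nat.add_sub_cancel]
  induction j with
  | zero => simp
  | succ j ih =>
    rw [Finset.sum_range_succ, ih, ← add_assoc m j 1, Finset.sum_Ioc_succ_top (by omega)]
    rw [show m + 1 + j = m + j + 1 by ring]; abel

lemma sum_Icc_eq_sum_range {A : Type*} [AddCommMonoid A] (f : ℕ → A) {i₀ n : ℕ} :
    ∑ c ∈ Finset.Icc i₀ (i₀ + n), f c = ∑ i ∈ Finset.range (n + 1), f (i₀ + i) := by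
  simp_rw [add_comm i₀]
  rw [Finset.range_eq_Ico, Finset.sum_Ico_add' f 0 (n + 1) i₀, zero_add]
  refine Finset.sum_congr ?_ fun _ _ => rfl
  ext c
  rw [Finset.mem_Icc, Finset.mem_Ico]
  omega

/-- Weights with a regular summatory function can be replaced by their density against smooth
functions on a dyadic interval. -/
lemma norm_sum_mul_sub_integral_le {h : ℕ → ℝ} {κ E : ℝ} {Y : ℕ} (hh : ∀ c, 0 ≤ h c ∧ h c ≤ 1)
    (hE : 1 ≤ E) (hκ : ∀ t ≤ Y, |∑ c ∈ Finset.Ioc 0 t, h c - κ * t| ≤ E)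
    {A : ℝ} (hA : 1 ≤ A) (hAY : 2 * A < Y + 1) {G : ℝ → ℂ} {D L : ℝ} (hL : 0 ≤ L)
    (hD : ∀ x ∈ Set.Icc A (2 * A), ‖G x‖ ≤ D)
    (hG : ∀ x ∈ Set.Icc A (2 * A), ∀ y ∈ Set.Icc A (2 * A), ‖G x - G y‖ ≤ L * |x - y|) :
    ‖∑ c ∈ Finset.Icc ⌈A⌉₊ ⌊2 * A⌋₊, (h c : ℂ) * G c - κ * ∫ x in A..(2 * A), G x‖ ≤
      8 * E * (D + 2 * A * L) := by
  have hA0 : 0 ≤ A := by linarith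
  have hD0 : 0 ≤ D := (norm_nonneg _).trans (hD A ⟨le_rfl, by linarith⟩)
  set i₀ := ⌈A⌉₊ with hi₀
  have a1 : A ≤ i₀ := Nat.le_ceil A
  have a2 : (i₀ : ℝ) < A + 1 := Nat.ceil_lt_add_one hA0
  have hi0 : 0 < i₀ := by
    have : (0 : ℝ) < i₀ := by linarith
    exact_mod_cast this
  have b1 : (⌊2 * A⌋₊ : ℝ) ≤ 2 * A := Nat.floor_le (by linarith)
  have b2 : 2 * A < ⌊2 * A⌋₊ + 1 := Nat.lt_floor_add_one _
  have hle : i₀ ≤ ⌊2 * A⌋₊ := by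
    have h1 : (i₀ : ℝ) < ((⌊2 * A⌋₊ + 1 : ℕ) : ℝ) := by push_cast; linarith
    have h2 : i₀ < ⌊2 * A⌋₊ + 1 := by exact_mod_cast h1
    omega
  obtain ⟨n, hn⟩ : ∃ n, ⌊2 * A⌋₊ = i₀ + n := ⟨⌊2 * A⌋₊ - i₀, by omega⟩
  rw [hn] at b1 b2 ⊢
  push_cast at b1 b2
  have hnY : i₀ + n ≤ Y := by
    have h1 : ((i₀ + n : ℕ) : ℝ) < ((Y + 1 : ℕ) : ℝ) := by push_cast; linarith
    have h2 : i₀ + n < Y + 1 := by exact_mod_cast h1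
    omega
  have hmem : ∀ i ≤ n, ((i₀ : ℝ) + i) ∈ Set.Icc A (2 * A) := by
    intro i hi
    have : (i : ℝ) ≤ n := by exact_mod_cast hi
    constructor
    · have : (0 : ℝ) ≤ i := by positivity
      linarith
    · linarith
  have hn2 : (n : ℝ) + 1 ≤ 2 * A := by linarith
  rw [sum_Icc_eq_sum_range]
  -- the weights minus their density have bounded partial sums
  have k1 := norm_sum_mul_le_of_partial_sums (n := n + 1) (fun i => ((h (i₀ + i) - κ : ℝ) : ℂ))
    (fun i => G ((i₀ : ℝ) + i)) (E := 2 * E) (D := D) (L := L)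
    (fun j hj => by
      rw [← Complex.ofReal_sum, Complex.norm_real, Real.norm_eq_abs, Finset.sum_sub_distrib,
        sum_Ioc_sub_eq h hi0, Finset.sum_const, Finset.card_range, nsmul_eq_mul]
      have e1 := hκ (i₀ - 1 + j) (by omega)
      have e2 := hκ (i₀ - 1) (by omega)
      push_cast at e1
      rw [abs_le] at e1 e2 ⊢
      constructor <;> linarith [e1.1, e1.2, e2.1, e2.2])
    (fun i hi => hD _ (hmem i (by omega)))
    (fun i hi => by
      refine (hG _ (hmem (i + 1) (by omega)) _ (hmem i (by omega))).trans_eq ?_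
      push_cast
      rw [show (i₀ : ℝ) + (i + 1) - (i₀ + i) = 1 by ring, abs_one, mul_one]) hD0 hL
  -- the Riemann sum
  have hsub : Set.Icc (i₀ : ℝ) (i₀ + n) ⊆ Set.Icc A (2 * A) := Set.Icc_subset_Icc a1 b1
  have k2 := norm_sum_sub_integral_le (G := G) (a := i₀) (n := n) hL
    fun x hx y hy => hG x (hsub hx) y (hsub hy)
  have hcont := continuousOn_of_norm_sub_le hG
  have hii : ∀ x ∈ Set.Icc A (2 * A), ∀ y ∈ Set.Icc A (2 * A), IntervalIntegrable G volume x y :=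
    fun x hx y hy => (hcont.mono (Set.uIcc_subset_Icc hx hy)).intervalIntegrable
  have mA : A ∈ Set.Icc A (2 * A) := ⟨le_rfl, by linarith⟩
  have mB : 2 * A ∈ Set.Icc A (2 * A) := ⟨by linarith, le_rfl⟩
  have m0 : (i₀ : ℝ) ∈ Set.Icc A (2 * A) := by simpa using hmem 0 (Nat.zero_le _)
  have m1 := hmem n le_rfl
  have k3 : ‖∫ x in A..(i₀ : ℝ), G x‖ ≤ D := by
    refine (intervalIntegral.norm_integral_le_of_norm_le_const (C := D) fun x hx => ?_).trans ?_
    · rw [Set.uIoc_of_le a1] at hx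
      exact hD x ⟨hx.1.le, hx.2.trans m0.2⟩
    · exact mul_le_of_le_one_right hD0 (by rw [abs_le]; constructor <;> linarith)
  have k4 : ‖∫ x in ((i₀ : ℝ) + n)..(2 * A), G x‖ ≤ D := by
    refine (intervalIntegral.norm_integral_le_of_norm_le_const (C := D) fun x hx => ?_).trans ?_
    · rw [Set.uIoc_of_le b1] at hx
      exact hD x ⟨m1.1.trans hx.1.le, hx.2⟩
    · exact mul_le_of_le_one_right hD0 (by rw [abs_le]; constructor <;> linarith)
  have k5 : ∫ x in A..(2 * A), G x = (∫ x in A..(i₀ : ℝ), G x) +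
      (∫ x in (i₀ : ℝ)..(i₀ + n), G x) + ∫ x in ((i₀ : ℝ) + n)..(2 * A), G x := by
    rw [intervalIntegral.integral_add_adjacent_intervals (hii _ mA _ m0) (hii _ m0 _ m1),
      intervalIntegral.integral_add_adjacent_intervals (hii _ mA _ m1) (hii _ m1 _ mB)]
  have k6 : ‖∑ i ∈ Finset.range (n + 1), G ((i₀ : ℝ) + i) - ∫ x in A..(2 * A), G x‖ ≤
      3 * D + n * L := by
    have e1 : ∑ i ∈ Finset.range (n + 1), G ((i₀ : ℝ) + i) - ∫ x in A..(2 * A), G x =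
        (∑ i ∈ Finset.range n, G ((i₀ : ℝ) + i) - ∫ x in (i₀ : ℝ)..(i₀ + n), G x) +
        G ((i₀ : ℝ) + n) - (∫ x in A..(i₀ : ℝ), G x) -
          ∫ x in ((i₀ : ℝ) + n)..(2 * A), G x := by
      rw [k5, Finset.sum_range_succ]; ring
    rw [e1]
    refine (norm_sub_le _ _).trans ?_
    have e2 := norm_sub_le ((∑ i ∈ Finset.range n, G ((i₀ : ℝ) + i) -
      ∫ x in (i₀ : ℝ)..(i₀ + n), G x) + G ((i₀ : ℝ) + n)) (∫ x in A..(i₀ : ℝ), G x)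
    have e3 := norm_add_le (∑ i ∈ Finset.range n, G ((i₀ : ℝ) + i) -
      ∫ x in (i₀ : ℝ)..(i₀ + n), G x) (G ((i₀ : ℝ) + n))
    linarith [hD _ m1]
  have hκE : |κ| ≤ 2 * E := by
    have hY1 : (1 : ℝ) ≤ Y := by
      have : 1 ≤ Y := by omega
      exact_mod_cast this
    have e1 := hκ Y le_rfl
    have e2 : |∑ c ∈ Finset.Ioc 0 Y, h c| ≤ Y := by
      rw [abs_of_nonneg (Finset.sum_nonneg fun c _ => (hh c).1)]
      refine (Finset.sum_le_sum fun c _ => (hh c).2).trans ?_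
      simp
    have e3 : |κ * Y| ≤ Y + E := by
      have := abs_sub_abs_le_abs_sub (κ * Y) (∑ c ∈ Finset.Ioc 0 Y, h c)
      rw [abs_sub_comm (κ * Y)] at this
      linarith
    rw [abs_mul, abs_of_nonneg (by linarith : (0 : ℝ) ≤ Y)] at e3
    have e4 : |κ| * Y ≤ 2 * E * Y := by nlinarith
    exact le_of_mul_le_mul_right e4 (by linarith)
  have k7 : ∑ i ∈ Finset.range (n + 1), (h (i₀ + i) : ℂ) * G ((i₀ + i : ℕ) : ℝ) -
      κ * ∫ x in A..(2 * A), G x =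
      ∑ i ∈ Finset.range (n + 1), ((h (i₀ + i) - κ : ℝ) : ℂ) * G ((i₀ : ℝ) + i) +
        κ * (∑ i ∈ Finset.range (n + 1), G ((i₀ : ℝ) + i) - ∫ x in A..(2 * A), G x) := by
    rw [mul_sub, Finset.mul_sum, ← add_sub_assoc, ← Finset.sum_add_distrib]
    congr 1
    refine Finset.sum_congr rfl fun i _ => ?_
    push_cast; ring
  rw [k7]
  refine (norm_add_le _ _).trans ?_
  rw [norm_mul, Complex.norm_real, Real.norm_eq_abs]
  push_cast at k1
  have k8 : |κ| * ‖∑ i ∈ Finset.range (n + 1), G ((i₀ : ℝ) + i) - ∫ x in A..(2 * A), G x‖ ≤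
      2 * E * (3 * D + n * L) := by gcongr
  have k9 : (n : ℝ) * L ≤ 2 * A * L := by gcongr; linarith
  have k10 : ((n : ℝ) + 1) * L ≤ 2 * A * L := by gcongr
  push_cast
  have hE0 : 0 ≤ E := by linarith
  calc _ ≤ 2 * E * (D + ((n : ℝ) + 1) * L) + 2 * E * (3 * D + n * L) := add_le_add k1 k8
    _ ≤ 2 * E * (D + 2 * A * L) + 2 * E * (3 * D + 2 * A * L) := by gcongr
    _ ≤ _ := by
      have : 0 ≤ E * (2 * A * L) := by positivity
      nlinarith

end RoughWeight

/-! ### Equidistribution of the moduli -/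

section Moduli
variable {Δ N : ℝ}

lemma coprime_primorial_iff {c z : ℕ} :
    Nat.Coprime c (primorial z) ↔ ∀ p : ℕ, p.Prime → p ∣ c → z < p := by
  constructor
  · intro h p hp hpc
    by_contra hz
    have h1 : p ∣ primorial z := hp.dvd_primorial_iff.2 (not_lt.1 hz)
    exact hp.one_lt.ne' (Nat.dvd_one.1 (h ▸ Nat.dvd_gcd hpc h1))
  · intro h
    refine Nat.Coprime.symm (Nat.coprime_of_dvd fun p hp h1 h2 => ?_)
    exact absurd (hp.dvd_primorial_iff.1 h1) (not_le.2 (h p hp h2))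

/-- The product of the primes that are excluded as prime factors of the moduli. -/
noncomputable def sieveProduct (Δ : ℝ) : ℕ := primorial ⌊Δ ^ 2001⌋₊

lemma sieveProduct_pos (Δ : ℝ) : 0 < sieveProduct Δ := primorial_pos _

lemma coprime_sieveProduct_iff (hΔ : 0 ≤ Δ) {c : ℕ} :
    Nat.Coprime c (sieveProduct Δ) ↔ ∀ p : ℕ, p.Prime → p ∣ c → Δ ^ 2001 < (p : ℝ) := by
  rw [sieveProduct, coprime_primorial_iff]
  simp only [Nat.floor_lt (pow_nonneg hΔ 2001)]

/-- The second factors that complete a given first factor to a modulus. -/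
lemma mem_moduli_iff (hΔ : 0 ≤ Δ) {b : ℕ} (hb : 0 < b)
    (hb1 : (Δ * √N) ^ (1 / 1000 : ℝ) ≤ b) (hb2 : (b : ℝ) ≤ 2 * (Δ * √N) ^ (1 / 1000 : ℝ))
    (hp : Nat.Coprime b (sieveProduct Δ)) (hsb : Squarefree b) (c : ℕ) :
    (b, c) ∈ moduli Δ N ↔
      c ∈ Finset.Icc ⌈Δ * √N / b⌉₊ ⌊2 * (Δ * √N / b)⌋₊ ∧
        (Squarefree c ∧ Nat.Coprime c (b * sieveProduct Δ)) := by
  have hbR : (0 : ℝ) < b := by exact_mod_cast hb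
  have hQ : 0 ≤ Δ * √N := by positivity
  have hp' := (coprime_sieveProduct_iff hΔ).1 hp
  rw [mem_moduli, Finset.mem_Icc, Nat.ceil_le, Nat.le_floor_iff (by positivity),
    Nat.coprime_mul_iff_right, coprime_sieveProduct_iff hΔ, Nat.squarefree_mul_iff,
    div_le_iff₀ hbR, ← mul_div_assoc, le_div_iff₀ hbR]
  push_cast
  constructor
  · rintro ⟨-, hc, h1, h2, -, -, h3, h4, -, h5⟩
    exact ⟨⟨by linarith, by linarith⟩, h5, h4.symm, fun p hp' hpc => h3 p hp' (hpc.mul_left _)⟩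
  · rintro ⟨⟨h1, h2⟩, h5, h4, h3⟩
    refine ⟨hb, Nat.pos_of_ne_zero h5.ne_zero, by linarith, by linarith, hb1, hb2, ?_, h4.symm,
      hsb, h5⟩
    intro p hpp hpbc
    rcases (Nat.Prime.dvd_mul hpp).1 hpbc with h | h
    · exact hp' p hpp h
    · exact h3 p hpp h

/-- The possible small factors of the moduli. -/
noncomputable def smallFactors (Δ N : ℝ) : Finset ℕ := (moduli Δ N).image Prod.fst

lemma mem_smallFactors (hΔ : 0 ≤ Δ) {b : ℕ} (hb : b ∈ smallFactors Δ N) :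
    0 < b ∧ (Δ * √N) ^ (1 / 1000 : ℝ) ≤ b ∧ (b : ℝ) ≤ 2 * (Δ * √N) ^ (1 / 1000 : ℝ) ∧
      Nat.Coprime b (sieveProduct Δ) ∧ Squarefree b := by
  rw [smallFactors, Finset.mem_image] at hb
  obtain ⟨⟨b, c⟩, h, rfl⟩ := hb
  rw [mem_moduli] at h
  obtain ⟨hb, -, -, -, hb1, hb2, hp, hsq⟩ := h
  exact ⟨hb, hb1, hb2,
    (coprime_sieveProduct_iff hΔ).2 fun p hp' hpb => hp p hp' (hpb.mul_right _),
    hsq.squarefree_of_dvd (dvd_mul_right _ _)⟩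

lemma card_smallFactors_le (hQ : 0 ≤ Δ * √N) :
    ((smallFactors Δ N).card : ℝ) ≤ 2 * (Δ * √N) ^ (1 / 1000 : ℝ) := by
  have h1 : smallFactors Δ N ⊆ Finset.Icc 1 ⌊2 * (Δ * √N) ^ (1 / 1000 : ℝ)⌋₊ := by
    intro b hb
    rw [smallFactors, Finset.mem_image] at hb
    obtain ⟨⟨b, c⟩, h, rfl⟩ := hb
    rw [mem_moduli] at h
    exact Finset.mem_Icc.2 ⟨h.1, Nat.le_floor h.2.2.2.2.2.1⟩
  have h2 := Finset.card_le_card h1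
  rw [Nat.card_Icc, Nat.add_sub_cancel] at h2
  refine le_trans (by exact_mod_cast h2) (Nat.floor_le (by positivity))

lemma sum_moduli_eq (hΔ : 0 ≤ Δ) (f : ℝ → ℂ) :
    ∑ m ∈ moduli Δ N, ((m.1 * m.2).totient : ℂ) * f (((m.1 * m.2 : ℕ) : ℝ) / √N) =
      ∑ b ∈ smallFactors Δ N, (b.totient : ℂ) *
        ∑ c ∈ Finset.Icc ⌈Δ * √N / b⌉₊ ⌊2 * (Δ * √N / b)⌋₊,
          (roughWeight (b * sieveProduct Δ) c : ℂ) * ((c : ℝ) * f (b * (c : ℝ) / √N)) := by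
  rw [← Finset.sum_fiberwise_of_maps_to (s := moduli Δ N) (t := smallFactors Δ N)
    (g := Prod.fst) fun m hm => Finset.mem_image_of_mem _ hm]
  refine Finset.sum_congr rfl fun b hb => ?_
  obtain ⟨h0, h1, h2, h3, h4⟩ := mem_smallFactors hΔ hb
  have h := mem_moduli_iff hΔ h0 h1 h2 h3 h4
  have hpt : ∀ c : ℕ, (roughWeight (b * sieveProduct Δ) c : ℂ) * ((c : ℝ) * f (b * (c : ℝ) / √N)) =
      if Squarefree c ∧ Nat.Coprime c (b * sieveProduct Δ) then
        (c.totient : ℂ) * f (b * (c : ℝ) / √N) else 0 := by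
    intro c
    rw [roughWeight]
    split_ifs with hc
    · have : (c : ℂ) ≠ 0 := by exact_mod_cast hc.1.ne_zero
      push_cast
      field_simp
    · simp
  simp_rw [hpt]
  rw [← Finset.sum_filter, Finset.mul_sum]
  refine Finset.sum_bij' (fun m _ => m.2) (fun c _ => (b, c)) ?_ ?_ ?_ ?_ ?_
  · rintro ⟨b', c⟩ hm
    rw [Finset.mem_filter] at hm
    obtain ⟨hm1, rfl⟩ := hm
    exact Finset.mem_filter.2 ((h c).1 hm1)
  · intro c hc
    exact Finset.mem_filter.2 ⟨(h c).2 (Finset.mem_filter.1 hc), rfl⟩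
  · rintro ⟨b', c⟩ hm
    rw [Finset.mem_filter] at hm
    obtain ⟨-, rfl⟩ := hm
    rfl
  · intro c _; rfl
  · rintro ⟨b', c⟩ hm
    rw [Finset.mem_filter] at hm
    obtain ⟨hm1, rfl⟩ := hm
    rw [mem_moduli] at hm1
    simp only
    rw [Nat.totient_mul (Nat.coprime_of_squarefree_mul hm1.2.2.2.2.2.2.2)]
    push_cast; ring

/-- The moduli are equidistributed, with density proportional to `v dv` in the variable
`v = q/√N`. -/
lemma exists_norm_sum_moduli_sub_le (hΔ : 1 ≤ Δ) (hN : 0 < N) {E : ℝ} (hE : 1 ≤ E)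
    (hEb : ∀ b ∈ smallFactors Δ N, (b : ℝ) ≤ Δ * √N ∧
      roughError (b * sieveProduct Δ) ⌊2 * (Δ * √N)⌋₊ ≤ E) :
    ∃ K : ℝ, ∀ (f : ℝ → ℂ) (D : ℝ), (∀ v ∈ Set.Icc Δ (2 * Δ), ‖f v‖ ≤ D ∧
        ∀ v' ∈ Set.Icc Δ (2 * Δ), ‖f v - f v'‖ ≤ D * |v - v'|) →
      ‖∑ m ∈ moduli Δ N, ((m.1 * m.2).totient : ℂ) * f (((m.1 * m.2 : ℕ) : ℝ) / √N) -
        K * ∫ v in Δ..(2 * Δ), v * f v‖ ≤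
        (smallFactors Δ N).card * (64 * E * (Δ * √N) * Δ) * D := by
  have hs : 0 < √N := Real.sqrt_pos.2 hN
  have hΔ0 : 0 < Δ := by linarith
  set Q := Δ * √N with hQ
  have hQ0 : 0 < Q := by positivity
  set P := sieveProduct Δ
  have hb0 : ∀ b ∈ smallFactors Δ N, 0 < b := fun b hb => (mem_smallFactors hΔ0.le hb).1
  have hκ : ∀ b, ∃ κ : ℝ, b ∈ smallFactors Δ N → ∀ t ≤ ⌊2 * Q⌋₊,
      |∑ c ∈ Finset.Ioc 0 t, roughWeight (b * P) c - κ * t| ≤ E := by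
    intro b
    by_cases hb : b ∈ smallFactors Δ N
    · obtain ⟨κ, h⟩ := exists_density_roughWeight
        (mul_ne_zero (hb0 b hb).ne' (sieveProduct_pos Δ).ne') ⌊2 * Q⌋₊
      exact ⟨κ, fun _ t ht => (h t ht).trans (hEb b hb).2⟩
    · exact ⟨0, fun h => absurd h hb⟩
  choose κ hκ using hκ
  refine ⟨∑ b ∈ smallFactors Δ N, b.totient * κ b * (√N / b) ^ 2, fun f D hf => ?_⟩
  have hD0 : 0 ≤ D := (norm_nonneg _).trans (hf Δ ⟨le_rfl, by linarith⟩).1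
  rw [sum_moduli_eq hΔ0.le]
  push_cast
  rw [Finset.sum_mul, ← Finset.sum_sub_distrib]
  refine (norm_sum_le_of_le (n := fun _ => 64 * E * Q * Δ * D) _ fun b hb => ?_).trans ?_
  · have hbR : (0 : ℝ) < b := by exact_mod_cast hb0 b hb
    set A := Q / b with hA
    have hA1 : 1 ≤ A := by
      rw [hA, one_le_div hbR]; exact (hEb b hb).1
    have hA0 : 0 < A := by linarith
    have hAQ : A ≤ Q := div_le_self hQ0.le (by exact_mod_cast hb0 b hb)
    have hAY : 2 * A < (⌊2 * Q⌋₊ : ℝ) + 1 :=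
      lt_of_le_of_lt (by linarith) (Nat.lt_floor_add_one (2 * Q))
    set r := (b : ℝ) / √N with hr
    have hr0 : 0 < r := by positivity
    have hrA : r * A = Δ := by
      rw [hr, hA, hQ]; field_simp
    have hmap : ∀ x ∈ Set.Icc A (2 * A), r * x ∈ Set.Icc Δ (2 * Δ) := by
      intro x hx
      have h1 : r * A ≤ r * x := by gcongr; exact hx.1
      have h2 : r * x ≤ r * (2 * A) := by gcongr; exact hx.2
      constructor <;> nlinarith
    have key := norm_sum_mul_sub_integral_le (h := roughWeight (b * P)) (κ := κ b) (E := E)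
      (Y := ⌊2 * Q⌋₊) (fun c => ⟨roughWeight_nonneg _ c, roughWeight_le_one _ c⟩) hE (hκ b hb)
      hA1 hAY (G := fun x => (x : ℂ) * f (r * x)) (D := 2 * A * D) (L := D * (1 + 2 * Δ))
      (by positivity)
      (fun x hx => by
        rw [norm_mul, Complex.norm_real, Real.norm_of_nonneg (hA0.le.trans hx.1)]
        have := (hf _ (hmap x hx)).1
        have := hx.2
        have : 0 ≤ x := hA0.le.trans hx.1
        gcongr)
      (fun x hx y hy => by
        have e1 : (x : ℂ) * f (r * x) - y * f (r * y) =
            ((x - y : ℝ) : ℂ) * f (r * x) + (y : ℂ) * (f (r * x) - f (r * y)) := by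
          push_cast; ring
        have e2 := (hf _ (hmap x hx)).1
        have e3 := (hf _ (hmap x hx)).2 _ (hmap y hy)
        rw [← mul_sub, abs_mul, abs_of_pos hr0] at e3
        have hy0 : 0 ≤ y := hA0.le.trans hy.1
        rw [e1]
        refine (norm_add_le _ _).trans ?_
        rw [norm_mul, norm_mul, Complex.norm_real, Complex.norm_real, Real.norm_eq_abs,
          Real.norm_of_nonneg hy0]
        calc |x - y| * ‖f (r * x)‖ + y * ‖f (r * x) - f (r * y)‖
            ≤ |x - y| * D + (2 * A) * (D * (r * |x - y|)) := by
              have := hy.2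
              gcongr
          _ = D * (1 + 2 * (r * A)) * |x - y| := by ring
          _ = _ := by rw [hrA])
    have hint : ∫ x in A..(2 * A), (x : ℂ) * f (r * x) =
        ((√N / b) ^ 2 : ℝ) * ∫ v in Δ..(2 * Δ), v * f v := by
      have e1 := intervalIntegral.integral_comp_mul_left (a := A) (b := 2 * A)
        (fun v : ℝ => (v : ℂ) * f v) hr0.ne'
      have e2 : r * (2 * A) = 2 * Δ := by rw [← hrA]; ring
      rw [hrA, e2] at e1
      have e3 : ∫ x in A..(2 * A), (x : ℂ) * f (r * x) =
          (r⁻¹ : ℝ) * ∫ x in A..(2 * A), ((r * x : ℝ) : ℂ) * f (r * x) := by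
        rw [← intervalIntegral.integral_const_mul]
        refine intervalIntegral.integral_congr fun x _ => ?_
        have : (r : ℂ) ≠ 0 := by exact_mod_cast hr0.ne'
        push_cast
        field_simp
      rw [e3, e1, Complex.real_smul, ← mul_assoc]
      congr 1
      have : √N / b = r⁻¹ := by rw [hr, inv_div]
      rw [this]; push_cast; ring
    rw [hint] at key
    have hlhs : (b.totient : ℂ) * ∑ c ∈ Finset.Icc ⌈A⌉₊ ⌊2 * A⌋₊,
          (roughWeight (b * P) c : ℂ) * ((c : ℝ) * f (b * (c : ℝ) / √N)) -
        b.totient * κ b * ((√N : ℂ) / b) ^ 2 * ∫ v in Δ..(2 * Δ), v * f v =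
        b.totient * (∑ c ∈ Finset.Icc ⌈A⌉₊ ⌊2 * A⌋₊,
          (roughWeight (b * P) c : ℂ) * ((c : ℝ) * f (r * (c : ℝ))) -
        κ b * (((√N / b) ^ 2 : ℝ) * ∫ v in Δ..(2 * Δ), v * f v)) := by
      have : ∀ c : ℕ, (b : ℝ) * (c : ℝ) / √N = r * c := fun c => by rw [hr]; ring
      simp_rw [this]
      push_cast; ring
    push_cast at hlhs
    rw [hlhs, norm_mul, Complex.norm_natCast]
    push_cast at key
    have ht : (b.totient : ℝ) ≤ b := by exact_mod_cast Nat.totient_le b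
    have hbA : (b : ℝ) * A = Q := by rw [hA]; field_simp
    calc _ ≤ (b : ℝ) * (8 * E * (2 * A * D + 2 * A * (D * (1 + 2 * Δ)))) := by gcongr
      _ = 32 * E * (b * A) * (1 + Δ) * D := by ring
      _ ≤ 32 * E * (b * A) * (2 * Δ) * D := by
        have : 0 ≤ E := by linarith
        gcongr; linarith
      _ = _ := by rw [hbA]; ring
  · rw [Finset.sum_const, nsmul_eq_mul]
    exact le_of_eq (by ring)

/-- Equidistribution of the moduli in terms of a lower bound for the normalization. -/
lemma norm_average_moduli_sub_le (hΔ : 1 ≤ Δ) (hN : 0 < N) {E : ℝ} (hE : 1 ≤ E)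
    (hEb : ∀ b ∈ smallFactors Δ N, (b : ℝ) ≤ Δ * √N ∧
      roughError (b * sieveProduct Δ) ⌊2 * (Δ * √N)⌋₊ ≤ E) (hL : 0 < totientSum Δ N)
    {f : ℝ → ℂ} {D : ℝ} (hf : ∀ v ∈ Set.Icc Δ (2 * Δ), ‖f v‖ ≤ D ∧
        ∀ v' ∈ Set.Icc Δ (2 * Δ), ‖f v - f v'‖ ≤ D * |v - v'|) :
    ‖((totientSum Δ N)⁻¹ : ℝ) * ∑ m ∈ moduli Δ N,
        ((m.1 * m.2).totient : ℂ) * f (((m.1 * m.2 : ℕ) : ℝ) / √N) -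
      (2 / (3 * Δ ^ 2) : ℝ) * ∫ v in Δ..(2 * Δ), v * f v‖ ≤
      3 * ((smallFactors Δ N).card * (64 * E * (Δ * √N) * Δ)) / totientSum Δ N * D := by
  obtain ⟨K, hK⟩ := exists_norm_sum_moduli_sub_le hΔ hN hE hEb
  have hΔ0 : 0 < Δ := by linarith
  have hD0 : 0 ≤ D := (norm_nonneg _).trans (hf Δ ⟨le_rfl, by linarith⟩).1
  set R := ((smallFactors Δ N).card : ℝ) * (64 * E * (Δ * √N) * Δ) with hR
  have hR0 : 0 ≤ R := by positivity
  set L := totientSum Δ N with hLdef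
  have h1 := hK f D hf
  -- the constant function `1` relates the density `K` to the normalization `L`
  have h2 := hK (fun _ => 1) 1 fun v _ => ⟨by simp, fun v' _ => by simp⟩
  have h3 : ∫ v in Δ..(2 * Δ), (v : ℂ) * 1 = ((3 / 2 * Δ ^ 2 : ℝ) : ℂ) := by
    simp_rw [mul_one]
    rw [intervalIntegral.integral_ofReal, integral_id]
    congr 1; ring
  have h4 : ∑ m ∈ moduli Δ N, ((m.1 * m.2).totient : ℂ) * 1 = (L : ℂ) := by
    rw [hLdef, totientSum]; push_cast; simp
  rw [h3, h4, ← Complex.ofReal_mul, ← Complex.ofReal_sub, Complex.norm_real, Real.norm_eq_abs,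
    mul_one] at h2
  set S := ∑ m ∈ moduli Δ N, ((m.1 * m.2).totient : ℂ) * f (((m.1 * m.2 : ℕ) : ℝ) / √N)
  set I := ∫ v in Δ..(2 * Δ), (v : ℂ) * f v with hI
  have h5 : ‖I‖ ≤ 2 * Δ ^ 2 * D := by
    refine (intervalIntegral.norm_integral_le_of_norm_le_const (C := 2 * Δ * D)
      fun v hv => ?_).trans ?_
    · rw [Set.uIoc_of_le (by linarith)] at hv
      rw [norm_mul, Complex.norm_real, Real.norm_of_nonneg (by linarith [hv.1])]
      have := (hf v ⟨hv.1.le, hv.2⟩).1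
      have := hv.2
      gcongr
    · rw [show 2 * Δ - Δ = Δ by ring, abs_of_pos hΔ0]
      exact le_of_eq (by ring)
  have h6 : ((L⁻¹ : ℝ) : ℂ) * S - (2 / (3 * Δ ^ 2) : ℝ) * I =
      ((L⁻¹ : ℝ) : ℂ) * (S - K * I) -
        ((L⁻¹ * (2 / (3 * Δ ^ 2)) * (L - K * (3 / 2 * Δ ^ 2)) : ℝ) : ℂ) * I := by
    have hL' : (L : ℂ) ≠ 0 := by exact_mod_cast hL.ne'
    have hΔ' : (Δ : ℂ) ≠ 0 := by exact_mod_cast hΔ0.ne'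
    push_cast
    field_simp
    ring
  rw [h6]
  refine (norm_sub_le _ _).trans ?_
  rw [norm_mul, norm_mul, Complex.norm_real, Complex.norm_real, Real.norm_eq_abs, Real.norm_eq_abs,
    abs_mul, abs_mul, abs_of_pos (inv_pos.2 hL), abs_of_pos (by positivity : 0 < 2 / (3 * Δ ^ 2))]
  calc L⁻¹ * ‖S - K * I‖ + L⁻¹ * (2 / (3 * Δ ^ 2)) * |L - K * (3 / 2 * Δ ^ 2)| * ‖I‖
      ≤ L⁻¹ * (R * D) + L⁻¹ * (2 / (3 * Δ ^ 2)) * R * (2 * Δ ^ 2 * D) := by gcongr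
    _ = 7 / 3 * (R / L * D) := by field_simp; ring
    _ ≤ 3 * (R / L * D) := by gcongr; norm_num
    _ = _ := by ring

end Moduli

/-! ### Sizes -/

section Sizes

/-- `K^ω(n)` grows more slowly than any power of `n`. -/
lemma pow_card_primeFactors_le {K : ℝ} (hK : 1 ≤ K) {ε : ℝ} (hε : 0 < ε) {n : ℕ} (hn : n ≠ 0) :
    K ^ n.primeFactors.card ≤ K ^ ⌈K ^ (1 / ε)⌉₊ * (n : ℝ) ^ ε := by
  set B := ⌈K ^ (1 / ε)⌉₊ with hB
  have hK0 : 0 ≤ K := by linarith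
  have h1 : ∀ p ∈ n.primeFactors, K ≤ (if p < B then K else 1) * (p : ℝ) ^ ε := by
    intro p hp
    have hp1 : (1 : ℝ) ≤ p := by exact_mod_cast (Nat.prime_of_mem_primeFactors hp).one_lt.le
    split_ifs with h
    · exact le_mul_of_one_le_right hK0 (Real.one_le_rpow hp1 hε.le)
    · rw [one_mul]
      have h2 : K ^ (1 / ε) ≤ p := (Nat.le_ceil _).trans (by exact_mod_cast not_lt.1 h)
      calc K = (K ^ (1 / ε)) ^ ε := by
            rw [← Real.rpow_mul hK0, one_div_mul_cancel hε.ne', Real.rpow_one]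
        _ ≤ _ := Real.rpow_le_rpow (by positivity) h2 hε.le
  calc K ^ n.primeFactors.card = ∏ _p ∈ n.primeFactors, K := by rw [Finset.prod_const]
    _ ≤ ∏ p ∈ n.primeFactors, ((if p < B then K else 1) * (p : ℝ) ^ ε) :=
        Finset.prod_le_prod (fun _ _ => hK0) h1
    _ = K ^ (n.primeFactors.filter fun p => p < B).card *
          ((∏ p ∈ n.primeFactors, p : ℕ) : ℝ) ^ ε := by
        rw [Finset.prod_mul_distrib, Finset.prod_ite, Finset.prod_const, Finset.prod_const_one,
          mul_one, Real.finsetProd_rpow _ _ fun p _ => by positivity]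
        push_cast; rfl
    _ ≤ _ := by
        gcongr
        · refine (Finset.card_le_card (t := Finset.range B) fun p hp => ?_).trans_eq
            (Finset.card_range B)
          exact Finset.mem_range.2 (Finset.mem_filter.1 hp).2
        · exact Nat.le_of_dvd (Nat.pos_of_ne_zero hn) (Nat.prod_primeFactors_dvd n)

lemma mul_pow_le_pow {T c : ℝ} (hT : 1 ≤ T) (hc : c ≤ T) {m n : ℕ} (h : m < n) :
    c * T ^ m ≤ T ^ n := by
  calc c * T ^ m ≤ T * T ^ m := by gcongr
    _ = T ^ (m + 1) := by rw [pow_succ, mul_comm]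
    _ ≤ T ^ n := pow_le_pow_right₀ hT h

/-- The sizes of the parameters in terms of `T = N^(1/2000)`. Note that `log N > 10^2001`, so that
`T` exceeds every numerical constant that occurs. -/
structure Scale (Δ N T : ℝ) : Prop where
  large : 10 ^ 50 ≤ T
  N_eq : N = T ^ 2000
  sqrt_eq : √N = T ^ 1000
  one_le : 1 ≤ Δ
  Δ_le : Δ ≤ T
  pow_le : Δ ^ 2001 ≤ T
  pow_le_log : Δ ^ 2001 ≤ Real.log N
  log_le : Real.log N ≤ T
  two_pow_le : ∀ B : ℕ, (B : ℝ) ≤ 10 ^ 40 → (2 : ℝ) ^ B ≤ T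

variable {Δ N : ℝ}

lemma Scale.of_lt_log (hΔ : 10 < Δ) (hN : 10 < N) (h : Δ ^ 2001 < Real.log N) :
    Scale Δ N (N ^ (1 / 2000 : ℝ)) := by
  have hN0 : 0 < N := by linarith
  set l := Real.log N with hl
  obtain ⟨T, hT⟩ : ∃ T, T = N ^ (1 / 2000 : ℝ) := ⟨_, rfl⟩
  rw [← hT]
  have hΔ1 : 1 ≤ Δ := by linarith
  have h50 : (10 : ℝ) ^ 50 ≤ l := by
    calc (10 : ℝ) ^ 50 ≤ Δ ^ 50 := by gcongr
      _ ≤ Δ ^ 2001 := pow_le_pow_right₀ hΔ1 (by norm_num)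
      _ ≤ l := h.le
  have hTe : T = Real.exp (l / 2000) := by
    rw [hT, Real.rpow_def_of_pos hN0]; congr 1; ring
  have hlT : l ≤ T := by
    have h1 := Real.quadratic_le_exp_of_nonneg (x := l / 2000) (by linarith)
    rw [← hTe] at h1
    nlinarith
  have hT0 : 0 ≤ T := by linarith
  have hNT : N = T ^ 2000 := by
    rw [hT, ← Real.rpow_mul_natCast hN0.le]
    norm_num
  refine ⟨h50.trans hlT, hNT, ?_, hΔ1, ?_, h.le.trans hlT, h.le, hlT, fun B hB => ?_⟩
  · have h1 : T ^ 2000 = (T ^ 1000) ^ 2 := by ring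
    rw [hNT, h1, Real.sqrt_sq (pow_nonneg hT0 _)]
  · exact (le_self_pow₀ hΔ1 (by norm_num)).trans (h.le.trans hlT)
  · calc (2 : ℝ) ^ B ≤ Real.exp 1 ^ B := by
          gcongr
          have := Real.add_one_le_exp (1 : ℝ)
          linarith
      _ = Real.exp B := by rw [← Real.exp_nat_mul, mul_one]
      _ ≤ T := by
          rw [hTe, Real.exp_le_exp]
          linarith

variable {T : ℝ}

lemma Scale.one_le_T (hs : Scale Δ N T) : 1 ≤ T := le_trans (by norm_num) hs.large

lemma Scale.N_pos (hs : Scale Δ N T) : 0 < N := by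
  have := hs.one_le_T
  rw [hs.N_eq]; positivity

lemma Scale.Q_bounds (hs : Scale Δ N T) : T ^ 1000 ≤ Δ * √N ∧ Δ * √N ≤ T ^ 1001 := by
  have hT := hs.one_le_T
  have hΔ := hs.one_le
  rw [hs.sqrt_eq]
  constructor
  · exact le_mul_of_one_le_left (by positivity) hΔ
  · calc Δ * T ^ 1000 ≤ T * T ^ 1000 := by gcongr; exact hs.Δ_le
      _ = T ^ 1001 := by ring

lemma Scale.Q_rpow_bounds (hs : Scale Δ N T) :
    T ≤ (Δ * √N) ^ (1 / 1000 : ℝ) ∧ (Δ * √N) ^ (1 / 1000 : ℝ) ≤ T ^ 2 := by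
  have hT := hs.one_le_T
  have hT0 : 0 ≤ T := by linarith
  obtain ⟨h1, h2⟩ := hs.Q_bounds
  constructor
  · calc T = (T ^ 1000) ^ (1 / 1000 : ℝ) := by
          rw [← Real.rpow_natCast_mul hT0]; norm_num
      _ ≤ _ := by gcongr
  · calc (Δ * √N) ^ (1 / 1000 : ℝ) ≤ (T ^ 2000) ^ (1 / 1000 : ℝ) := by
          refine Real.rpow_le_rpow ((by positivity : 0 ≤ T ^ 1000).trans h1) ?_ (by norm_num)
          exact h2.trans (pow_le_pow_right₀ hT (by norm_num : 1001 ≤ 2000))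
      _ = T ^ 2 := by
          rw [← Real.rpow_natCast_mul hT0]; norm_num

lemma Scale.card_divisors_le (hs : Scale Δ N T) {b : ℕ} (hb : (b : ℝ) ≤ 2 * T ^ 2)
    (hbP : Nat.Coprime b (sieveProduct Δ)) (hbs : Squarefree b) :
    ((b * sieveProduct Δ).divisors.card : ℝ) ≤ T ^ 42 := by
  have hT := hs.one_le_T
  have hT0 : 0 ≤ T := by linarith
  have hlarge := hs.large
  set P := sieveProduct Δ with hP
  have hsq : Squarefree (b * P) :=
    Nat.squarefree_mul_iff.2 ⟨hbP, hbs, squarefree_primorial _⟩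
  rw [card_divisors_of_squarefree hsq]
  obtain ⟨B, hB, h1⟩ : ∃ B : ℕ, (B : ℝ) ≤ 10 ^ 40 ∧ (2 : ℝ) ^ (b * P).primeFactors.card ≤
      2 ^ B * ((b * P : ℕ) : ℝ) ^ (1 / 100 : ℝ) := by
    refine ⟨_, ?_, pow_card_primeFactors_le (by norm_num) (by norm_num) hsq.ne_zero⟩
    have h3 : (2 : ℝ) ^ (1 / (1 / 100) : ℝ) = 2 ^ 100 := by
      rw [← Real.rpow_natCast]; norm_num
    rw [h3]
    exact (Nat.ceil_lt_add_one (by positivity)).le.trans (by norm_num)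
  have h2 := hs.two_pow_le B hB
  have h3 : (P : ℝ) ≤ T ^ 4000 := by
    obtain ⟨z, hz⟩ : ∃ z : ℕ, z = ⌊Δ ^ 2001⌋₊ := ⟨_, rfl⟩
    have e1 : (P : ℝ) ≤ 4 ^ z := by
      rw [hP, sieveProduct, ← hz]
      exact_mod_cast primorial_le_four_pow z
    have e2 : (z : ℝ) ≤ Real.log N := by
      rw [hz]
      exact (Nat.floor_le (pow_nonneg (by linarith [hs.one_le]) _)).trans hs.pow_le_log
    have e3 : (4 : ℝ) ≤ Real.exp 1 ^ 2 := by
      have := Real.add_one_le_exp (1 : ℝ)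
      nlinarith
    have e4 : (Real.exp 1 ^ 2) ^ z = Real.exp z ^ 2 := by
      rw [pow_right_comm, ← Real.exp_nat_mul, mul_one]
    calc (P : ℝ) ≤ 4 ^ z := e1
      _ ≤ (Real.exp 1 ^ 2) ^ z := by gcongr
      _ ≤ Real.exp (Real.log N) ^ 2 := by rw [e4]; gcongr
      _ = (T ^ 2000) ^ 2 := by rw [Real.exp_log hs.N_pos, hs.N_eq]
      _ = T ^ 4000 := by ring
  have h5 : ((b * P : ℕ) : ℝ) ^ (1 / 100 : ℝ) ≤ T ^ 41 := by
    have e1 : ((b * P : ℕ) : ℝ) ≤ T ^ 4100 := by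
      push_cast
      calc (b : ℝ) * P ≤ (2 * T ^ 2) * T ^ 4000 := by gcongr
        _ = 2 * T ^ 4002 := by ring
        _ ≤ _ := mul_pow_le_pow hT (by linarith) (by norm_num)
    calc ((b * P : ℕ) : ℝ) ^ (1 / 100 : ℝ) ≤ (T ^ 4100) ^ (1 / 100 : ℝ) := by gcongr
      _ = T ^ 41 := by
        rw [← Real.rpow_natCast_mul hT0]; norm_num
  push_cast
  calc (2 : ℝ) ^ (b * P).primeFactors.card
      ≤ 2 ^ B * ((b * P : ℕ) : ℝ) ^ (1 / 100 : ℝ) := h1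
    _ ≤ T * T ^ 41 := by gcongr
    _ = T ^ 42 := by ring

lemma Scale.roughError_le (hs : Scale Δ N T) {b : ℕ} (hb : (b : ℝ) ≤ 2 * T ^ 2)
    (hbP : Nat.Coprime b (sieveProduct Δ)) (hbs : Squarefree b) :
    roughError (b * sieveProduct Δ) ⌊2 * (Δ * √N)⌋₊ ≤ T ^ 545 := by
  have hT := hs.one_le_T
  have hT0 : 0 ≤ T := by linarith
  have hlarge := hs.large
  obtain ⟨hQ1, hQ2⟩ := hs.Q_bounds
  have h1 : (1 : ℝ) ≤ T ^ 1000 := one_le_pow₀ hT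
  obtain ⟨Y, hY⟩ : ∃ Y, Y = ⌊2 * (Δ * √N)⌋₊ := ⟨_, rfl⟩
  rw [← hY]
  have hY1 : (Y : ℝ) ≤ T ^ 1002 := by
    rw [hY]
    refine (Nat.floor_le (by linarith)).trans ?_
    calc 2 * (Δ * √N) ≤ 2 * T ^ 1001 := by gcongr
      _ ≤ _ := mul_pow_le_pow hT (by linarith) (by norm_num)
  have hY0 : 0 < Y := by
    rw [hY]; exact Nat.floor_pos.2 (by linarith)
  have hlog : Real.log Y ≤ T := by
    refine le_trans (Real.log_le_log (by exact_mod_cast hY0) (hY1.trans ?_)) hs.log_le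
    rw [hs.N_eq]
    exact pow_le_pow_right₀ hT (by norm_num)
  have hsq : √(Y : ℝ) ≤ T ^ 501 := by
    rw [Real.sqrt_le_left (by positivity)]
    exact hY1.trans_eq (by ring)
  have hd := hs.card_divisors_le hb hbP hbs
  rw [roughError]
  calc (1 + Real.log Y) * √Y * (b * sieveProduct Δ).divisors.card
      ≤ (T + T) * T ^ 501 * T ^ 42 := by gcongr
    _ = 2 * T ^ 544 := by ring
    _ ≤ _ := mul_pow_le_pow hT (by linarith) (by norm_num)

/-- A regular summatory function that is large at `2A` is large on `[A, 2A]`. -/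
lemma sum_dyadic_ge {h : ℕ → ℝ} {κ E : ℝ} {Y : ℕ}
    (hκ : ∀ t ≤ Y, |∑ c ∈ Finset.Ioc 0 t, h c - κ * t| ≤ E)
    {A : ℝ} (hA : 2 ≤ A) (hAY : 2 * A < Y + 1) (hE : 0 ≤ E)
    (hH : E ≤ ∑ c ∈ Finset.Ioc 0 ⌊2 * A⌋₊, h c) :
    (∑ c ∈ Finset.Ioc 0 ⌊2 * A⌋₊, h c) / 4 - 2 * E ≤
      ∑ c ∈ Finset.Icc ⌈A⌉₊ ⌊2 * A⌋₊, h c := by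
  have hA0 : 0 ≤ A := by linarith
  set i₀ := ⌈A⌉₊ with hi₀
  have a1 : A ≤ i₀ := Nat.le_ceil A
  have a2 : (i₀ : ℝ) < A + 1 := Nat.ceil_lt_add_one hA0
  have hi0 : 0 < i₀ := by
    have : (0 : ℝ) < i₀ := by linarith
    exact_mod_cast this
  have b1 : (⌊2 * A⌋₊ : ℝ) ≤ 2 * A := Nat.floor_le (by linarith)
  have b2 : 2 * A < ⌊2 * A⌋₊ + 1 := Nat.lt_floor_add_one _
  have hle : i₀ ≤ ⌊2 * A⌋₊ := by
    have h1 : (i₀ : ℝ) < ((⌊2 * A⌋₊ + 1 : ℕ) : ℝ) := by push_cast; linarith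
    have h2 : i₀ < ⌊2 * A⌋₊ + 1 := by exact_mod_cast h1
    omega
  obtain ⟨n, hn⟩ : ∃ n, ⌊2 * A⌋₊ = i₀ + n := ⟨⌊2 * A⌋₊ - i₀, by omega⟩
  rw [hn] at b1 b2 hH ⊢
  have hnY : i₀ + n ≤ Y := by
    have h1 : ((i₀ + n : ℕ) : ℝ) < ((Y + 1 : ℕ) : ℝ) := by push_cast at b1 ⊢; linarith
    have h2 : i₀ + n < Y + 1 := by exact_mod_cast h1
    omega
  rw [sum_Icc_eq_sum_range, sum_Ioc_sub_eq h hi0, show i₀ - 1 + (n + 1) = i₀ + n by omega]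
  have e1 := abs_le.1 (hκ (i₀ + n) hnY)
  have e2 := abs_le.1 (hκ (i₀ - 1) (by omega))
  set M : ℝ := ((i₀ + n : ℕ) : ℝ)
  set H := ∑ c ∈ Finset.Ioc 0 (i₀ + n), h c
  have e3 : ((i₀ - 1 : ℕ) : ℝ) ≤ 3 / 4 * M := by
    rw [Nat.cast_sub (by omega)]
    push_cast
    linarith
  have hM0 : 0 < M := by linarith
  have hκ0 : 0 ≤ κ := by
    by_contra hneg
    nlinarith [mul_neg_of_neg_of_pos (not_le.1 hneg) hM0]
  have e4 : κ * ((i₀ - 1 : ℕ) : ℝ) ≤ κ * (3 / 4 * M) := by gcongr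
  nlinarith

open Classical in
/-- The primes not dividing `n` have weight at least `1/2`. -/
lemma sum_roughWeight_ge {n : ℕ} (hn : n ≠ 0) (M : ℕ) :
    ((Nat.primeCounting M : ℝ) - n.divisors.card) / 2 ≤
      ∑ c ∈ Finset.Ioc 0 M, roughWeight n c := by
  set S := (Finset.range (M + 1)).filter fun p => Nat.Prime p ∧ ¬ p ∣ n with hS
  have h1 : (Nat.primeCounting M : ℝ) - n.divisors.card ≤ S.card := by
    have h2 : (Finset.range (M + 1)).filter Nat.Prime ⊆ S ∪ n.divisors := by
      intro p hp
      rw [Finset.mem_filter] at hp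
      by_cases hpn : p ∣ n
      · exact Finset.mem_union_right _ (Nat.mem_divisors.2 ⟨hpn, hn⟩)
      · exact Finset.mem_union_left _ (Finset.mem_filter.2 ⟨hp.1, hp.2, hpn⟩)
    have h3 := (Finset.card_le_card h2).trans (Finset.card_union_le _ _)
    have h4 : Nat.primeCounting M = ((Finset.range (M + 1)).filter Nat.Prime).card := by
      rw [Nat.primeCounting, Nat.primeCounting', Nat.count_eq_card_filter_range]
    rw [← h4] at h3
    have : (Nat.primeCounting M : ℝ) ≤ S.card + n.divisors.card := by exact_mod_cast h3
    linarith
  have h2 : S ⊆ Finset.Ioc 0 M := by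
    intro p hp
    rw [hS, Finset.mem_filter, Finset.mem_range] at hp
    exact Finset.mem_Ioc.2 ⟨hp.2.1.pos, by omega⟩
  calc _ ≤ (S.card : ℝ) / 2 := by linarith
    _ = ∑ _p ∈ S, (1 / 2 : ℝ) := by rw [Finset.sum_const, nsmul_eq_mul]; ring
    _ ≤ ∑ p ∈ S, roughWeight n p := by
      refine Finset.sum_le_sum fun p hp => ?_
      rw [hS, Finset.mem_filter] at hp
      have hp2 : (2 : ℝ) ≤ p := by exact_mod_cast hp.2.1.two_le
      rw [roughWeight, if_pos ⟨hp.2.1.squarefree, (Nat.Prime.coprime_iff_not_dvd hp.2.1).2 hp.2.2⟩,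
        Nat.totient_prime hp.2.1, Nat.cast_sub hp.2.1.one_le, le_div_iff₀ (by linarith)]
      push_cast; linarith
    _ ≤ _ := Finset.sum_le_sum_of_subset_of_nonneg h2 fun c _ _ => roughWeight_nonneg n c

/-- A lower bound for the normalization, from the moduli whose small factor is a fixed prime. -/
lemma Scale.totientSum_ge (hs : Scale Δ N T) : T ^ 1990 ≤ totientSum Δ N := by
  have hT := hs.one_le_T
  have hT0 : 0 < T := by linarith
  have hlarge := hs.large
  have hΔ0 : 0 ≤ Δ := by linarith [hs.one_le]
  obtain ⟨hQ1, hQ2⟩ := hs.Q_bounds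
  obtain ⟨hx1, hx2⟩ := hs.Q_rpow_bounds
  set Q := Δ * √N with hQ
  have hQ0 : 0 < Q := lt_of_lt_of_le (by positivity) hQ1
  set x := Q ^ (1 / 1000 : ℝ) with hx
  obtain ⟨b, hbp, hb1, hb2⟩ := Nat.exists_prime_lt_and_le_two_mul ⌊x⌋₊
    (Nat.floor_pos.2 (by linarith)).ne'
  have hb1' : x < b := (Nat.floor_lt (by linarith)).1 hb1
  have hb2' : (b : ℝ) ≤ 2 * x := by
    calc (b : ℝ) ≤ 2 * ⌊x⌋₊ := by exact_mod_cast hb2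
      _ ≤ 2 * x := by gcongr; exact Nat.floor_le (by linarith)
  have hbT : (b : ℝ) ≤ 2 * T ^ 2 := by linarith
  have hbR : (0 : ℝ) < b := by linarith
  set P := sieveProduct Δ with hP
  have hbP : Nat.Coprime b P := by
    rw [hP, coprime_sieveProduct_iff hΔ0]
    intro p hp hpb
    rw [(Nat.prime_dvd_prime_iff_eq hp hbp).1 hpb]
    exact lt_of_le_of_lt hs.pow_le (lt_of_le_of_lt hx1 hb1')
  have hmem := mem_moduli_iff (N := N) hΔ0 hbp.pos hb1'.le hb2' hbP hbp.squarefree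
  have hE := hs.roughError_le hbT hbP hbp.squarefree
  have hd := hs.card_divisors_le hbT hbP hbp.squarefree
  have hn0 : b * P ≠ 0 := mul_ne_zero hbp.ne_zero (sieveProduct_pos Δ).ne'
  obtain ⟨κ, hκ⟩ := exists_density_roughWeight hn0 ⌊2 * Q⌋₊
  set A := Q / b with hA
  have hAQ : A ≤ Q := div_le_self hQ0.le (by exact_mod_cast hbp.one_le)
  have hA1 : T ^ 997 ≤ A := by
    rw [hA, le_div_iff₀ hbR]
    calc T ^ 997 * b ≤ T ^ 997 * (2 * T ^ 2) := by gcongr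
      _ = 2 * T ^ 999 := by ring
      _ ≤ T ^ 1000 := mul_pow_le_pow hT (by linarith) (by norm_num)
      _ ≤ Q := hQ1
  have hTpow : ∀ m : ℕ, 1 ≤ m → T ≤ T ^ m := fun m hm => le_self_pow₀ hT (by omega)
  have hA2 : 2 ≤ A := by linarith [hTpow 997 (by norm_num)]
  set M := ⌊2 * A⌋₊ with hM
  have hM1 : (M : ℝ) ≤ 2 * A := Nat.floor_le (by linarith)
  have hM2 : A ≤ M := by
    have : 2 * A < M + 1 := Nat.lt_floor_add_one _
    linarith
  have hMT : T ^ 997 ≤ M := hA1.trans hM2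
  -- Chebyshev's lower bound provides enough primes
  have hpi : T ^ 996 / 4 ≤ Nat.primeCounting M := by
    have h1 := Chebyshev.pi_ge M
    have hM3 : (M : ℝ) + 1 ≤ N := by
      rw [hs.N_eq]
      calc (M : ℝ) + 1 ≤ 3 * Q := by linarith
        _ ≤ 3 * T ^ 1001 := by gcongr
        _ ≤ T ^ 2000 := mul_pow_le_pow hT (by linarith) (by norm_num)
    have hM0 : (1 : ℝ) < M := by linarith
    have h2 : Real.log (M + 1) ≤ T := (Real.log_le_log (by linarith) hM3).trans hs.log_le
    have h3 : Real.log M ≤ T :=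
      (Real.log_le_log (by linarith) (by linarith)).trans h2
    have h4 : 0 < Real.log M := Real.log_pos hM0
    have h5 : (1 : ℝ) / 2 ≤ Real.log 2 := by linarith [Real.log_two_gt_d9]
    have h6 : (M : ℝ) / 4 ≤ M * Real.log 2 - Real.log (M + 1) := by
      have : 4 * T ^ 1 ≤ T ^ 997 := mul_pow_le_pow hT (by linarith) (by norm_num)
      rw [pow_one] at this
      nlinarith
    have h7 : T ^ 997 = T ^ 996 * T := by ring
    calc T ^ 996 / 4 = T ^ 997 / 4 / T := by rw [h7]; field_simp
      _ ≤ (M : ℝ) / 4 / T := by gcongr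
      _ ≤ (M : ℝ) / 4 / Real.log M := by gcongr
      _ ≤ (M * Real.log 2 - Real.log (M + 1)) / Real.log M := by gcongr
      _ ≤ _ := h1
  have hH : T ^ 995 ≤ ∑ c ∈ Finset.Ioc 0 M, roughWeight (b * P) c := by
    refine le_trans ?_ (sum_roughWeight_ge hn0 M)
    have h1 : 20 * T ^ 995 ≤ T ^ 996 := mul_pow_le_pow hT (by linarith) (by norm_num)
    have h2 : T ^ 42 ≤ T ^ 995 := pow_le_pow_right₀ hT (by norm_num)
    linarith
  have hE995 : 20 * T ^ 545 ≤ T ^ 995 := mul_pow_le_pow hT (by linarith) (by norm_num)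
  have hE545 : 0 ≤ T ^ 545 := by positivity
  have hdy := sum_dyadic_ge (E := T ^ 545) (fun t ht => (hκ t ht).trans hE) hA2
    (lt_of_le_of_lt (by linarith) (Nat.lt_floor_add_one (2 * Q))) hE545 (by linarith)
  have hdy2 : T ^ 994 ≤ ∑ c ∈ Finset.Icc ⌈A⌉₊ M, roughWeight (b * P) c := by
    have h1 : 20 * T ^ 994 ≤ T ^ 995 := mul_pow_le_pow hT (by linarith) (by norm_num)
    have h2 : 0 ≤ T ^ 994 := by positivity
    linarith
  -- each such cofactor contributes
  have hcontr : ∑ c ∈ Finset.Icc ⌈A⌉₊ M, Q / 2 * roughWeight (b * P) c ≤ totientSum Δ N := by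
    have h1 : ∀ c ∈ Finset.Icc ⌈A⌉₊ M, Q / 2 * roughWeight (b * P) c ≤
        if Squarefree c ∧ Nat.Coprime c (b * P) then ((b * c).totient : ℝ) else 0 := by
      intro c hc
      rw [roughWeight]
      split_ifs with h
      · have hbc : Nat.Coprime b c := (h.2.coprime_dvd_right (dvd_mul_right _ _)).symm
        have hcA : A ≤ c := (Nat.le_ceil A).trans (by exact_mod_cast (Finset.mem_Icc.1 hc).1)
        have hc0 : (0 : ℝ) < c := by linarith
        have hb2 : (2 : ℝ) ≤ b := by exact_mod_cast hbp.two_le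
        rw [Nat.totient_mul hbc, Nat.totient_prime hbp]
        push_cast [hbp.one_le]
        have hQb : Q = b * A := by rw [hA]; field_simp
        calc Q / 2 * ((c.totient : ℝ) / c) = b / 2 * (A / c) * c.totient := by
              rw [hQb]; field_simp
          _ ≤ ((b : ℝ) - 1) * 1 * c.totient := by
              gcongr
              · linarith
              · linarith
              · exact div_le_one_of_le₀ hcA hc0.le
          _ = _ := by ring
      · simp
    refine (Finset.sum_le_sum h1).trans ?_
    rw [← Finset.sum_filter, totientSum]
    rw [← Finset.sum_image (s := (Finset.Icc ⌈A⌉₊ M).filter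
      fun c => Squarefree c ∧ Nat.Coprime c (b * P)) (g := fun c => (b, c))
      (f := fun m : ℕ × ℕ => ((m.1 * m.2).totient : ℝ)) fun c _ c' _ h => by simpa using h]
    refine Finset.sum_le_sum_of_subset_of_nonneg ?_ fun _ _ _ => by positivity
    intro m hm
    rw [Finset.mem_image] at hm
    obtain ⟨c, hc, rfl⟩ := hm
    exact (hmem c).2 (Finset.mem_filter.1 hc)
  rw [← Finset.mul_sum] at hcontr
  refine le_trans ?_ hcontr
  have h1 : T ^ 999 ≤ Q / 2 := by
    have : 2 * T ^ 999 ≤ T ^ 1000 := mul_pow_le_pow hT (by linarith) (by norm_num)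
    linarith
  calc T ^ 1990 ≤ T ^ 1993 := pow_le_pow_right₀ hT (by norm_num)
    _ = T ^ 999 * T ^ 994 := by rw [← pow_add]
    _ ≤ _ := by gcongr

end Sizes

variable {Δ N T : ℝ}

/-! ### The estimate for a fixed `θ` -/

section Pointwise

/-- The properties of a modulus `q = bc`, recorded by its factors, that are used. -/
structure GoodModulus (Δ N T : ℝ) (b c : ℕ) : Prop where
  rough : RoughModulus Δ (b * c)
  squarefree : Squarefree (b * c)
  cube_le : b ^ 3 ≤ b * c
  T_le : T ≤ b
  le_N : ((b * c : ℕ) : ℝ) ≤ N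
  mem_Icc : ((b * c : ℕ) : ℝ) / √N ∈ Set.Icc Δ (2 * Δ)

lemma Scale.goodModulus (hs : Scale Δ N T) (hΔ : 10 < Δ) {m : ℕ × ℕ} (hm : m ∈ moduli Δ N) :
    GoodModulus Δ N T m.1 m.2 := by
  obtain ⟨b, c⟩ := m
  rw [mem_moduli] at hm
  obtain ⟨hb, hc, hQ1, hQ2, hb1, hb2, hp, hsq⟩ := hm
  have hT := hs.one_le_T
  have hlarge := hs.large
  obtain ⟨hT1, hT2⟩ := hs.Q_bounds
  obtain ⟨hx1, hx2⟩ := hs.Q_rpow_bounds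
  have hs0 : 0 < √N := Real.sqrt_pos.2 hs.N_pos
  have hTpow : T ≤ T ^ 1000 := le_self_pow₀ hT (by norm_num)
  have hΔ4 : Δ ^ 4 ≤ Δ ^ 2001 := pow_le_pow_right₀ hs.one_le (by norm_num)
  have hΔ1 : Δ ≤ Δ ^ 2001 := le_self_pow₀ hs.one_le (by norm_num)
  have hcop : ∀ z : ℕ, z ≠ 0 → (z : ℝ) ≤ Δ ^ 2001 → Nat.Coprime (b * c) z := by
    intro z hz hzΔ
    refine Nat.coprime_of_dvd fun p hpp h1 h2 => ?_
    have h3 := hp p hpp h1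
    have h4 : (p : ℝ) ≤ z := by exact_mod_cast Nat.le_of_dvd (Nat.pos_of_ne_zero hz) h2
    linarith
  refine ⟨⟨?_, ?_, ?_⟩, hsq, ?_, hx1.trans hb1, ?_, ?_⟩
  · have : (1 : ℝ) < ((b * c : ℕ) : ℝ) := by linarith
    exact_mod_cast this
  · exact (hcop 4 (by norm_num) (by push_cast; linarith)).symm
  · intro u hu
    rw [mem_shifts] at hu
    refine hcop _ (by rw [Ne, Int.natAbs_eq_zero]; rintro rfl; simpa using hu.1) ?_
    rw [Nat.cast_natAbs]
    exact hu.2.trans hΔ4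
  · have h1 : (b : ℝ) ^ 3 ≤ ((b * c : ℕ) : ℝ) := by
      calc (b : ℝ) ^ 3 ≤ (2 * T ^ 2) ^ 3 := by gcongr; linarith
        _ = 8 * T ^ 6 := by ring
        _ ≤ T ^ 1000 := mul_pow_le_pow hT (by linarith) (by norm_num)
        _ ≤ _ := hT1.trans hQ1
    exact_mod_cast h1
  · rw [hs.N_eq] at *
    calc ((b * c : ℕ) : ℝ) ≤ 2 * T ^ 1001 := by linarith
      _ ≤ T ^ 2000 := mul_pow_le_pow hT (by linarith) (by norm_num)
  · exact ⟨(le_div_iff₀ hs0).2 hQ1, (div_le_iff₀ hs0).2 (by linarith)⟩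

lemma log_pow_le (m : ℕ) {ε : ℝ} (hε : 0 < ε) : ∃ C, 0 ≤ C ∧ ∀ N : ℝ, 1 ≤ N →
    Real.log N ^ m ≤ C * N ^ ε := by
  set δ := ε / (m + 1) with hδ
  have hδ0 : 0 < δ := by positivity
  refine ⟨(1 / δ) ^ m, by positivity, fun N hN => ?_⟩
  have h1 := Real.log_le_rpow_div (x := N) (by linarith) hδ0
  have h2 : 0 ≤ Real.log N := Real.log_nonneg hN
  calc Real.log N ^ m ≤ (N ^ δ / δ) ^ m := by gcongr
    _ = (1 / δ) ^ m * N ^ (δ * m) := by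
      rw [Real.rpow_mul_natCast (by linarith)]; ring
    _ ≤ (1 / δ) ^ m * N ^ ε := by
      gcongr
      rw [hδ, div_mul_eq_mul_div, div_le_iff₀ (by positivity)]
      nlinarith

/-- The errors from the single moduli, relative to `φ(q)`. -/
lemma modulusError_le {ε : ℝ} (hε : 0 < ε) : ∃ C, 0 ≤ C ∧ ∀ (Δ N T : ℝ) (b c : ℕ),
    Scale Δ N T → T = N ^ (1 / 2000 : ℝ) → GoodModulus Δ N T b c →
    modulusError b c ≤ C * Real.log N * N ^ (-(1 / 8000) + ε) * (b * c).totient := by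
  refine ⟨3 * 4 ^ ⌈(4 : ℝ) ^ (1 / ε)⌉₊, by positivity, fun Δ N T b c hs hT hg => ?_⟩
  have hN0 := hs.N_pos
  have hT1 := hs.one_le_T
  have hω := pow_card_primeFactors_le (K := 4) (by norm_num) hε hg.squarefree.ne_zero
  generalize (4 : ℝ) ^ ⌈(4 : ℝ) ^ (1 / ε)⌉₊ = K at hω ⊢
  obtain ⟨q, hq⟩ : ∃ q, q = b * c := ⟨_, rfl⟩
  have hgs := hg.squarefree
  have hle := hg.le_N
  rw [← hq] at hω hgs hle
  rw [modulusError, ← hq]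
  have : NeZero q := ⟨hgs.ne_zero⟩
  have hq1 : (1 : ℝ) ≤ q := by exact_mod_cast NeZero.one_le
  have hK : 0 ≤ K := by
    by_contra hneg
    have h1 : K * (q : ℝ) ^ ε ≤ 0 :=
      mul_nonpos_of_nonpos_of_nonneg (not_le.1 hneg).le (by positivity)
    have h2 : (0 : ℝ) < 4 ^ q.primeFactors.card := by positivity
    linarith
  have h1 : (q : ℝ) ≤ 2 ^ q.primeFactors.card * q.totient := by
    exact_mod_cast le_two_pow_mul_totient hgs
  have h2 : 1 ≤ Real.log N := by
    have := hs.pow_le_log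
    have h3 : (1 : ℝ) ≤ Δ ^ 2001 := one_le_pow₀ hs.one_le
    linarith
  have h3 : Real.log q ≤ Real.log N := Real.log_le_log (by linarith) hle
  have hlq : 0 ≤ Real.log q := Real.log_nonneg hq1
  have h4 : (b : ℝ) ^ (-(1 / 4) : ℝ) ≤ N ^ (-(1 / 8000) : ℝ) := by
    calc (b : ℝ) ^ (-(1 / 4) : ℝ) ≤ T ^ (-(1 / 4) : ℝ) :=
          Real.rpow_le_rpow_of_nonpos (by linarith) hg.T_le (by norm_num)
      _ = N ^ (-(1 / 8000) : ℝ) := by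
          rw [hT, ← Real.rpow_mul hN0.le]; norm_num
  have h5 : (q : ℝ) ^ ε ≤ N ^ ε := by gcongr
  have h6 : (2 : ℝ) ^ q.primeFactors.card * 2 ^ q.primeFactors.card = 4 ^ q.primeFactors.card := by
    rw [← mul_pow]; norm_num
  calc 2 ^ q.primeFactors.card * (2 + Real.log q) * q * (b : ℝ) ^ (-(1 / 4) : ℝ)
      ≤ 2 ^ q.primeFactors.card * (3 * Real.log N) * (2 ^ q.primeFactors.card * q.totient) *
          N ^ (-(1 / 8000) : ℝ) := by
        gcongr
        linarith
    _ = 4 ^ q.primeFactors.card * (3 * Real.log N) * q.totient * N ^ (-(1 / 8000) : ℝ) := by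
        rw [← h6]; ring
    _ ≤ (K * N ^ ε) * (3 * Real.log N) * q.totient * N ^ (-(1 / 8000) : ℝ) := by
        gcongr
        exact hω.trans (by gcongr)
    _ = _ := by
        rw [Real.rpow_add hN0]; ring

/-- Equidistribution of the moduli, with a power saving. -/
lemma Scale.norm_average_moduli_sub_le (hs : Scale Δ N T) {f : ℝ → ℂ} {D : ℝ}
    (hf : ∀ v ∈ Set.Icc Δ (2 * Δ), ‖f v‖ ≤ D ∧
        ∀ v' ∈ Set.Icc Δ (2 * Δ), ‖f v - f v'‖ ≤ D * |v - v'|) :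
    ‖((totientSum Δ N)⁻¹ : ℝ) * ∑ m ∈ moduli Δ N,
        ((m.1 * m.2).totient : ℂ) * f (((m.1 * m.2 : ℕ) : ℝ) / √N) -
      (2 / (3 * Δ ^ 2) : ℝ) * ∫ v in Δ..(2 * Δ), v * f v‖ ≤ T⁻¹ * D := by
  have hT := hs.one_le_T
  have hlarge := hs.large
  have hT0 : 0 < T := by linarith
  have hL := hs.totientSum_ge
  have hL0 : 0 < totientSum Δ N := lt_of_lt_of_le (by positivity) hL
  have hΔ0 : 0 ≤ Δ := by linarith [hs.one_le]
  have hD0 : 0 ≤ D := (norm_nonneg _).trans (hf Δ ⟨le_rfl, by linarith [hs.one_le]⟩).1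
  obtain ⟨hT1, hT2⟩ := hs.Q_bounds
  obtain ⟨hx1, hx2⟩ := hs.Q_rpow_bounds
  have hQ0 : 0 ≤ Δ * √N := by positivity
  refine (MinorArcMoments.norm_average_moduli_sub_le hs.one_le hs.N_pos (E := T ^ 545)
    (one_le_pow₀ hT) (fun b hb => ?_) hL0 hf).trans ?_
  · obtain ⟨-, -, hb2, hbP, hbs⟩ := mem_smallFactors hΔ0 hb
    have hb3 : (b : ℝ) ≤ 2 * T ^ 2 := by linarith
    refine ⟨hb3.trans (le_trans ?_ hT1), hs.roughError_le hb3 hbP hbs⟩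
    exact mul_pow_le_pow hT (by linarith) (by norm_num)
  · have h1 : ((smallFactors Δ N).card : ℝ) ≤ 2 * T ^ 2 :=
      (card_smallFactors_le hQ0).trans (by linarith)
    gcongr
    rw [div_le_iff₀ hL0]
    calc 3 * ((smallFactors Δ N).card * (64 * T ^ 545 * (Δ * √N) * Δ))
        ≤ 3 * (2 * T ^ 2 * (64 * T ^ 545 * T ^ 1001 * T)) := by
          gcongr
          exact hs.Δ_le
      _ = 384 * T ^ 1549 := by ring
      _ ≤ T ^ 1989 := mul_pow_le_pow hT (by linarith) (by norm_num)
      _ = T⁻¹ * T ^ 1990 := by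
          rw [show T ^ 1990 = T * T ^ 1989 by ring, ← mul_assoc, inv_mul_cancel₀ hT0.ne', one_mul]
      _ ≤ _ := by gcongr

/-- The average over `a` and `q` of `R~ᵏ`, as a function of the rescaled `θ`. -/
noncomputable def averagePow (Φ V : ℝ → ℝ) (k : ℕ) (Δ N θ : ℝ) : ℂ :=
  ((totientSum Δ N)⁻¹ : ℝ) * ∑ m ∈ moduli Δ N,
    ∑ h ∈ (Finset.range (m.1 * m.2)).filter (fun h => Nat.Coprime h (m.1 * m.2)),
      Rpow Φ V k Δ (m.1 * m.2) h θ (((m.1 * m.2 : ℕ) : ℝ) / √N)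

/-- The integral over `v` of the main term, as a function of `θ`. -/
noncomputable def limitDensity (Φ V : ℝ → ℝ) (k : ℕ) (Δ θ : ℝ) : ℂ :=
  (2 / (3 * Δ ^ 2) : ℝ) * ∫ v in Δ..(2 * Δ), v * density Φ V k Δ θ v

/-- The asymptotic formula for a fixed `θ`. -/
lemma Cutoffs.norm_averagePow_sub_le (hc : Cutoffs Φ V) (k : ℕ) {ε : ℝ} (hε : 0 < ε) :
    ∃ C, ∀ Δ N θ : ℝ, 10 < Δ → 10 < N → Δ ^ 2001 < Real.log N → |θ| ≤ 1 →
      ‖averagePow Φ V k Δ N θ - limitDensity Φ V k Δ θ‖ ≤ C * N ^ (-(1 / 8000) + ε) := by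
  obtain ⟨C₁, hC₁, h₁⟩ := hc.norm_sum_Rpow_sub_density_le k
  obtain ⟨C₂, hC₂, h₂⟩ := hc.density_regular k
  obtain ⟨C₃, hC₃, h₃⟩ := modulusError_le (half_pos hε)
  obtain ⟨C₀, hC₀, h₀⟩ := log_pow_le (16 * k + 10) (half_pos hε)
  refine ⟨C₁ * C₃ * C₀ + C₂ * C₀, fun Δ N θ hΔ hN hΔN hθ => ?_⟩
  have hs := Scale.of_lt_log hΔ hN hΔN
  obtain ⟨T, hT⟩ : ∃ T, T = N ^ (1 / 2000 : ℝ) := ⟨_, rfl⟩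
  rw [← hT] at hs
  have hΔ1 := hs.one_le
  have hN0 := hs.N_pos
  have hN1 : 1 ≤ N := by linarith
  have hL := hs.totientSum_ge
  have hL0 : 0 < totientSum Δ N :=
    lt_of_lt_of_le (pow_pos (by linarith [hs.one_le_T]) _) hL
  set L := totientSum Δ N with hLdef
  set l := Real.log N with hl
  have hl1 : 1 ≤ l := (one_le_pow₀ hΔ1).trans hs.pow_le_log
  have hΔl : Δ ≤ l := (le_self_pow₀ hΔ1 (by norm_num)).trans hs.pow_le_log
  set D := C₂ * Δ ^ (16 * k + 5) with hD
  have hdens : ∀ v ∈ Set.Icc Δ (2 * Δ), ‖density Φ V k Δ θ v‖ ≤ D ∧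
      ∀ v' ∈ Set.Icc Δ (2 * Δ),
        ‖density Φ V k Δ θ v - density Φ V k Δ θ v'‖ ≤ D * |v - v'| :=
    fun v hv => h₂ θ Δ v hθ hΔ1 hv
  have k1 := hs.norm_average_moduli_sub_le hdens
  set X : ℂ := ((L⁻¹ : ℝ) : ℂ) * ∑ m ∈ moduli Δ N, ((m.1 * m.2).totient : ℂ) *
    density Φ V k Δ θ (((m.1 * m.2 : ℕ) : ℝ) / √N) with hX
  have k2 : ‖averagePow Φ V k Δ N θ - X‖ ≤
      C₁ * Δ ^ (16 * k + 9) * (C₃ * l * N ^ (-(1 / 8000) + ε / 2)) := by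
    rw [averagePow, hX, ← mul_sub, ← Finset.sum_sub_distrib, norm_mul, Complex.norm_real,
      Real.norm_of_nonneg (inv_nonneg.2 hL0.le), inv_mul_le_iff₀ hL0]
    have e1 : L * (C₁ * Δ ^ (16 * k + 9) * (C₃ * l * N ^ (-(1 / 8000) + ε / 2))) =
        ∑ m ∈ moduli Δ N, C₁ * Δ ^ (16 * k + 9) *
          (C₃ * l * N ^ (-(1 / 8000) + ε / 2) * (m.1 * m.2).totient) := by
      rw [← Finset.mul_sum, ← Finset.mul_sum, hLdef, totientSum]; ring
    rw [e1]
    refine norm_sum_le_of_le _ fun m hm => ?_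
    have hg := hs.goodModulus hΔ hm
    refine (h₁ θ Δ _ m.1 m.2 hθ hΔ1 hg.mem_Icc hg.squarefree hg.rough.odd hg.cube_le).trans ?_
    gcongr
    exact h₃ Δ N T m.1 m.2 hs hT hg
  have k3 : ‖averagePow Φ V k Δ N θ - limitDensity Φ V k Δ θ‖ ≤
      C₁ * Δ ^ (16 * k + 9) * (C₃ * l * N ^ (-(1 / 8000) + ε / 2)) + T⁻¹ * D := by
    refine (norm_sub_le_norm_sub_add_norm_sub _ X _).trans (add_le_add k2 ?_)
    rw [limitDensity]
    exact k1
  refine k3.trans ?_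
  have k4 : T⁻¹ ≤ N ^ (-(1 / 8000) : ℝ) := by
    rw [hT, ← Real.rpow_neg hN0.le]
    exact Real.rpow_le_rpow_of_exponent_le hN1 (by norm_num)
  have k5 := h₀ N hN1
  have k6 : Δ ^ (16 * k + 5) ≤ l ^ (16 * k + 10) :=
    (pow_le_pow_left₀ (by linarith) hΔl _).trans (pow_le_pow_right₀ hl1 (by omega))
  have k7 : N ^ (ε / 2) ≤ N ^ ε := Real.rpow_le_rpow_of_exponent_le hN1 (by linarith)
  have k8 : N ^ (-(1 / 8000) + ε) = N ^ (-(1 / 8000) : ℝ) * N ^ ε := Real.rpow_add hN0 _ _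
  have k9 : N ^ (-(1 / 8000) + ε / 2) * N ^ (ε / 2) = N ^ (-(1 / 8000) + ε) := by
    rw [← Real.rpow_add hN0]; congr 1; ring
  have p1 : 0 ≤ N ^ (-(1 / 8000) + ε / 2) := by positivity
  have p2 : 0 ≤ N ^ (-(1 / 8000) : ℝ) := by positivity
  have p3 : 0 ≤ l := by linarith
  calc C₁ * Δ ^ (16 * k + 9) * (C₃ * l * N ^ (-(1 / 8000) + ε / 2)) + T⁻¹ * D
      ≤ C₁ * l ^ (16 * k + 9) * (C₃ * l * N ^ (-(1 / 8000) + ε / 2)) +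
          N ^ (-(1 / 8000) : ℝ) * (C₂ * l ^ (16 * k + 10)) := by
        rw [hD]; gcongr
    _ = C₁ * C₃ * N ^ (-(1 / 8000) + ε / 2) * l ^ (16 * k + 10) +
          N ^ (-(1 / 8000) : ℝ) * (C₂ * l ^ (16 * k + 10)) := by
        rw [show 16 * k + 10 = 16 * k + 9 + 1 by ring, pow_succ]; ring
    _ ≤ C₁ * C₃ * N ^ (-(1 / 8000) + ε / 2) * (C₀ * N ^ (ε / 2)) +
          N ^ (-(1 / 8000) : ℝ) * (C₂ * (C₀ * N ^ ε)) := by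
        gcongr
        exact k5.trans (by gcongr)
    _ = C₁ * C₃ * C₀ * (N ^ (-(1 / 8000) + ε / 2) * N ^ (ε / 2)) +
          C₂ * C₀ * (N ^ (-(1 / 8000) : ℝ) * N ^ ε) := by ring
    _ = _ := by rw [k9, ← k8]; ring

end Pointwise

/-! ### Integration over `θ` -/

section Integration

variable {φ : ℝ → ℝ}

lemma integrable_mul_bump (hφ : Continuous φ) (hφs : HasCompactSupport φ) {f : ℝ → ℂ}
    (hf : Continuous f) : Integrable fun θ => f θ * (φ θ : ℂ) := by
  refine Continuous.integrable_of_hasCompactSupport (by fun_prop) ?_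
  exact (hφs.comp_left (g := fun x : ℝ => (x : ℂ)) (by simp)).mul_left

lemma Cutoffs.Rtilde_pow_of_inverse (hc : Cutoffs Φ V) (k : ℕ) (hs : Scale Δ N T) {b c : ℕ}
    (hg : GoodModulus Δ N T b c) {a h : ℕ} (hh : Nat.Coprime h (b * c))
    (hah : 2 * a * h ≡ 1 [MOD b * c]) (θ : ℝ) :
    Rtilde Φ V Δ N a (b * c) θ ^ k =
      Rpow Φ V k Δ (b * c) h (N * θ) (((b * c : ℕ) : ℝ) / √N) :=
  hc.Rtilde_pow k hs.N_pos hg.rough (hs.one_le.trans hg.mem_Icc.1) hh hah θ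

lemma Cutoffs.integrable_Rtilde_pow (hc : Cutoffs Φ V) (k : ℕ) (hs : Scale Δ N T) {b c : ℕ}
    (hg : GoodModulus Δ N T b c) {a : ℕ} (ha : Nat.Coprime a (b * c)) (hφ : Continuous φ)
    (hφs : HasCompactSupport φ) :
    Integrable fun θ : ℝ => Rtilde Φ V Δ N a (b * c) θ ^ k * (φ (N * θ) : ℂ) := by
  obtain ⟨h, hlt, hh, hah⟩ := exists_inverse hg.rough ha
  simp_rw [hc.Rtilde_pow_of_inverse k hs hg hh hah]
  exact (integrable_mul_bump hφ hφs (hc.continuous_Rpow k hlt.le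
    (hs.one_le.trans hg.mem_Icc.1))).comp_mul_left' hs.N_pos.ne'

lemma Cutoffs.integrable_Rpow_mul (hc : Cutoffs Φ V) (k : ℕ) (hs : Scale Δ N T) {b c : ℕ}
    (hg : GoodModulus Δ N T b c) (hφ : Continuous φ) (hφs : HasCompactSupport φ) {h : ℕ}
    (hh : h ≤ b * c) :
    Integrable fun θ : ℝ => Rpow Φ V k Δ (b * c) h θ (((b * c : ℕ) : ℝ) / √N) * (φ θ : ℂ) :=
  integrable_mul_bump hφ hφs (hc.continuous_Rpow k hh (hs.one_le.trans hg.mem_Icc.1))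

lemma Cutoffs.continuous_averagePow (hc : Cutoffs Φ V) (k : ℕ) (hs : Scale Δ N T) (hΔ : 10 < Δ) :
    Continuous fun θ => averagePow Φ V k Δ N θ := by
  refine continuous_const.mul (continuous_finsetSum _ fun m hm =>
    continuous_finsetSum _ fun h hh => ?_)
  have hg := hs.goodModulus hΔ hm
  exact hc.continuous_Rpow k (Finset.mem_range.1 (Finset.mem_filter.1 hh).1).le
    (hs.one_le.trans hg.mem_Icc.1)

/-- Rescaling `θ` by `N` cancels the factor `N` in the definition of the moment. -/
lemma Cutoffs.moment_eq (hc : Cutoffs Φ V) (k : ℕ) (hs : Scale Δ N T) (hΔ : 10 < Δ)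
    (hφ : Continuous φ) (hφs : HasCompactSupport φ) :
    moment Φ V φ k Δ N = ∫ θ, averagePow Φ V k Δ N θ * (φ θ : ℂ) := by
  have hN0 := hs.N_pos
  set S : ℕ × ℕ → Finset ℕ := fun m =>
    (Finset.range (m.1 * m.2)).filter (fun h => Nat.Coprime h (m.1 * m.2)) with hS
  have hint : ∀ m ∈ moduli Δ N, ∀ h ∈ S m, Integrable fun θ : ℝ =>
      Rpow Φ V k Δ (m.1 * m.2) h θ (((m.1 * m.2 : ℕ) : ℝ) / √N) * (φ θ : ℂ) :=
    fun m hm h hh => hc.integrable_Rpow_mul k hs (hs.goodModulus hΔ hm) hφ hφs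
      (Finset.mem_range.1 (Finset.mem_filter.1 hh).1).le
  have h1 : ∀ m ∈ moduli Δ N,
      ∑ c ∈ (Finset.Icc 1 (m.1 * m.2)).filter (fun c => Nat.Coprime c (m.1 * m.2)),
        ∫ θ : ℝ, Rtilde Φ V Δ N c (m.1 * m.2) θ ^ k * (φ (N * θ) : ℂ) =
      (N⁻¹ : ℝ) * ∑ h ∈ S m,
        ∫ θ : ℝ, Rpow Φ V k Δ (m.1 * m.2) h θ (((m.1 * m.2 : ℕ) : ℝ) / √N) * (φ θ : ℂ) := by
    intro m hm
    have hg := hs.goodModulus hΔ hm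
    rw [Finset.mul_sum]
    refine sum_coprime_reindex hg.rough _ _ fun a h ha hh hlt hah => ?_
    simp_rw [hc.Rtilde_pow_of_inverse k hs hg hh hah]
    rw [Measure.integral_comp_mul_left (fun θ : ℝ =>
      Rpow Φ V k Δ (m.1 * m.2) h θ (((m.1 * m.2 : ℕ) : ℝ) / √N) * (φ θ : ℂ)) N,
      abs_of_pos (inv_pos.2 hN0), Complex.real_smul]
  have h2 : ∀ θ : ℝ, averagePow Φ V k Δ N θ * (φ θ : ℂ) =
      ((totientSum Δ N)⁻¹ : ℝ) * ∑ m ∈ moduli Δ N, ∑ h ∈ S m,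
        Rpow Φ V k Δ (m.1 * m.2) h θ (((m.1 * m.2 : ℕ) : ℝ) / √N) * (φ θ : ℂ) := by
    intro θ
    rw [averagePow, mul_assoc, Finset.sum_mul]
    simp_rw [Finset.sum_mul, hS]
  simp_rw [h2]
  rw [integral_const_mul, integral_finsetSum _ fun m hm => integrable_finsetSum _ (hint m hm),
    Finset.sum_congr rfl fun m hm => integral_finsetSum _ (hint m hm), moment,
    Finset.sum_congr rfl h1, ← Finset.mul_sum, ← mul_assoc, ← Complex.ofReal_mul]
  congr 2
  field_simp

lemma Cutoffs.integral_mainIntegrand_eq (hc : Cutoffs Φ V) {w : ℝ → ℝ} (h₁ : HasCompactSupport w)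
    (h₂ : ContDiff ℝ ∞ w) (h₃ : tsupport w ⊆ Set.Ioo (-1 / 2) (1 / 2)) (h₄ : w 0 = 1) (k : ℕ)
    (hΔ : 1 ≤ Δ) (θ : ℝ) :
    ((2 / (3 * Δ ^ 2) : ℝ) : ℂ) * ∫ v in Set.Icc Δ (2 * Δ), mainIntegrand Φ V w φ k Δ θ v =
      limitDensity Φ V k Δ θ * (φ θ : ℂ) := by
  rw [limitDensity, mul_assoc, intervalIntegral.integral_of_le (by linarith),
    ← integral_Icc_eq_integral_Ioc, ← integral_mul_const]
  congr 1
  exact setIntegral_congr_fun measurableSet_Icc fun v hv =>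
    hc.mainIntegrand_eq h₁ h₂ h₃ h₄ φ k θ hΔ (hΔ.trans hv.1)

end Integration
end MinorArcMoments

theorem proposition1p7
    (Φ V : ℝ → ℝ)
    (hΦ_smooth : ContDiff ℝ ∞ Φ) (hΦ_supp : HasCompactSupport Φ)
    (hΦ_range : ∀ x, 0 ≤ Φ x ∧ Φ x ≤ 1) (hΦ_ne : Φ ≠ 0)
    (hV_smooth : ContDiff ℝ ∞ V) (hV_compact : HasCompactSupport V)
    (hV_supp : tsupport V ⊆ Set.Ioo (1 / 2) 3)
    (hV_range : ∀ x, 0 ≤ V x ∧ V x ≤ 1) (hV_ne : V ≠ 0)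
    (k : ℕ) (ε : ℝ) (hε : 0 < ε) :
    ∃ C : ℝ, ∀ (w φ : ℝ → ℝ) (Δ N : ℝ),
      ContDiff ℝ ∞ w → HasCompactSupport w → tsupport w ⊆ Set.Ioo (-1 / 2) (1 / 2) → w 0 = 1 →
      ContDiff ℝ ∞ φ → (∀ x, 0 ≤ φ x) → tsupport φ ⊆ Set.Icc (-1 / 100) (1 / 100) →
      ∫ x, φ x = 1 →
      10 < Δ → 10 < N → Δ ^ 2001 < Real.log N →
      -- the sums and integrals on the left-hand side converge absolutely
      (∀ m ∈ moduli Δ N, ∀ c : ℕ, Nat.Coprime c (m.1 * m.2) →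
        (∀ θ : ℝ, Summable fun p : B Δ c (m.1 * m.2) => Rterm Φ V N (m.1 * m.2) θ p) ∧
        MeasureTheory.Integrable
          fun θ : ℝ => Rtilde Φ V Δ N c (m.1 * m.2) θ ^ k * (φ (N * θ) : ℂ)) ∧
      -- the sums and integrals on the right-hand side converge absolutely
      (∀ (θ : ℝ) (t u : Fin k → ℝ), MeasureTheory.Integrable (Hintegrand Φ V w θ Δ t u)) ∧
      (∀ θ : ℝ, ∀ v ∈ Set.Icc Δ (2 * Δ),
        Summable fun p : lattice k Δ =>
          Hterm Φ V w θ Δ v (p : (Fin k → ℤ) × (Fin k → ℤ))) ∧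
      MeasureTheory.IntegrableOn
        (fun x : ℝ × ℝ => mainIntegrand Φ V w φ k Δ x.1 x.2)
        (Set.univ ×ˢ Set.Icc Δ (2 * Δ)) ∧
      -- the asymptotic formula
      ‖moment Φ V φ k Δ N - mainTerm Φ V w φ k Δ‖ ≤ C * N ^ (-(1 / 8000) + ε) := by
  have hc : Cutoffs Φ V :=
    ⟨hΦ_smooth, hΦ_supp, hΦ_range, hV_smooth.continuous, hV_supp, hV_range⟩
  obtain ⟨C, hC⟩ := hc.norm_averagePow_sub_le k hε
  refine ⟨C, fun w φ Δ N hw hws hwI hw0 hφ hφ0 hφI hφ1 hΔ hN hΔN => ?_⟩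
  have hs := Scale.of_lt_log hΔ hN hΔN
  have hφc : Continuous φ := hφ.continuous
  have hφs : HasCompactSupport φ :=
    HasCompactSupport.of_support_subset_isCompact isCompact_Icc
      ((subset_tsupport φ).trans hφI)
  have hmain := hc.integrableOn_mainIntegrand hws hw hwI hw0 hφc hφI k hs.one_le
  refine ⟨fun m hm c hcm => ?_, fun θ t u => hc.integrable_Hintegrand hws hw θ Δ t u,
    fun θ v hv => ?_, hmain, ?_⟩
  · have hg := hs.goodModulus hΔ hm
    exact ⟨hc.summable_Rterm hs.N_pos hg.rough (hs.one_le.trans hg.mem_Icc.1) hcm,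
      hc.integrable_Rtilde_pow k hs hg hcm hφc hφs⟩
  · exact summable_subtype_iff_indicator.2 (summable_indicator_Hterm hc hws hw θ
      (by linarith) (hs.one_le.trans hv.1))
  · have hi1 := integrable_mul_bump hφc hφs (hc.continuous_averagePow k hs hΔ)
    have hi2 : MeasureTheory.Integrable fun θ => limitDensity Φ V k Δ θ * (φ θ : ℂ) := by
      have h1 : MeasureTheory.Integrable (fun x : ℝ × ℝ => mainIntegrand Φ V w φ k Δ x.1 x.2)
          (MeasureTheory.volume.prod (MeasureTheory.volume.restrict (Set.Icc Δ (2 * Δ)))) := by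
        have h2 := hmain
        rwa [MeasureTheory.IntegrableOn, MeasureTheory.Measure.volume_eq_prod,
          ← MeasureTheory.Measure.prod_restrict, MeasureTheory.Measure.restrict_univ] at h2
      refine (h1.integral_prod_left.const_mul ((2 / (3 * Δ ^ 2) : ℝ) : ℂ)).congr
        (Filter.Eventually.of_forall fun θ => ?_)
      exact hc.integral_mainIntegrand_eq hws hw hwI hw0 k hs.one_le θ
    have hm2 : mainTerm Φ V w φ k Δ = ∫ θ, limitDensity Φ V k Δ θ * (φ θ : ℂ) := by
      rw [mainTerm, ← MeasureTheory.integral_const_mul]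
      exact MeasureTheory.integral_congr_ae (Filter.Eventually.of_forall fun θ =>
        hc.integral_mainIntegrand_eq hws hw hwI hw0 k hs.one_le θ)
    rw [hc.moment_eq k hs hΔ hφc hφs, hm2, ← MeasureTheory.integral_sub hi1 hi2]
    have hb : ∀ θ, ‖averagePow Φ V k Δ N θ * (φ θ : ℂ) - limitDensity Φ V k Δ θ * (φ θ : ℂ)‖ ≤
        C * N ^ (-(1 / 8000) + ε) * φ θ := by
      intro θ
      rw [← sub_mul, norm_mul, Complex.norm_real, Real.norm_of_nonneg (hφ0 θ)]
      by_cases hθ : φ θ = 0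
      · rw [hθ, mul_zero, mul_zero]
      · have h1 := hφI (subset_tsupport φ hθ)
        refine mul_le_mul_of_nonneg_right (hC Δ N θ hΔ hN hΔN ?_) (hφ0 θ)
        rw [abs_le]
        constructor <;> linarith [h1.1, h1.2]
    refine (MeasureTheory.norm_integral_le_of_norm_le
      ((hφc.integrable_of_hasCompactSupport hφs).const_mul _)
      (Filter.Eventually.of_forall hb)).trans_eq ?_
    rw [MeasureTheory.integral_const_mul, hφ1, mul_one]
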